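/- Let $\mathbb N=\{1,2,\dots\}$, $\mathcal H=\ell^2(\mathbb N)$, and let $H_0$ be the discrete Dirichlet Laplacian $(H_0x)[n]=2x[n]-x[n+1]-x[n-1]$ with $x[0]=0$. For $s\ge 0$ let $\mathcal L^s=\{x:\sum_n(1+n^2)^{s/2}|x[n]|<\infty\}$, $(\mathcal L^s)^*=\{x:\sup_n(1+n^2)^{-s/2}|x[n]|<\infty\}$ with their natural norms, and let $\mathcal B^s$ be the space of bounded operators $\mathcal L^s\to(\mathcal L^s)^*$ (for $t\le s$, $\mathcal B^t\subset\mathcal B^s$ by restriction). Let $\beta\ge 1$ be an integer and let $V$ be a bounded self-adjoint operator on $\mathcal H$ with $V=vUv^*$, where, for some complex Hilbert space $\mathcal K$, $v:\mathcal K\to\mathcal L^\beta$ is bounded, injective, and compact as a map into $\mathcal L^1$, and $U$ is a self-adjoint unitary operator on $\mathcal K$; then $V$ extends to a bounded operator $(\mathcal L^\beta)^*\to\mathcal L^\beta$. Put $H=H_0+V$ and $R(\kappa)=(H+\kappa^2)^{-1}$ for $\operatorname{Re}\kappa>0$. Let $$\widetilde{\mathcal E}=\{\Psi\in(\mathcal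 L^\beta)^*: H\Psi=0\},\quad \mathcal E=\widetilde{\mathcal E}\cap(\mathbb C\mathbf 1+\mathcal L^{\beta-2}),\quad \mathsf E=\widetilde{\mathcal E}\cap\mathcal L^{\beta-2},$$ where $\mathbf 1[n]=1$ for all $n$ and $\mathcal L^{-1}$ is defined by the same formula. The threshold $0$ is regular if $\mathcal E=\mathsf E=\{0\}$; exceptional of the first kind if $\mathcal E\supsetneq\mathsf E=\{0\}$, of the second kind if $\mathcal E=\mathsf E\supsetneq\{0\}$, of the third kind if $\mathcal E\supsetneq\mathsf E\supsetneq\{0\}$. Assume $\beta\ge\beta_0$ and set, according to the type, - regular: $\beta_0=2$, $a=0$, $J=\beta-2$, $s=\beta$; - first kind: $\beta_0=3$, $a=-1$, $J=\beta-4$, $s=\beta-1$; - second or third kind: $\beta_0=4$, $a=-2$, $J=\beta-6$, $s=\beta-2$. Then $\mathsf E$ is a closed subspace of $\mathcal H$; let $P_0$ be the orthogonal projection of $\mathcal H$ onto $\mathsf E$. As $\kappa\to0$ with $\operatorname{Re}\kappa>0$, the operator $H+\kappa^2$ is invertible and there is an expansion $$R(\kappa)=\sum_{j=a}^{J}\kappa^jG_j+O(\kappa^{J+1})\quad\text{in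 }\mathcal B^{s},$$ where in the regular case $G_j\in\mathcal B^{j+1}$ for $j$ even and $G_j\in\mathcal B^{j}$ for $j$ odd, and in the exceptional cases $G_j\in\mathcal B^{j+3}$ for $j$ even and $G_j\in\mathcal B^{j+2}$ for $j$ odd. With the convention $G_j=0$ for $j<a$, the coefficients of every such expansion satisfy, as operators from $\mathcal L^s$ to $(\mathcal L^s)^*$ and for all indices $j\le J$, $$HG_j=G_jH=0\ \ (j=-2,-1),\qquad HG_0=G_0H=I-P_0,\qquad HG_j=G_jH=-G_{j-2}\ \ (j\ge1).$$ -/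

import Mathlib

open Filter Topology Asymptotics
open scoped InnerProductSpace

noncomputable section

namespace HalfLine

/-! Sequence spaces on the half-line `ℕ+ = {1, 2, 3, …}` -/

/-- The weight `(1 + n²)^(s/2)`. -/
def weight (s : ℝ) (n : ℕ+) : ℝ := (1 + (n : ℝ) ^ 2) ^ (s / 2)

theorem weight_pos (s : ℝ) (n : ℕ+) : 0 < weight s n := by
  unfold weight; positivity

theorem weight_mono {s t : ℝ} (h : s ≤ t) (n : ℕ+) : weight s n ≤ weight t n := by
  unfold weight
  apply Real.rpow_le_rpow_of_exponent_le
  · nlinarith [sq_nonneg (n : ℝ)]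
  · linarith

theorem one_le_weight {s : ℝ} (h : 0 ≤ s) (n : ℕ+) : 1 ≤ weight s n := by
  have := weight_mono h n
  simpa [weight] using this

theorem weight_neg_mul (s : ℝ) (n : ℕ+) : weight (-s) n * weight s n = 1 := by
  unfold weight
  rw [← Real.rpow_add (by positivity)]
  have : -s / 2 + s / 2 = 0 := by ring
  rw [this, Real.rpow_zero]

theorem weight_succ_le {s : ℝ} (h : 0 ≤ s) (n : ℕ+) : weight s n ≤ weight s (n + 1) := by
  unfold weight
  apply Real.rpow_le_rpow (by positivity) _ (by linarith)
  have : (0 : ℝ) ≤ n := by positivity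
  push_cast
  nlinarith

theorem weight_le_succ {s : ℝ} (h : 0 ≤ s) (n : ℕ+) :
    weight s (n + 1) ≤ 5 ^ (s / 2) * weight s n := by
  unfold weight
  rw [← Real.mul_rpow (by norm_num) (by positivity)]
  apply Real.rpow_le_rpow (by positivity) _ (by linarith)
  have : (1 : ℝ) ≤ n := by exact_mod_cast (_root_.one_le : 1 ≤ n)
  push_cast
  nlinarith

/-- The set of sequences underlying `𝓛^s = ℓ^{1,s}(ℕ+)`. -/
def l1Sub (s : ℝ) : Submodule ℂ (ℕ+ → ℂ) where
  carrier := {x | Summable fun n => weight s n * ‖x n‖}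
  zero_mem' := by simp
  add_mem' := by
    intro x y hx hy
    refine Summable.of_nonneg_of_le (fun n => ?_) (fun n => ?_) (Summable.add hx hy)
    · exact mul_nonneg (weight_pos s n).le (norm_nonneg _)
    · rw [← mul_add]
      exact mul_le_mul_of_nonneg_left (norm_add_le _ _) (weight_pos s n).le
  smul_mem' := by
    intro c x hx
    refine (Summable.mul_left ‖c‖ hx).congr (fun n => ?_)
    simp only [Pi.smul_apply, norm_smul]
    ring

/-- The set of sequences underlying `(𝓛^s)^* = ℓ^{∞,-s}(ℕ+)`. -/
def lInfSub (s : ℝ) : Submodule ℂ (ℕ+ → ℂ) where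
  carrier := {x | BddAbove (Set.range fun n => weight (-s) n * ‖x n‖)}
  zero_mem' := ⟨0, by rintro _ ⟨n, rfl⟩; simp⟩
  add_mem' := by
    rintro x y ⟨a, ha⟩ ⟨b, hb⟩
    refine ⟨a + b, ?_⟩
    rintro _ ⟨n, rfl⟩
    have h1 := ha ⟨n, rfl⟩
    have h2 := hb ⟨n, rfl⟩
    have h3 := mul_le_mul_of_nonneg_left (norm_add_le (x n) (y n)) (weight_pos (-s) n).le
    simp only [Pi.add_apply] at *
    linarith
  smul_mem' := by
    rintro c x ⟨a, ha⟩
    refine ⟨‖c‖ * a, ?_⟩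
    rintro _ ⟨n, rfl⟩
    have h1 := mul_le_mul_of_nonneg_left (ha ⟨n, rfl⟩) (norm_nonneg c)
    simp only [Pi.smul_apply, norm_smul] at *
    linarith

/-- `𝓛^s = ℓ^{1,s}(ℕ+)`, normed by `‖x‖ = ∑ (1+n²)^{s/2} |x[n]|`. -/
def LOne (s : ℝ) : Type := ↥(l1Sub s)

/-- `(𝓛^s)^* = ℓ^{∞,-s}(ℕ+)`, normed by `‖x‖ = sup (1+n²)^{-s/2} |x[n]|`. -/
def LInf (s : ℝ) : Type := ↥(lInfSub s)

instance (s : ℝ) : AddCommGroup (LOne s) := inferInstanceAs (AddCommGroup ↥(l1Sub s))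
instance (s : ℝ) : Module ℂ (LOne s) := inferInstanceAs (Module ℂ ↥(l1Sub s))
instance (s : ℝ) : AddCommGroup (LInf s) := inferInstanceAs (AddCommGroup ↥(lInfSub s))
instance (s : ℝ) : Module ℂ (LInf s) := inferInstanceAs (Module ℂ ↥(lInfSub s))

/-- The sequence underlying an element of `𝓛^s`. -/
def LOne.seq {s : ℝ} : LOne s →ₗ[ℂ] (ℕ+ → ℂ) := (l1Sub s).subtype

/-- The sequence underlying an element of `(𝓛^s)^*`. -/
def LInf.seq {s : ℝ} : LInf s →ₗ[ℂ] (ℕ+ → ℂ) := (lInfSub s).subtype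

theorem LOne.summable {s : ℝ} (x : LOne s) : Summable fun n => weight s n * ‖x.seq n‖ := x.2

theorem LInf.bddAbove {s : ℝ} (x : LInf s) :
    BddAbove (Set.range fun n => weight (-s) n * ‖x.seq n‖) := x.2

theorem LOne.ext {s : ℝ} {x y : LOne s} (h : x.seq = y.seq) : x = y := Subtype.ext h

theorem LInf.ext {s : ℝ} {x y : LInf s} (h : x.seq = y.seq) : x = y := Subtype.ext h

instance (s : ℝ) : Norm (LOne s) := ⟨fun x => ∑' n, weight s n * ‖x.seq n‖⟩
instance (s : ℝ) : Norm (LInf s) := ⟨fun x => ⨆ n, weight (-s) n * ‖x.seq n‖⟩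

theorem LOne.norm_def {s : ℝ} (x : LOne s) : ‖x‖ = ∑' n, weight s n * ‖x.seq n‖ := rfl
theorem LInf.norm_def {s : ℝ} (x : LInf s) : ‖x‖ = ⨆ n, weight (-s) n * ‖x.seq n‖ := rfl

theorem LInf.le_norm {s : ℝ} (x : LInf s) (n : ℕ+) : weight (-s) n * ‖x.seq n‖ ≤ ‖x‖ :=
  le_ciSup x.bddAbove n

theorem LInf.norm_le {s : ℝ} (x : LInf s) {C : ℝ}
    (h : ∀ n, weight (-s) n * ‖x.seq n‖ ≤ C) : ‖x‖ ≤ C := ciSup_le h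

theorem LInf.apply_le {s : ℝ} (x : LInf s) (n : ℕ+) : ‖x.seq n‖ ≤ ‖x‖ * weight s n := by
  have h := mul_le_mul_of_nonneg_right (x.le_norm n) (weight_pos s n).le
  calc ‖x.seq n‖ = (weight (-s) n * weight s n) * ‖x.seq n‖ := by rw [weight_neg_mul, one_mul]
    _ = weight (-s) n * ‖x.seq n‖ * weight s n := by ring
    _ ≤ _ := h

theorem LOne.core (s : ℝ) : NormedSpace.Core ℂ (LOne s) where
  norm_nonneg x := tsum_nonneg fun n => mul_nonneg (weight_pos s n).le (norm_nonneg _)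
  norm_smul c x := by
    rw [LOne.norm_def, LOne.norm_def, ← tsum_mul_left]
    refine tsum_congr fun n => ?_
    simp only [map_smul, Pi.smul_apply, norm_smul]
    ring
  norm_triangle x y := by
    rw [LOne.norm_def, LOne.norm_def, LOne.norm_def, ← x.summable.tsum_add y.summable]
    refine (x + y).summable.tsum_le_tsum (fun n => ?_) (x.summable.add y.summable)
    rw [← mul_add, map_add]
    exact mul_le_mul_of_nonneg_left (norm_add_le _ _) (weight_pos s n).le
  norm_eq_zero_iff x := by
    have h0 : ∀ n, 0 ≤ weight s n * ‖x.seq n‖ := fun n =>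
      mul_nonneg (weight_pos s n).le (norm_nonneg _)
    constructor
    · intro h
      rw [LOne.norm_def] at h
      have h1 := (hasSum_zero_iff_of_nonneg h0).1 (h ▸ x.summable.hasSum)
      apply LOne.ext
      funext n
      have h2 := congrFun h1 n
      simpa [(weight_pos s n).ne'] using h2
    · rintro rfl
      simp [LOne.norm_def]

theorem LInf.core (s : ℝ) : NormedSpace.Core ℂ (LInf s) where
  norm_nonneg x := Real.iSup_nonneg fun n => mul_nonneg (weight_pos (-s) n).le (norm_nonneg _)
  norm_smul c x := by
    rw [LInf.norm_def, LInf.norm_def, Real.mul_iSup_of_nonneg (norm_nonneg c)]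
    congr 1
    funext n
    simp only [map_smul, Pi.smul_apply, norm_smul]
    ring
  norm_triangle x y := by
    refine LInf.norm_le _ fun n => ?_
    have h1 := x.le_norm n
    have h2 := y.le_norm n
    have h3 := mul_le_mul_of_nonneg_left (norm_add_le (x.seq n) (y.seq n)) (weight_pos (-s) n).le
    rw [map_add, Pi.add_apply]
    linarith
  norm_eq_zero_iff x := by
    constructor
    · intro h
      apply LInf.ext
      funext n
      have h1 := x.apply_le n
      rw [h, zero_mul] at h1
      simpa using h1
    · rintro rfl
      simp [LInf.norm_def]

instance (s : ℝ) : NormedAddCommGroup (LOne s) := NormedAddCommGroup.ofCore (LOne.core s)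
instance (s : ℝ) : NormedSpace ℂ (LOne s) := NormedSpace.ofCore (LOne.core s)
instance (s : ℝ) : NormedAddCommGroup (LInf s) := NormedAddCommGroup.ofCore (LInf.core s)
instance (s : ℝ) : NormedSpace ℂ (LInf s) := NormedSpace.ofCore (LInf.core s)

/-- `𝓑^s`, the bounded operators from `𝓛^s` to `(𝓛^s)^*`, with the operator norm. -/
abbrev BOp (s : ℝ) : Type := LOne s →L[ℂ] LInf s

/-- The Hilbert space `𝓗 = ℓ²(ℕ+)`. -/
abbrev Hil : Type := lp (fun _ : ℕ+ => ℂ) 2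

/-- The sequence underlying an element of `𝓗`. -/
def hilSeq : Hil →ₗ[ℂ] (ℕ+ → ℂ) where
  toFun x := x
  map_add' _ _ := rfl
  map_smul' _ _ := rfl

/-! The inclusions `𝓛^t ⊆ 𝓛^s`, `(𝓛^s)^* ⊆ (𝓛^t)^*` for `s ≤ t`, and
`𝓛^s ⊆ 𝓗 ⊆ (𝓛^s)^*` for `0 ≤ s`. All of them keep the underlying sequence. -/

/-- The inclusion `𝓛^t ⊆ 𝓛^s` for `s ≤ t`. -/
def LOne.incl {s t : ℝ} (h : s ≤ t) : LOne t →L[ℂ] LOne s :=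
  have key : ∀ (x : LOne t) (n : ℕ+), weight s n * ‖x.seq n‖ ≤ weight t n * ‖x.seq n‖ :=
    fun _ n => mul_le_mul_of_nonneg_right (weight_mono h n) (norm_nonneg _)
  have hs : ∀ x : LOne t, Summable fun n => weight s n * ‖x.seq n‖ := fun x =>
    Summable.of_nonneg_of_le (fun n => mul_nonneg (weight_pos s n).le (norm_nonneg _))
      (key x) x.summable
  LinearMap.mkContinuous
    { toFun := fun x => (⟨x.seq, hs x⟩ : LOne s)
      map_add' := fun _ _ => rfl
      map_smul' := fun _ _ => rfl } 1
    (fun x => by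
      rw [one_mul]
      exact (hs x).tsum_le_tsum (key x) x.summable)

/-- The inclusion `(𝓛^s)^* ⊆ (𝓛^t)^*` for `s ≤ t`. -/
def LInf.incl {s t : ℝ} (h : s ≤ t) : LInf s →L[ℂ] LInf t :=
  have key : ∀ (x : LInf s) (n : ℕ+), weight (-t) n * ‖x.seq n‖ ≤ ‖x‖ := fun x n =>
    (mul_le_mul_of_nonneg_right (weight_mono (neg_le_neg h) n) (norm_nonneg _)).trans (x.le_norm n)
  LinearMap.mkContinuous
    { toFun := fun x => (⟨x.seq, ⟨‖x‖, by rintro _ ⟨n, rfl⟩; exact key x n⟩⟩ : LInf t)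
      map_add' := fun _ _ => rfl
      map_smul' := fun _ _ => rfl } 1
    (fun x => by
      rw [one_mul]
      exact LInf.norm_le _ (key x))

theorem LOne.sq_summable {s : ℝ} (hs : 0 ≤ s) (x : LOne s) :
    (Summable fun n => ‖x.seq n‖ ^ 2) ∧ ∑' n, ‖x.seq n‖ ^ 2 ≤ ‖x‖ ^ 2 := by
  have h1 : ∀ n, ‖x.seq n‖ ≤ weight s n * ‖x.seq n‖ := fun n =>
    le_mul_of_one_le_left (norm_nonneg _) (one_le_weight hs n)
  have h2 : ∀ n, weight s n * ‖x.seq n‖ ≤ ‖x‖ := fun n =>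
    x.summable.le_tsum n fun m _ => mul_nonneg (weight_pos s m).le (norm_nonneg _)
  have h3 : ∀ n, ‖x.seq n‖ ^ 2 ≤ weight s n * ‖x.seq n‖ * ‖x‖ := fun n => by
    rw [sq]
    exact mul_le_mul (h1 n) ((h1 n).trans (h2 n)) (norm_nonneg _)
      (mul_nonneg (weight_pos s n).le (norm_nonneg _))
  have h4 : Summable fun n => ‖x.seq n‖ ^ 2 :=
    Summable.of_nonneg_of_le (fun n => by positivity) h3 (x.summable.mul_right _)
  refine ⟨h4, (h4.tsum_le_tsum h3 (x.summable.mul_right _)).trans ?_⟩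
  rw [tsum_mul_right, ← LOne.norm_def, sq]

theorem memHil_iff (x : ℕ+ → ℂ) :
    Memℓp (E := fun _ : ℕ+ => ℂ) x 2 ↔ Summable fun n => ‖x n‖ ^ 2 := by
  rw [memℓp_gen_iff (by norm_num)]
  simp

theorem hil_norm_sq (x : Hil) : ‖x‖ ^ 2 = ∑' n, ‖x n‖ ^ 2 := by
  have := lp.norm_rpow_eq_tsum (p := 2) (by norm_num) x
  simpa using this

/-- The inclusion `𝓛^s ⊆ 𝓗` for `0 ≤ s`. -/
def LOne.toHil {s : ℝ} (hs : 0 ≤ s) : LOne s →L[ℂ] Hil :=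
  LinearMap.mkContinuous
    { toFun := fun x => (⟨x.seq, (memHil_iff _).2 (x.sq_summable hs).1⟩ : Hil)
      map_add' := fun _ _ => rfl
      map_smul' := fun _ _ => rfl } 1
    (fun x => by
      rw [one_mul]
      refine (pow_le_pow_iff_left₀ (norm_nonneg _) (by positivity) two_ne_zero).1 ?_
      rw [hil_norm_sq]
      exact (x.sq_summable hs).2)

/-- The inclusion `𝓗 ⊆ (𝓛^s)^*` for `0 ≤ s`. -/
def hilToInf {s : ℝ} (hs : 0 ≤ s) : Hil →L[ℂ] LInf s :=
  have key : ∀ (x : Hil) (n : ℕ+), weight (-s) n * ‖x n‖ ≤ ‖x‖ := fun x n => by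
    have h1 : weight (-s) n ≤ 1 := by
      have := weight_mono (s := -s) (t := 0) (by linarith) n
      simpa [weight] using this
    exact (mul_le_of_le_one_left (norm_nonneg _) h1).trans
      (lp.norm_apply_le_norm (by norm_num) x n)
  LinearMap.mkContinuous
    { toFun := fun x => (⟨x, ⟨‖x‖, by rintro _ ⟨n, rfl⟩; exact key x n⟩⟩ : LInf s)
      map_add' := fun _ _ => rfl
      map_smul' := fun _ _ => rfl } 1
    (fun x => by
      rw [one_mul]
      exact LInf.norm_le _ (key x))

/-- An operator on `𝓗` viewed in `𝓑^s`, for `0 ≤ s`. -/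
def toBOp {s : ℝ} (hs : 0 ≤ s) (T : Hil →L[ℂ] Hil) : BOp s :=
  (hilToInf hs).comp (T.comp (LOne.toHil hs))

/-- `G ∈ 𝓑^s` belongs to the smaller space `𝓑^t`, `t ≤ s`. -/
def MemB {s : ℝ} (t : ℝ) (G : BOp s) : Prop :=
  ∃ (h : t ≤ s) (T : BOp t), G = (LInf.incl h).comp (T.comp (LOne.incl h))

/-! The free Laplacian -/

/-- `(S x)[n] = x[n-1]`, with `x[0] = 0`. -/
def shiftR (x : ℕ+ → ℂ) : ℕ+ → ℂ := fun n => if n = 1 then 0 else x (n - 1)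

/-- `(H₀ x)[n] = 2 x[n] - x[n+1] - x[n-1]`, with the Dirichlet convention `x[0] = 0`. -/
def freeLap : (ℕ+ → ℂ) →ₗ[ℂ] (ℕ+ → ℂ) where
  toFun x := fun n => 2 * x n - x (n + 1) - shiftR x n
  map_add' x y := by
    funext n
    simp only [shiftR, Pi.add_apply]
    split_ifs <;> ring
  map_smul' c x := by
    funext n
    simp only [shiftR, Pi.smul_apply, smul_eq_mul, RingHom.id_apply]
    split_ifs <;> ring

theorem freeLap_apply (x : ℕ+ → ℂ) (n : ℕ+) :
    freeLap x n = 2 * x n - x (n + 1) - shiftR x n := rfl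

theorem shiftR_one (x : ℕ+ → ℂ) : shiftR x 1 = 0 := by simp [shiftR]

theorem shiftR_succ (x : ℕ+ → ℂ) (n : ℕ+) : shiftR x (n + 1) = x n := by
  have h : n + 1 ≠ 1 := by
    intro h
    have := congrArg PNat.val h
    simp at this
  simp [shiftR, h]

theorem succ_injective : Function.Injective fun n : ℕ+ => n + 1 := fun _ _ h => by simpa using h

theorem hasSum_shift {f g : ℕ+ → ℝ} {a : ℝ} (h1 : g 1 = 0) (h2 : ∀ n, g (n + 1) = f n)
    (hf : HasSum f a) : HasSum g a := by
  have h : f = g ∘ fun n => n + 1 := by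
    funext n
    simp [h2]
  rw [h] at hf
  refine (succ_injective.hasSum_iff ?_).1 hf
  intro n hn
  by_cases h' : n = 1
  · rw [h', h1]
  · obtain ⟨m, rfl⟩ := PNat.exists_eq_succ_of_ne_one h'
    exact absurd ⟨m, rfl⟩ hn

theorem norm_freeLap_sq_le (x : ℕ+ → ℂ) (n : ℕ+) :
    ‖freeLap x n‖ ^ 2 ≤
      12 * ‖x n‖ ^ 2 + 3 * ‖x (n + 1)‖ ^ 2 + 3 * ‖shiftR x n‖ ^ 2 := by
  have h : ‖freeLap x n‖ ≤ 2 * ‖x n‖ + ‖x (n + 1)‖ + ‖shiftR x n‖ := by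
    rw [freeLap_apply]
    refine (norm_sub_le _ _).trans (add_le_add_left ((norm_sub_le _ _).trans ?_) _)
    simp
  have h0 := norm_nonneg (freeLap x n)
  have h' := pow_le_pow_left₀ h0 h 2
  nlinarith [sq_nonneg (2 * ‖x n‖ - ‖x (n + 1)‖), sq_nonneg (2 * ‖x n‖ - ‖shiftR x n‖),
    sq_nonneg (‖x (n + 1)‖ - ‖shiftR x n‖)]

theorem freeLap_hil (x : Hil) :
    (Summable fun n => ‖freeLap x n‖ ^ 2) ∧ ∑' n, ‖freeLap x n‖ ^ 2 ≤ 18 * ‖x‖ ^ 2 := by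
  have hx : Summable fun n => ‖x n‖ ^ 2 := (memHil_iff _).1 (lp.memℓp x)
  have hl : Summable fun n => ‖x (n + 1)‖ ^ 2 := hx.comp_injective succ_injective
  have hr : HasSum (fun n => ‖shiftR x n‖ ^ 2) (∑' n, ‖x n‖ ^ 2) :=
    hasSum_shift (by simp [shiftR_one]) (fun n => by rw [shiftR_succ]) hx.hasSum
  have hl' : ∑' n, ‖x (n + 1)‖ ^ 2 ≤ ∑' n, ‖x n‖ ^ 2 :=
    hl.tsum_le_tsum_of_inj (fun n : ℕ+ => n + 1) succ_injective (fun n _ => by positivity)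
      (fun n => le_rfl) hx
  have hS := ((hx.mul_left 12).add (hl.mul_left 3)).add (hr.summable.mul_left 3)
  have hF : Summable fun n => ‖freeLap x n‖ ^ 2 :=
    Summable.of_nonneg_of_le (fun n => by positivity) (norm_freeLap_sq_le x) hS
  refine ⟨hF, (hF.tsum_le_tsum (norm_freeLap_sq_le x) hS).trans ?_⟩
  rw [((hx.mul_left 12).add (hl.mul_left 3)).tsum_add (hr.summable.mul_left 3),
    (hx.mul_left 12).tsum_add (hl.mul_left 3), tsum_mul_left, tsum_mul_left, tsum_mul_left,
    hr.tsum_eq, hil_norm_sq]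
  linarith

/-- The free Laplacian `H₀` on `𝓗`. -/
def freeHil : Hil →L[ℂ] Hil :=
  LinearMap.mkContinuous
    { toFun := fun x => (⟨freeLap x, (memHil_iff _).2 (freeLap_hil x).1⟩ : Hil)
      map_add' := fun x y => Subtype.ext (freeLap.map_add x y)
      map_smul' := fun c x => Subtype.ext (freeLap.map_smul c x) } 5
    (fun x => by
      refine (pow_le_pow_iff_left₀ (norm_nonneg _) (by positivity) two_ne_zero).1 ?_
      rw [hil_norm_sq, mul_pow]
      exact (freeLap_hil x).2.trans (by nlinarith [sq_nonneg ‖x‖]))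

theorem norm_freeLap_le (x : ℕ+ → ℂ) (n : ℕ+) :
    ‖freeLap x n‖ ≤ 2 * ‖x n‖ + ‖x (n + 1)‖ + ‖shiftR x n‖ := by
  rw [freeLap_apply]
  refine (norm_sub_le _ _).trans (add_le_add_left ((norm_sub_le _ _).trans ?_) _)
  simp

theorem freeLap_mem_l1 {s : ℝ} (hs : 0 ≤ s) (x : LOne s) : freeLap x.seq ∈ l1Sub s := by
  have hl : Summable fun n => weight s (n + 1) * ‖x.seq (n + 1)‖ :=
    x.summable.comp_injective succ_injective
  have hl' : Summable fun n => weight s n * ‖x.seq (n + 1)‖ :=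
    Summable.of_nonneg_of_le (fun n => mul_nonneg (weight_pos s n).le (norm_nonneg _))
      (fun n => mul_le_mul_of_nonneg_right (weight_succ_le hs n) (norm_nonneg _)) hl
  have hr0 : Summable fun n => weight s (n + 1) * ‖x.seq n‖ :=
    Summable.of_nonneg_of_le (fun n => mul_nonneg (weight_pos s _).le (norm_nonneg _))
      (fun n => by
        have := mul_le_mul_of_nonneg_right (weight_le_succ hs n) (norm_nonneg (x.seq n))
        rwa [mul_assoc] at this) (x.summable.mul_left (5 ^ (s / 2)))
  have hr : Summable fun n => weight s n * ‖shiftR x.seq n‖ :=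
    (hasSum_shift (by simp [shiftR_one]) (fun n => by rw [shiftR_succ]) hr0.hasSum).summable
  refine Summable.of_nonneg_of_le (fun n => mul_nonneg (weight_pos s n).le (norm_nonneg _))
    (fun n => ?_) (((x.summable.mul_left 2).add hl').add hr)
  have := mul_le_mul_of_nonneg_left (norm_freeLap_le x.seq n) (weight_pos s n).le
  linarith

theorem freeLap_mem_lInf {s : ℝ} (hs : 0 ≤ s) (x : LInf s) : freeLap x.seq ∈ lInfSub s := by
  refine ⟨‖x‖ * (3 + 5 ^ (s / 2)), ?_⟩
  rintro _ ⟨n, rfl⟩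
  have hN : 0 ≤ ‖x‖ := norm_nonneg x
  have hw := weight_pos s n
  have h1 : ‖x.seq n‖ ≤ ‖x‖ * weight s n := x.apply_le n
  have h2 : ‖x.seq (n + 1)‖ ≤ ‖x‖ * (5 ^ (s / 2) * weight s n) :=
    (x.apply_le _).trans (mul_le_mul_of_nonneg_left (weight_le_succ hs n) hN)
  have h3 : ‖shiftR x.seq n‖ ≤ ‖x‖ * weight s n := by
    by_cases h' : n = 1
    · subst h'
      rw [shiftR_one, norm_zero]
      positivity
    · obtain ⟨m, rfl⟩ := PNat.exists_eq_succ_of_ne_one h'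
      rw [shiftR_succ]
      exact (x.apply_le m).trans (mul_le_mul_of_nonneg_left (weight_succ_le hs m) hN)
  have h4 : ‖freeLap x.seq n‖ ≤ ‖x‖ * (3 + 5 ^ (s / 2)) * weight s n := by
    have := norm_freeLap_le x.seq n
    linarith
  calc weight (-s) n * ‖freeLap x.seq n‖
      ≤ weight (-s) n * (‖x‖ * (3 + 5 ^ (s / 2)) * weight s n) :=
        mul_le_mul_of_nonneg_left h4 (weight_pos _ n).le
    _ = (weight (-s) n * weight s n) * (‖x‖ * (3 + 5 ^ (s / 2))) := by ring
    _ = _ := by rw [weight_neg_mul, one_mul]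

/-- `H₀` acting in `𝓛^s`, `0 ≤ s`. -/
def freeOne {s : ℝ} (hs : 0 ≤ s) : LOne s →ₗ[ℂ] LOne s where
  toFun x := ⟨freeLap x.seq, freeLap_mem_l1 hs x⟩
  map_add' x y := LOne.ext (freeLap.map_add x.seq y.seq)
  map_smul' c x := LOne.ext (freeLap.map_smul c x.seq)

/-- `H₀` acting in `(𝓛^s)^*`, `0 ≤ s`. -/
def freeInf {s : ℝ} (hs : 0 ≤ s) : LInf s →ₗ[ℂ] LInf s where
  toFun x := ⟨freeLap x.seq, freeLap_mem_lInf hs x⟩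
  map_add' x y := LInf.ext (freeLap.map_add x.seq y.seq)
  map_smul' c x := LInf.ext (freeLap.map_smul c x.seq)

/-! The factorized perturbation -/

theorem LInf.pair_bound {s : ℝ} (y : LInf s) (x : LOne s) :
    (Summable fun n => ‖starRingEnd ℂ (y.seq n) * x.seq n‖) ∧
      ∑' n, ‖starRingEnd ℂ (y.seq n) * x.seq n‖ ≤ ‖y‖ * ‖x‖ := by
  have h : ∀ n, ‖starRingEnd ℂ (y.seq n) * x.seq n‖ ≤ ‖y‖ * (weight s n * ‖x.seq n‖) := fun n => by
    rw [norm_mul, RCLike.norm_conj, ← mul_assoc]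
    exact mul_le_mul_of_nonneg_right (y.apply_le n) (norm_nonneg _)
  have h1 := Summable.of_nonneg_of_le (fun n => norm_nonneg _) h (x.summable.mul_left ‖y‖)
  refine ⟨h1, (h1.tsum_le_tsum h (x.summable.mul_left ‖y‖)).trans ?_⟩
  rw [tsum_mul_left, ← LOne.norm_def]

/-- The duality `⟨y, x⟩ = ∑ conj(y[n]) x[n]` between `y ∈ (𝓛^s)^*` and `x ∈ 𝓛^s`. -/
def pairing (s : ℝ) : LInf s →L⋆[ℂ] LOne s →L[ℂ] ℂ :=
  LinearMap.mkContinuous₂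
    (LinearMap.mk₂'ₛₗ (starRingEnd ℂ) (RingHom.id ℂ)
      (fun (y : LInf s) (x : LOne s) => ∑' n, starRingEnd ℂ (y.seq n) * x.seq n)
      (fun y y' x => by
        rw [← (y.pair_bound x).1.of_norm.tsum_add (y'.pair_bound x).1.of_norm]
        refine tsum_congr fun n => ?_
        simp only [map_add, Pi.add_apply]
        ring)
      (fun c y x => by
        rw [smul_eq_mul, ← tsum_mul_left]
        refine tsum_congr fun n => ?_
        simp only [map_smul, Pi.smul_apply, smul_eq_mul, map_mul]
        ring)
      (fun y x x' => by
        rw [← (y.pair_bound x).1.of_norm.tsum_add (y.pair_bound x').1.of_norm]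
        refine tsum_congr fun n => ?_
        simp only [map_add, Pi.add_apply]
        ring)
      (fun c y x => by
        rw [smul_eq_mul, ← tsum_mul_left]
        refine tsum_congr fun n => ?_
        simp only [map_smul, Pi.smul_apply, smul_eq_mul, RingHom.id_apply]
        ring)) 1
    (fun y x => by
      rw [one_mul]
      exact (norm_tsum_le_tsum_norm (y.pair_bound x).1).trans (y.pair_bound x).2)

variable {K : Type*} [NormedAddCommGroup K] [InnerProductSpace ℂ K] [CompleteSpace K]

/-- The adjoint `v^* : (𝓛^s)^* → K` of `v : K → 𝓛^s`:
`⟨v^* y, k⟩ = ∑ conj(y[n]) (v k)[n]`. -/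
def adj {s : ℝ} (v : K →L[ℂ] LOne s) (y : LInf s) : K :=
  (InnerProductSpace.toDual ℂ K).symm ((pairing s y).comp v)

theorem inner_adj {s : ℝ} (v : K →L[ℂ] LOne s) (y : LInf s) (k : K) :
    ⟪adj v y, k⟫_ℂ = ∑' n, starRingEnd ℂ (y.seq n) * (v k).seq n := by
  simp [adj, pairing, LinearMap.mk₂'ₛₗ]

/-- `v U v^* : (𝓛^s)^* → 𝓛^s`. -/
def potExt {s : ℝ} (v : K →L[ℂ] LOne s) (U : K →L[ℂ] K) : LInf s →ₗ[ℂ] LOne s where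
  toFun y := v (U (adj v y))
  map_add' y y' := by
    have : adj v (y + y') = adj v y + adj v y' := by
      simp [adj, ContinuousLinearMap.add_comp]
    rw [this, map_add, map_add]
  map_smul' c y := by
    have : adj v (c • y) = c • adj v y := by
      simp only [adj, map_smulₛₗ, ContinuousLinearMap.smul_comp, RingHomCompTriple.comp_apply,
        RingHom.id_apply]
    rw [this, map_smul, map_smul, RingHom.id_apply]

/-- The standing assumption on the self-adjoint perturbation `V` of `H₀`, with decay `β ≥ 1`:
`V = v U v^*` with `v ∈ 𝓑(K, 𝓛^β)` injective and compact as a map to `𝓛^1`, and `U` self-adjoint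
and unitary. That `v U v^*` is bounded `(𝓛^β)^* → 𝓛^β` and compact `(𝓛^1)^* → 𝓛^1` is
automatic. -/
structure IsFactored {β : ℕ} (V : Hil →L[ℂ] Hil) (v : K →L[ℂ] LOne β) (U : K →L[ℂ] K) : Prop where
  isSelfAdjoint : IsSelfAdjoint V
  one_le : (1 : ℝ) ≤ β
  injective : Function.Injective v
  compact : IsCompactOperator ((LOne.incl one_le).comp v)
  selfAdjoint_U : IsSelfAdjoint U
  unitary_U : U ∈ unitary (K →L[ℂ] K)
  factor : ∀ x : Hil, hilSeq (V x) = (potExt v U (hilToInf (Nat.cast_nonneg β) x)).seq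

/-- `H = H₀ + v U v^*` acting in `(𝓛^s)^*`, `0 ≤ s ≤ β`. -/
def hamInf {β : ℕ} (v : K →L[ℂ] LOne β) (U : K →L[ℂ] K) {s : ℝ} (h0 : 0 ≤ s) (h : s ≤ β) :
    LInf s →ₗ[ℂ] LInf s :=
  freeInf h0 + ((hilToInf h0).comp (LOne.toHil (Nat.cast_nonneg β))).toLinearMap ∘ₗ
    potExt v U ∘ₗ (LInf.incl h).toLinearMap

/-- `H = H₀ + v U v^*` acting in `𝓛^s`, `0 ≤ s ≤ β`. -/
def hamOne {β : ℕ} (v : K →L[ℂ] LOne β) (U : K →L[ℂ] K) {s : ℝ} (h0 : 0 ≤ s) (h : s ≤ β) :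
    LOne s →ₗ[ℂ] LOne s :=
  freeOne h0 + (LOne.incl h).toLinearMap ∘ₗ potExt v U ∘ₗ
    ((hilToInf (Nat.cast_nonneg β)).comp (LOne.toHil h0)).toLinearMap

/-! Generalized zero eigenspaces and the classification of the threshold -/

/-- `{Ψ ∈ (𝓛^β)^* | H Ψ = 0}`. -/
def genEig {β : ℕ} (v : K →L[ℂ] LOne β) (U : K →L[ℂ] K) : Submodule ℂ (ℕ+ → ℂ) :=
  (LinearMap.ker (hamInf v U (Nat.cast_nonneg β) le_rfl)).map LInf.seq

/-- Solutions of `H Ψ = 0` in `ℂ 𝟏 + 𝓛^{β-2}`. -/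
def resEig {β : ℕ} (v : K →L[ℂ] LOne β) (U : K →L[ℂ] K) : Submodule ℂ (ℕ+ → ℂ) :=
  genEig v U ⊓ (Submodule.span ℂ {fun _ => 1} ⊔ l1Sub ((β : ℝ) - 2))

/-- Solutions of `H Ψ = 0` in `𝓛^{β-2}`. -/
def eig {β : ℕ} (v : K →L[ℂ] LOne β) (U : K →L[ℂ] K) : Submodule ℂ (ℕ+ → ℂ) :=
  genEig v U ⊓ l1Sub ((β : ℝ) - 2)

/-- The four types of the threshold `0`. -/
inductive ThresholdType
  | regular
  | first
  | second
  | third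

namespace ThresholdType

/-- The threshold `0` of `H` is of the given type. -/
def Holds {β : ℕ} (v : K →L[ℂ] LOne β) (U : K →L[ℂ] K) : ThresholdType → Prop
  | regular => resEig v U = ⊥ ∧ eig v U = ⊥
  | first => eig v U < resEig v U ∧ eig v U = ⊥
  | second => resEig v U = eig v U ∧ ⊥ < eig v U
  | third => eig v U < resEig v U ∧ ⊥ < eig v U

/-- The smallest decay exponent `β` for which the expansion is claimed. -/
def minBeta : ThresholdType → ℕ
  | regular => 2
  | first => 3
  | second => 4
  | third => 4

/-- The first index of the expansion. -/
def jMin : ThresholdType → ℤ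
  | regular => 0
  | first => -1
  | second => -2
  | third => -2

/-- The last index of the expansion. -/
def jMax (β : ℕ) : ThresholdType → ℤ
  | regular => β - 2
  | first => β - 4
  | second => β - 6
  | third => β - 6

/-- The expansion holds in `𝓑^s` with this `s` (the subtractions are only used for
`minBeta ≤ β`). -/
def space (β : ℕ) : ThresholdType → ℕ
  | regular => β
  | first => β - 1
  | second => β - 2
  | third => β - 2

/-- The `j`-th coefficient lies in `𝓑^t` with this `t`. -/
def coeffSpace (j : ℤ) : ThresholdType → ℤ
  | regular => if Even j then j + 1 else j
  | _ => if Even j then j + 3 else j + 2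

theorem space_nonneg (τ : ThresholdType) (β : ℕ) : (0 : ℝ) ≤ τ.space β := Nat.cast_nonneg _

theorem space_le (τ : ThresholdType) (β : ℕ) : (τ.space β : ℝ) ≤ β := by
  cases τ <;> simp [space]

end ThresholdType

/-! Resolvent expansion -/

/-- `R(κ) = (H + κ²)⁻¹` with `H = H₀ + V`, i.e. `(H - z)⁻¹` for `z = -κ²`. -/
def resolv (V : Hil →L[ℂ] Hil) (κ : ℂ) : Hil →L[ℂ] Hil :=
  Ring.inverse (freeHil + V + κ ^ 2 • 1)

/-- The filter `κ → 0` with `Re κ > 0`. -/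
def rightZero : Filter ℂ := 𝓝[{κ : ℂ | 0 < κ.re}] 0

/-- `G_j`, `jMin ≤ j ≤ jMax`, are the coefficients of the resolvent expansion for the threshold
type `τ`: as `κ → 0` with `Re κ > 0`, `H + κ²` is invertible and
`R(κ) = ∑_{jMin ≤ j ≤ jMax} κ^j G_j + O(κ^{jMax+1})` in `𝓑^s`, with `s = τ.space β`, and each
`G_j` lies in its smaller space. By convention `G_j = 0` for `j < jMin`. -/
structure IsExpansion (V : Hil →L[ℂ] Hil) (β : ℕ) (τ : ThresholdType)
    (G : ℤ → BOp (τ.space β)) : Prop where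
  invertible : ∀ᶠ κ in rightZero, IsUnit (freeHil + V + κ ^ 2 • (1 : Hil →L[ℂ] Hil))
  expansion : (fun κ : ℂ => toBOp (τ.space_nonneg β) (resolv V κ) -
      ∑ j ∈ Finset.Icc τ.jMin (τ.jMax β), κ ^ j • G j) =O[rightZero]
    fun κ : ℂ => κ ^ (τ.jMax β + 1)
  mem : ∀ j ∈ Finset.Icc τ.jMin (τ.jMax β), MemB (τ.coeffSpace j : ℝ) (G j)
  eq_zero : ∀ j < τ.jMin, G j = 0

end HalfLine

end

open HalfLine

noncomputable section

namespace HalfLine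

/-! Asymptotic power expansions as `κ → 0`, `Re κ > 0` -/

/-! Put `R₀(κ) = (H₀ + κ²)⁻¹` and `M(κ) = U + v* R₀(κ) v` on `K`. Because `U² = 1`, invertibility of
`M(κ)` gives invertibility of `H + κ²` and `R = R₀ - R₀ v M⁻¹ v* R₀` (`resolv_eq`). It remains to
expand `R₀` and to invert `M`.

With `κ = μ⁻¹ - μ` and `ζ = μ²`, the kernel of `R₀` is a finite sum of powers of `ζ`. Expanding in
`1 - ζ = κμ` gives coefficients of size `min(n,m) max(n,m)^j`, the first two being `min(n,m)` and
`-nm` (`exists_free_expansion`).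

The leading coefficient `M₀` is self-adjoint and is `U` plus a compact operator. Each `k` in `ker
M₀` yields the zero mode `-H₀⁻¹vk`. Moreover `H₀⁻¹f` is the constant `∑ m f[m]` minus a tail lying
in `𝓛^{β-2}` (`green_eq`, `tail_mem`), so the mode always lies in `ℂ𝟏 + 𝓛^{β-2}`, and in `𝓛^{β-2}`
if the moment of `vk` vanishes. The next coefficients see exactly this: `M₁ = -|η⟩⟨η|` where `⟨η,k⟩`
is the moment of `vk`, and `⟨k, M₂k⟩ = -‖H₀⁻¹vk‖²` on the moment-free part `N₂` of `N = ker M₀`.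
Thus order `κ` is nondegenerate on `N ⊖ N₂` and order `κ²` on `N₂`. Rescaling these two blocks makes
the leading coefficient invertible (`scaled_injective`, `HasExp.scaled_inverse`), and `M⁻¹` has a
pole of order at most `p = 0, 1, 2` according to the type (`exists_bsOp_inverse`). A pole of order
`p` costs `p` terms in inverting `M` and shifts the last index by another `p`, so the expansion ends
at `β - 2 - 2p`.

The relations hold for any expansion, by uniqueness of coefficients in `(H + κ²)R = R(H + κ²) = I`
(`coeff_relations`). In the relation for `j = 0` the coefficient `G₋₂` appears; it equals `P₀`
because `κ²R(κ)` converges strongly to the projection onto the `ℓ²` kernel of `H` along a ray on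
which `κ²` is imaginary (`tendsto_sq_resolv`). That kernel is `𝖤` (`map_ker_eq_eig`). -/

/-- `f κ = ∑_{i < n} κ^i c_i + O(κ^n)` as `κ → 0` with `Re κ > 0`. -/
def HasExp {E : Type*} [NormedAddCommGroup E] [NormedSpace ℂ E] (f : ℂ → E) (n : ℕ)
    (c : ℕ → E) : Prop :=
  (fun κ : ℂ => f κ - ∑ i ∈ Finset.range n, κ ^ i • c i) =O[rightZero] fun κ : ℂ => κ ^ n

/-! ### Calculus of finite asymptotic expansions -/

section Expansions

variable {E F G : Type*} [NormedAddCommGroup E] [NormedSpace ℂ E] [NormedAddCommGroup F]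
  [NormedSpace ℂ F] [NormedAddCommGroup G] [NormedSpace ℂ G]

instance rightZero_neBot : rightZero.NeBot := by
  rw [rightZero, ← mem_closure_iff_nhdsWithin_neBot]
  have h : Tendsto (fun t : ℝ => (t : ℂ)) (𝓝[>] 0) (𝓝 0) :=
    (Complex.continuous_ofReal.tendsto' 0 0 Complex.ofReal_zero).mono_left nhdsWithin_le_nhds
  refine mem_closure_of_tendsto h ?_
  filter_upwards [self_mem_nhdsWithin] with t ht
  simpa using ht

theorem tendsto_id_rightZero : Tendsto (fun κ : ℂ => κ) rightZero (𝓝 0) :=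
  tendsto_id.mono_left nhdsWithin_le_nhds

theorem eventually_re_pos : ∀ᶠ κ in rightZero, 0 < κ.re := self_mem_nhdsWithin

theorem ne_zero_of_re_pos {κ : ℂ} (h : 0 < κ.re) : κ ≠ 0 := by
  rintro rfl
  simp at h

theorem eventually_ne_zero : ∀ᶠ κ in rightZero, κ ≠ 0 :=
  eventually_re_pos.mono fun _ => ne_zero_of_re_pos

theorem pow_isBigO_pow {m n : ℕ} (h : m ≤ n) :
    (fun κ : ℂ => κ ^ n) =O[rightZero] fun κ : ℂ => κ ^ m := by
  obtain ⟨k, rfl⟩ := Nat.exists_eq_add_of_le h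
  have : (fun κ : ℂ => κ ^ k) =O[rightZero] fun _ => (1 : ℂ) :=
    ((continuous_pow k).tendsto' 0 _ rfl |>.comp tendsto_id_rightZero).isBigO_one ℂ
  simpa [pow_add] using (isBigO_refl (fun κ : ℂ => κ ^ m) _).mul this

theorem pow_smul_isBigO {f : ℂ → E} {n : ℕ} (k : ℕ) (hf : f =O[rightZero] fun κ : ℂ => κ ^ n) :
    (fun κ : ℂ => κ ^ k • f κ) =O[rightZero] fun κ : ℂ => κ ^ (n + k) := by
  have := (isBigO_refl (fun κ : ℂ => κ ^ k) rightZero).smul hf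
  simpa [pow_add, mul_comm] using this

theorem isBigO_of_pow_smul {f : ℂ → E} {n : ℕ} (k : ℕ)
    (hf : (fun κ : ℂ => κ ^ k • f κ) =O[rightZero] fun κ : ℂ => κ ^ (n + k)) :
    f =O[rightZero] fun κ : ℂ => κ ^ n := by
  have := (isBigO_refl (fun κ : ℂ => (κ ^ k)⁻¹) rightZero).smul hf
  refine this.congr' ?_ ?_
  · filter_upwards [eventually_ne_zero] with κ hκ
    rw [inv_smul_smul₀ (pow_ne_zero k hκ)]
  · filter_upwards [eventually_ne_zero] with κ hκ
    rw [smul_eq_mul, pow_add, mul_comm (κ ^ n), inv_mul_cancel_left₀ (pow_ne_zero k hκ)]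

namespace HasExp

variable {f g : ℂ → E} {c d : ℕ → E} {n : ℕ}

theorem congr (hf : HasExp f n c) (h : f =ᶠ[rightZero] g) : HasExp g n c :=
  hf.congr' (h.mono fun κ hκ => by simp only [hκ]) EventuallyEq.rfl

theorem congr_coeff (hf : HasExp f n c) (h : ∀ i < n, c i = d i) : HasExp f n d := by
  have : ∀ κ : ℂ, ∑ i ∈ Finset.range n, κ ^ i • c i = ∑ i ∈ Finset.range n, κ ^ i • d i :=
    fun κ => Finset.sum_congr rfl fun i hi => by rw [h i (Finset.mem_range.1 hi)]
  simpa only [HasExp, this] using hf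

theorem of_isBigO (hf : f =O[rightZero] fun κ : ℂ => κ ^ n) : HasExp f n 0 := by
  simpa [HasExp] using hf

theorem add (hf : HasExp f n c) (hg : HasExp g n d) :
    HasExp (fun κ => f κ + g κ) n fun i => c i + d i := by
  refine (IsBigO.add hf hg).congr_left fun κ => ?_
  simp only [smul_add, Finset.sum_add_distrib]
  abel

theorem sub (hf : HasExp f n c) (hg : HasExp g n d) :
    HasExp (fun κ => f κ - g κ) n fun i => c i - d i := by
  refine (IsBigO.sub hf hg).congr_left fun κ => ?_
  simp only [smul_sub, Finset.sum_sub_distrib]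
  abel

theorem sum {ι : Type*} {s : Finset ι} {f : ι → ℂ → E} {c : ι → ℕ → E}
    (h : ∀ i ∈ s, HasExp (f i) n (c i)) :
    HasExp (fun κ => ∑ i ∈ s, f i κ) n fun k => ∑ i ∈ s, c i k := by
  classical
  induction s using Finset.induction_on with
  | empty =>
    refine (of_isBigO (isBigO_zero _ _)).congr (Eventually.of_forall fun κ => by simp) |>.congr_coeff
      fun i _ => by simp
  | insert a s ha ih =>
    simp only [Finset.sum_insert ha]
    exact (h a (Finset.mem_insert_self a s)).add
      (ih fun i hi => h i (Finset.mem_insert_of_mem hi))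

theorem map (L : E →L[ℂ] F) (hf : HasExp f n c) :
    HasExp (fun κ => L (f κ)) n fun i => L (c i) := by
  have h := (L.isBigO_comp (fun κ : ℂ => f κ - ∑ i ∈ Finset.range n, κ ^ i • c i) rightZero).trans hf
  refine h.congr_left fun κ => ?_
  simp only [map_sub, map_sum, map_smul]

theorem trunc {m : ℕ} (hf : HasExp f n c) (h : m ≤ n) : HasExp f m c := by
  induction n, h using Nat.le_induction with
  | base => exact hf
  | succ n hmn ih =>
    refine ih ?_
    have h1 : (fun κ : ℂ => κ ^ n • c n) =O[rightZero] fun κ : ℂ => κ ^ n := by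
      simpa using (isBigO_refl (fun κ : ℂ => κ ^ n) rightZero).smul
        (isBigO_const_const (c n) (one_ne_zero (α := ℂ)) rightZero)
    refine ((IsBigO.trans hf (pow_isBigO_pow n.le_succ)).add h1).congr_left fun κ => ?_
    rw [Finset.sum_range_succ]
    abel

theorem zero_order (hf : HasExp f n c) (hn : 1 ≤ n) : Tendsto f rightZero (𝓝 (c 0)) := by
  have h1 : HasExp f 1 c := hf.trunc hn
  have h2 : Tendsto (fun κ : ℂ => f κ - ∑ i ∈ Finset.range 1, κ ^ i • c i) rightZero (𝓝 0) := by
    refine IsBigO.trans_tendsto h1 ?_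
    simpa using tendsto_id_rightZero
  simpa using h2.add_const (c 0)

theorem monomial (k : ℕ) (x : E) (n : ℕ) : HasExp (fun κ : ℂ => κ ^ k • x) n (Pi.single k x) := by
  by_cases h : k < n
  · refine (isBigO_zero _ _).congr_left fun κ => ?_
    rw [Finset.sum_eq_single_of_mem k (Finset.mem_range.2 h)]
    · simp
    · intro b _ hb
      rw [Pi.single_eq_of_ne hb, smul_zero]
  · refine congr_coeff (c := 0) (of_isBigO ?_) fun i hi => ?_
    · have := (pow_isBigO_pow (not_lt.1 h)).smul
        (isBigO_const_const x (one_ne_zero (α := ℂ)) rightZero)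
      simpa using this
    · rw [Pi.single_eq_of_ne (by omega), Pi.zero_apply]

theorem const (x : E) (n : ℕ) : HasExp (fun _ : ℂ => x) n (Pi.single 0 x) := by
  simpa using monomial 0 x n

/-- Multiplication by `κ^k` shifts the coefficients. -/
theorem shift (k : ℕ) (hf : HasExp f n c) :
    HasExp (fun κ => κ ^ k • f κ) (n + k) fun i => if k ≤ i then c (i - k) else 0 := by
  refine (pow_smul_isBigO k hf).congr_left fun κ => ?_
  rw [smul_sub, Finset.smul_sum, add_comm n k, Finset.sum_range_add]
  congr 1
  have h0 : ∑ i ∈ Finset.range k, κ ^ i • (if k ≤ i then c (i - k) else 0) = 0 :=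
    Finset.sum_eq_zero fun i hi => by rw [if_neg (by simpa using hi), smul_zero]
  rw [h0, zero_add]
  refine Finset.sum_congr rfl fun i _ => ?_
  simp [smul_smul, pow_add]

/-- Division by `κ^k`. -/
theorem unshift (k : ℕ) (hf : HasExp (fun κ => κ ^ k • f κ) (n + k) c) (hc : ∀ i < k, c i = 0) :
    HasExp f n fun i => c (i + k) := by
  refine isBigO_of_pow_smul k (IsBigO.congr_left hf fun κ => ?_)
  rw [smul_sub, Finset.smul_sum, add_comm n k, Finset.sum_range_add]
  congr 1
  have h0 : ∑ i ∈ Finset.range k, κ ^ i • c i = 0 :=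
    Finset.sum_eq_zero fun i hi => by rw [hc i (Finset.mem_range.1 hi), smul_zero]
  rw [h0, zero_add]
  refine Finset.sum_congr rfl fun i _ => ?_
  simp [smul_smul, pow_add, add_comm]

/-- The constant coefficient is the limit at `0`; subtracting it and dividing by `κ` leaves an
expansion one term shorter, so induction applies. -/
theorem unique (hf : HasExp f n c) (hg : HasExp f n d) : ∀ i < n, c i = d i := by
  induction n generalizing f c d with
  | zero => intro i hi; omega
  | succ n ih =>
    have h0 : c 0 = d 0 := tendsto_nhds_unique (hf.zero_order (by omega)) (hg.zero_order (by omega))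
    have key : ∀ {c : ℕ → E}, HasExp f (n + 1) c →
        HasExp (fun κ => κ⁻¹ • (f κ - c 0)) n fun i => c (i + 1) := by
      intro c hc
      have h1 := (hc.sub (const (c 0) (n + 1)))
      have h2 : HasExp (fun κ : ℂ => κ ^ 1 • κ⁻¹ • (f κ - c 0)) (n + 1)
          fun i => c i - (Pi.single 0 (c 0) : ℕ → E) i := by
        refine h1.congr ?_
        filter_upwards [eventually_ne_zero] with κ hκ
        rw [pow_one, smul_inv_smul₀ hκ]
      refine (unshift 1 h2 fun i hi => ?_).congr_coeff fun i _ => ?_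
      · obtain rfl : i = 0 := by omega
        simp
      · simp
    have h1 := key hf
    rw [h0] at h1
    intro i hi
    cases i with
    | zero => exact h0
    | succ i => exact ih h1 (key hg) i (by omega)

theorem isBigO_one (hf : HasExp f n c) : f =O[rightZero] fun _ => (1 : ℂ) := by
  simpa [HasExp] using hf.trunc (Nat.zero_le n)

theorem poly (c : ℕ → E) (n : ℕ) :
    HasExp (fun κ : ℂ => ∑ i ∈ Finset.range n, κ ^ i • c i) n c :=
  (isBigO_zero _ _).congr_left fun κ => by simp

theorem sum_antidiagonal {M : Type*} [AddCommMonoid M] (φ : ℕ → ℕ → M) {k n : ℕ} (hk : k < n) :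
    ∑ i ∈ Finset.range n, ∑ j ∈ Finset.range n, (if k = i + j then φ i j else 0) =
      ∑ p ∈ Finset.HasAntidiagonal.antidiagonal k, φ p.1 p.2 := by
  rw [← Finset.sum_product', ← Finset.sum_filter]
  refine Finset.sum_congr ?_ fun _ _ => rfl
  ext ⟨i, j⟩
  simp only [Finset.mem_filter, Finset.mem_product, Finset.mem_range, Finset.HasAntidiagonal.mem_antidiagonal]
  omega

/-- The Cauchy product of two expansions. -/
theorem bilin (B : E →L[ℂ] F →L[ℂ] G) {f : ℂ → E} {g : ℂ → F} {c : ℕ → E} {d : ℕ → F}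
    (hf : HasExp f n c) (hg : HasExp g n d) :
    HasExp (fun κ => B (f κ) (g κ)) n fun k => ∑ p ∈ Finset.HasAntidiagonal.antidiagonal k, B (c p.1) (d p.2) := by
  set Pf := fun κ : ℂ => ∑ i ∈ Finset.range n, κ ^ i • c i with hPf
  set Pg := fun κ : ℂ => ∑ i ∈ Finset.range n, κ ^ i • d i with hPg
  have h1 : HasExp (fun κ => B (Pf κ) (Pg κ)) n
      fun k => ∑ p ∈ Finset.HasAntidiagonal.antidiagonal k, B (c p.1) (d p.2) := by
    have h2 : HasExp (fun κ : ℂ => ∑ i ∈ Finset.range n, ∑ j ∈ Finset.range n,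
        κ ^ (i + j) • B (c i) (d j)) n fun k => ∑ i ∈ Finset.range n, ∑ j ∈ Finset.range n,
          (Pi.single (i + j) (B (c i) (d j)) : ℕ → G) k :=
      sum fun i _ => sum fun j _ => monomial (i + j) _ n
    refine (h2.congr (Eventually.of_forall fun κ => ?_)).congr_coeff fun k hk => ?_
    · beta_reduce
      rw [Finset.sum_comm]
      simp only [hPf, hPg, map_sum, sum_apply, map_smul, smul_apply, smul_smul, ← pow_add,
        Finset.smul_sum, add_comm]
    · simp only [Pi.single_apply]
      exact sum_antidiagonal (fun i j => B (c i) (d j)) hk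
  -- The errors come from `B(f,g) - B(Pf,Pg) = B(f - Pf, g) + B(Pf, g - Pg)`; in each summand one
  -- factor is `O(κ^n)` and the other bounded.
  have h3 : (fun κ => B (f κ - Pf κ) (g κ)) =O[rightZero] fun κ : ℂ => κ ^ n := by
    have := (B.isBoundedBilinearMap.isBigO_comp (g := fun κ => f κ - Pf κ) (h := g)
      (l := rightZero)).trans ((IsBigO.norm_left hf).mul hg.isBigO_one.norm_left)
    simpa using this
  have h4 : (fun κ => B (Pf κ) (g κ - Pg κ)) =O[rightZero] fun κ : ℂ => κ ^ n := by
    have := (B.isBoundedBilinearMap.isBigO_comp (g := Pf) (h := fun κ => g κ - Pg κ)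
      (l := rightZero)).trans ((poly c n).isBigO_one.norm_left.mul (IsBigO.norm_left hg))
    simpa using this
  refine ((h1.add (of_isBigO h3)).add (of_isBigO h4)).congr (Eventually.of_forall fun κ => ?_)
    |>.congr_coeff fun i _ => by simp
  simp only [map_sub, sub_apply]
  abel

/-- The coefficients are the Taylor coefficients, the same for every length `n`. -/
theorem of_analyticAt {f : ℂ → E} (hf : AnalyticAt ℂ f 0) : ∃ c : ℕ → E, ∀ n, HasExp f n c := by
  obtain ⟨p, hp⟩ := hf
  refine ⟨p.coeff, fun n => ?_⟩
  have h := (hp.isBigO_sub_partialSum_pow n).mono (nhdsWithin_le_nhds (s := {κ : ℂ | 0 < κ.re}))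
  have h2 : (fun y : ℂ => ‖y‖ ^ n) =O[rightZero] fun κ : ℂ => κ ^ n :=
    (isBigO_refl (fun κ : ℂ => κ ^ n) rightZero).norm_left.congr_left fun κ => norm_pow κ n
  refine (h.trans h2).congr_left fun κ => ?_
  simp [FormalMultilinearSeries.partialSum]

/-- Inversion of an expansion whose leading coefficient is invertible. -/
theorem inverse {A : Type*} [NormedRing A] [NormedAlgebra ℂ A] [CompleteSpace A] {f : ℂ → A}
    {c : ℕ → A} (hf : HasExp f n c) (hn : 1 ≤ n) (hc : IsUnit (c 0)) :
    (∀ᶠ κ in rightZero, IsUnit (f κ)) ∧ ∃ d, HasExp (fun κ => Ring.inverse (f κ)) n d := by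
  obtain ⟨u, hu⟩ := hc
  -- The polynomial part `Q` is analytic, so its inverse is analytic near `0` and has an expansion
  -- of every length; `f⁻¹` then only has to be compared with `Q⁻¹`.
  set Q := fun κ : ℂ => ∑ i ∈ Finset.range n, κ ^ i • c i with hQ
  have hQ0 : Q 0 = u := by
    rw [hu, hQ]
    simp only
    rw [Finset.sum_eq_single_of_mem 0 (Finset.mem_range.2 (by omega))]
    · simp
    · intro b _ hb
      simp [hb]
  have hQa : AnalyticAt ℂ Q 0 := by
    refine Finset.analyticAt_fun_sum _ fun i _ => ?_
    exact (analyticAt_id.pow i).smul analyticAt_const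
  have hf0 : Tendsto f rightZero (𝓝 (u : A)) := by
    rw [hu]
    exact hf.zero_order hn
  have hQ1 : Tendsto Q rightZero (𝓝 (u : A)) := by
    rw [← hQ0]
    exact hQa.continuousAt.tendsto.mono_left nhdsWithin_le_nhds
  refine ⟨hf0.eventually (Units.isOpen.mem_nhds u.isUnit), ?_⟩
  have hinv : AnalyticAt ℂ (fun κ => Ring.inverse (Q κ)) 0 := by
    have : AnalyticAt ℂ (Ring.inverse : A → A) (Q 0) := by
      rw [hQ0]
      exact analyticAt_inverse u
    exact this.comp hQa
  obtain ⟨d, hd⟩ := of_analyticAt hinv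
  -- Strict differentiability of inversion at `u` makes it Lipschitz there, hence `f⁻¹ - Q⁻¹ = O(f -
  -- Q)`.
  have hs := (analyticAt_inverse (𝕜 := ℂ) u).hasStrictFDerivAt.isBigO_sub
  have h1 : (fun κ => Ring.inverse (f κ) - Ring.inverse (Q κ)) =O[rightZero]
      fun κ => f κ - Q κ := hs.comp_tendsto (hf0.prodMk_nhds hQ1)
  refine ⟨d, ((hd n).add (of_isBigO (h1.trans hf))).congr (Eventually.of_forall fun κ => by simp)
    |>.congr_coeff fun i _ => by simp⟩

end HasExp

/-- An expansion in integer powers from `κ^(-p)` on, multiplied by `κ^p`. -/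
theorem hasExp_iff_zpow (f : ℂ → E) (p n : ℕ) (g : ℤ → E) :
    HasExp (fun κ => κ ^ p • f κ) n (fun k => g (k - p)) ↔
      (fun κ : ℂ => f κ - ∑ j ∈ Finset.Icc (-p : ℤ) (n - 1 - p), κ ^ j • g j) =O[rightZero]
        fun κ : ℂ => κ ^ ((n : ℤ) - p) := by
  have hsum : ∀ κ : ℂ, κ ≠ 0 → κ ^ p • ∑ j ∈ Finset.Icc (-p : ℤ) (n - 1 - p), κ ^ j • g j =
      ∑ i ∈ Finset.range n, κ ^ i • g (i - p) := by
    intro κ hκ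
    rw [Finset.smul_sum]
    symm
    refine Finset.sum_bij (fun i _ => (i : ℤ) - p) ?_ ?_ ?_ ?_
    · intro i hi
      have := Finset.mem_range.1 hi
      rw [Finset.mem_Icc]
      omega
    · intro i _ j _ h
      simpa using h
    · intro j hj
      rw [Finset.mem_Icc] at hj
      exact ⟨(j + p).toNat, Finset.mem_range.2 (by omega), by omega⟩
    · intro i _
      rw [smul_smul]
      congr 1
      rw [← zpow_natCast κ p, ← zpow_add₀ hκ]
      simp
  constructor
  · intro h
    have h1 := (isBigO_refl (fun κ : ℂ => (κ ^ p)⁻¹) rightZero).smul h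
    refine h1.congr' ?_ ?_
    · filter_upwards [eventually_ne_zero] with κ hκ
      rw [← hsum κ hκ, ← smul_sub, inv_smul_smul₀ (pow_ne_zero p hκ)]
    · filter_upwards [eventually_ne_zero] with κ hκ
      rw [zpow_sub₀ hκ, zpow_natCast, zpow_natCast, smul_eq_mul, div_eq_mul_inv, mul_comm]
  · intro h
    have h1 := (isBigO_refl (fun κ : ℂ => κ ^ p) rightZero).smul h
    refine h1.congr' ?_ ?_
    · filter_upwards [eventually_ne_zero] with κ hκ
      rw [smul_sub, hsum κ hκ]
    · filter_upwards [eventually_ne_zero] with κ hκ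
      rw [zpow_sub₀ hκ, zpow_natCast, zpow_natCast, smul_eq_mul, mul_div_cancel₀ _ (pow_ne_zero p hκ)]

end Expansions

/-! Operators between the weighted spaces and their kernels -/

theorem weight_add (s t : ℝ) (n : ℕ+) : weight (s + t) n = weight s n * weight t n := by
  rw [weight, weight, weight, ← Real.rpow_add (by positivity)]
  congr 1
  ring

theorem weight_two (n : ℕ+) : weight 2 n = 1 + (n : ℝ) ^ 2 := by simp [weight]

theorem cast_pow_le_weight (j : ℕ) (n : ℕ+) : (n : ℝ) ^ j ≤ weight j n := by
  have h : (0 : ℝ) ≤ n := by positivity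
  rw [weight, ← Real.rpow_natCast]
  calc (n : ℝ) ^ (j : ℝ) = ((n : ℝ) ^ 2) ^ ((j : ℝ) / 2) := by
        rw [← Real.rpow_natCast, ← Real.rpow_mul h]
        congr 1
        push_cast
        ring
    _ ≤ _ := Real.rpow_le_rpow (by positivity) (by linarith) (by positivity)

/-- The standard basis vector `e_m` of `𝓛^s`. -/
def LOne.single (s : ℝ) (m : ℕ+) : LOne s :=
  ⟨Pi.single m 1, by
    refine summable_of_ne_finset_zero (s := {m}) fun n hn => ?_
    simp [Pi.single_eq_of_ne (Finset.notMem_singleton.1 hn)]⟩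

theorem LOne.seq_single (s : ℝ) (m : ℕ+) : (LOne.single s m).seq = Pi.single m 1 := rfl

theorem LOne.incl_seq {s t : ℝ} (h : s ≤ t) (x : LOne t) : (LOne.incl h x).seq = x.seq := by
  unfold LOne.incl
  rw [LinearMap.mkContinuous_apply]
  rfl

theorem LInf.incl_seq {s t : ℝ} (h : s ≤ t) (x : LInf s) : (LInf.incl h x).seq = x.seq := rfl

theorem LOne.incl_incl {r s t : ℝ} (h : r ≤ s) (h' : s ≤ t) (x : LOne t) :
    LOne.incl h (LOne.incl h' x) = LOne.incl (h.trans h') x :=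
  LOne.ext (by rw [LOne.incl_seq, LOne.incl_seq, LOne.incl_seq])

theorem LInf.incl_incl {r s t : ℝ} (h : r ≤ s) (h' : s ≤ t) (x : LInf r) :
    LInf.incl h' (LInf.incl h x) = LInf.incl (h.trans h') x := LInf.ext rfl

theorem LOne.toHil_apply {s : ℝ} (hs : 0 ≤ s) (x : LOne s) (n : ℕ+) :
    LOne.toHil hs x n = x.seq n := rfl

theorem hilToInf_seq {s : ℝ} (hs : 0 ≤ s) (x : Hil) (n : ℕ+) : (hilToInf hs x).seq n = x n := rfl

theorem LOne.incl_single {s t : ℝ} (h : s ≤ t) (m : ℕ+) :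
    LOne.incl h (LOne.single t m) = LOne.single s m :=
  LOne.ext (by rw [LOne.incl_seq, LOne.seq_single, LOne.seq_single])

/-- The remainder after a finite set of terms has norm equal to the corresponding remainder of the
series defining `‖x‖`. This density is what lets operators on `𝓛^s` be handled through their
kernels. -/
theorem LOne.hasSum_single {s : ℝ} (x : LOne s) :
    HasSum (fun m => x.seq m • LOne.single s m) x := by
  have hseq : ∀ (F : Finset ℕ+) (n : ℕ+),
      (x - ∑ m ∈ F, x.seq m • LOne.single s m).seq n = if n ∈ F then 0 else x.seq n := by
    intro F n
    simp only [map_sub, map_sum, map_smul, LOne.seq_single, Pi.sub_apply, Finset.sum_apply,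
      Pi.smul_apply, smul_eq_mul, Pi.single_apply, mul_ite, mul_one, mul_zero, Finset.sum_ite_eq]
    split_ifs <;> simp
  have hnorm : ∀ F : Finset ℕ+, ‖∑ m ∈ F, x.seq m • LOne.single s m - x‖ =
      ∑' n, weight s n * ‖x.seq n‖ - ∑ n ∈ F, weight s n * ‖x.seq n‖ := by
    intro F
    rw [norm_sub_rev, LOne.norm_def]
    have h1 : HasSum (fun n => if n ∈ F then weight s n * ‖x.seq n‖ else 0)
        (∑ n ∈ F, weight s n * ‖x.seq n‖) := by
      have := hasSum_sum_of_ne_finset_zero (f := fun n => if n ∈ F then weight s n * ‖x.seq n‖ else 0)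
        (s := F) (L := SummationFilter.unconditional ℕ+) fun n hn => if_neg hn
      rwa [Finset.sum_congr rfl fun n hn => if_pos hn] at this
    rw [← (x.summable.hasSum.sub h1).tsum_eq]
    refine tsum_congr fun n => ?_
    rw [hseq]
    split_ifs <;> simp
  rw [HasSum, SummationFilter.unconditional_filter, tendsto_iff_norm_sub_tendsto_zero]
  simp only [hnorm]
  have h2 : Tendsto (fun F : Finset ℕ+ => ∑ n ∈ F, weight s n * ‖x.seq n‖) atTop
      (𝓝 (∑' n, weight s n * ‖x.seq n‖)) := x.summable.hasSum
  simpa using h2.const_sub (∑' n, weight s n * ‖x.seq n‖)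

section Maps

variable {E : Type*} [NormedAddCommGroup E] [NormedSpace ℂ E]

theorem LOne.clm_ext {s : ℝ} {S T : LOne s →L[ℂ] E}
    (h : ∀ m, S (LOne.single s m) = T (LOne.single s m)) : S = T := by
  ext x
  have h1 := x.hasSum_single.mapL S
  have h2 := x.hasSum_single.mapL T
  simp only [map_smul, h] at h1 h2
  exact h1.unique h2

theorem LOne.norm_apply_le {s : ℝ} {T : LOne s →L[ℂ] E} {C : ℝ}
    (h : ∀ m, ‖T (LOne.single s m)‖ ≤ C * weight s m) (x : LOne s) : ‖T x‖ ≤ C * ‖x‖ := by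
  have h1 := x.hasSum_single.mapL T
  have h2 : ∀ m, ‖T (x.seq m • LOne.single s m)‖ ≤ C * (weight s m * ‖x.seq m‖) := by
    intro m
    rw [map_smul, norm_smul]
    have := mul_le_mul_of_nonneg_left (h m) (norm_nonneg (x.seq m))
    linarith
  have h3 := tsum_of_norm_bounded (x.summable.hasSum.mul_left C) h2
  rwa [h1.tsum_eq, ← LOne.norm_def] at h3

end Maps

/-- The kernel `k` satisfies `|k[n,m]| ≤ C (1+n²)^{t/2} (1+m²)^{t/2}`. -/
def KerBound (t C : ℝ) (k : ℕ+ → ℕ+ → ℂ) : Prop :=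
  ∀ n m, ‖k n m‖ ≤ C * (weight t n * weight t m)

theorem KerBound.nonneg {t C : ℝ} {k : ℕ+ → ℕ+ → ℂ} (h : KerBound t C k) : 0 ≤ C := by
  have h1 := (norm_nonneg _).trans (h 1 1)
  have h2 := mul_pos (weight_pos t 1) (weight_pos t 1)
  exact nonneg_of_mul_nonneg_left h1 h2

theorem KerBound.mono {t s C : ℝ} {k : ℕ+ → ℕ+ → ℂ} (h : KerBound t C k) (hts : t ≤ s) :
    KerBound s C k := fun n m =>
  (h n m).trans (mul_le_mul_of_nonneg_left (mul_le_mul (weight_mono hts n) (weight_mono hts m)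
    (weight_pos t m).le (weight_pos s n).le) h.nonneg)

/-- `(k x)[n] = ∑_m k[n,m] x[m]`. -/
def kerSeq (k : ℕ+ → ℕ+ → ℂ) (x : ℕ+ → ℂ) (n : ℕ+) : ℂ := ∑' m, k n m * x m

theorem kerSeq_bound {t C : ℝ} {k : ℕ+ → ℕ+ → ℂ} {n : ℕ+} (h : ∀ m, ‖k n m‖ ≤ C * weight t m)
    (x : LOne t) : (Summable fun m => k n m * x.seq m) ∧ ‖kerSeq k x.seq n‖ ≤ C * ‖x‖ := by
  have h1 : ∀ m, ‖k n m * x.seq m‖ ≤ C * (weight t m * ‖x.seq m‖) := by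
    intro m
    rw [norm_mul, ← mul_assoc]
    exact mul_le_mul_of_nonneg_right (h m) (norm_nonneg _)
  refine ⟨Summable.of_norm_bounded (x.summable.mul_left C) h1, ?_⟩
  exact tsum_of_norm_bounded (x.summable.hasSum.mul_left C) h1

theorem KerBound.seq_bound {t C : ℝ} {k : ℕ+ → ℕ+ → ℂ} (h : KerBound t C k) (n : ℕ+) (x : LOne t) :
    (Summable fun m => k n m * x.seq m) ∧ ‖kerSeq k x.seq n‖ ≤ C * weight t n * ‖x‖ :=
  kerSeq_bound (fun m => by rw [mul_assoc]; exact h n m) x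

open Classical in
/-- The operator in `𝓑^s` with the kernel `k` (zero if the kernel is not bounded there). -/
def kerOp (s : ℝ) (k : ℕ+ → ℕ+ → ℂ) : BOp s :=
  if h : ∃ C, KerBound s C k then
    have key : ∀ (x : LOne s) (n : ℕ+),
        weight (-s) n * ‖kerSeq k x.seq n‖ ≤ h.choose * ‖x‖ := fun x n =>
      calc weight (-s) n * ‖kerSeq k x.seq n‖
          ≤ weight (-s) n * (h.choose * weight s n * ‖x‖) :=
            mul_le_mul_of_nonneg_left (h.choose_spec.seq_bound n x).2 (weight_pos _ n).le
        _ = (weight (-s) n * weight s n) * (h.choose * ‖x‖) := by ring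
        _ = _ := by rw [weight_neg_mul, one_mul]
    LinearMap.mkContinuous
      { toFun := fun x => (⟨kerSeq k x.seq, ⟨h.choose * ‖x‖, by
          rintro _ ⟨n, rfl⟩
          exact key x n⟩⟩ : LInf s)
        map_add' := fun x y => LInf.ext <| funext fun n => by
          change kerSeq k (x + y).seq n = kerSeq k x.seq n + kerSeq k y.seq n
          simp only [kerSeq, map_add, Pi.add_apply, mul_add]
          exact (h.choose_spec.seq_bound n x).1.tsum_add (h.choose_spec.seq_bound n y).1
        map_smul' := fun c x => LInf.ext <| funext fun n => by
          change kerSeq k (c • x).seq n = c * kerSeq k x.seq n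
          simp only [kerSeq, map_smul, Pi.smul_apply, smul_eq_mul]
          rw [← tsum_mul_left]
          exact tsum_congr fun m => by ring }
      h.choose fun x => LInf.norm_le _ (key x)
  else 0

/-! ### Operators determined by their kernels -/

section Kernels

variable {s t C : ℝ} {k : ℕ+ → ℕ+ → ℂ}

theorem kerOp_seq (h : KerBound s C k) (x : LOne s) : (kerOp s k x).seq = kerSeq k x.seq := by
  rw [kerOp, dif_pos ⟨C, h⟩]
  rfl

theorem kerSeq_single (s : ℝ) (k : ℕ+ → ℕ+ → ℂ) (n m : ℕ+) :
    kerSeq k (LOne.single s m).seq n = k n m := by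
  rw [kerSeq, tsum_eq_single m]
  · simp [LOne.seq_single]
  · intro b hb
    simp [LOne.seq_single, Pi.single_eq_of_ne hb]

theorem kerOp_single (h : KerBound s C k) (n m : ℕ+) :
    (kerOp s k (LOne.single s m)).seq n = k n m := by
  rw [kerOp_seq h, kerSeq_single]

theorem BOp.ext_kernel {G G' : BOp s}
    (h : ∀ n m, (G (LOne.single s m)).seq n = (G' (LOne.single s m)).seq n) : G = G' :=
  LOne.clm_ext fun m => LInf.ext (funext fun n => h n m)

theorem BOp.norm_le_kernel {G : BOp s}
    (h : KerBound s C fun n m => (G (LOne.single s m)).seq n) : ‖G‖ ≤ C := by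
  refine G.opNorm_le_bound h.nonneg (LOne.norm_apply_le fun m => LInf.norm_le _ fun n => ?_)
  calc weight (-s) n * ‖(G (LOne.single s m)).seq n‖
      ≤ weight (-s) n * (C * (weight s n * weight s m)) :=
        mul_le_mul_of_nonneg_left (h n m) (weight_pos _ n).le
    _ = (weight (-s) n * weight s n) * (C * weight s m) := by ring
    _ = _ := by rw [weight_neg_mul, one_mul]

/-- Membership in a smaller `𝓑^t` is a pointwise estimate: the kernel defines an operator on `𝓛^t`,
and it agrees with `G` on basis vectors. -/
theorem memB_of_kernel {G : BOp s} (hts : t ≤ s)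
    (h : KerBound t C fun n m => (G (LOne.single s m)).seq n) : MemB t G := by
  refine ⟨hts, kerOp t fun n m => (G (LOne.single s m)).seq n, BOp.ext_kernel fun n m => ?_⟩
  rw [ContinuousLinearMap.comp_apply, ContinuousLinearMap.comp_apply, LInf.incl_seq,
    LOne.incl_single, kerOp_single h]

theorem MemB.mono {G : BOp s} {r : ℝ} (h : MemB t G) (htr : t ≤ r) (hrs : r ≤ s) : MemB r G := by
  obtain ⟨hts, T, rfl⟩ := h
  refine ⟨hrs, (LInf.incl htr).comp (T.comp (LOne.incl htr)), ContinuousLinearMap.ext fun x => ?_⟩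
  rw [ContinuousLinearMap.comp_apply, ContinuousLinearMap.comp_apply,
    ContinuousLinearMap.comp_apply, ContinuousLinearMap.comp_apply,
    ContinuousLinearMap.comp_apply, ContinuousLinearMap.comp_apply, LInf.incl_incl,
    LOne.incl_incl]

theorem MemB.sub {G G' : BOp s} (h : MemB t G) (h' : MemB t G') : MemB t (G - G') := by
  obtain ⟨hts, T, rfl⟩ := h
  obtain ⟨_, T', rfl⟩ := h'
  refine ⟨hts, T - T', ?_⟩
  ext x
  simp

theorem MemB.zero (h : t ≤ s) : MemB t (0 : BOp s) := ⟨h, 0, by ext x; simp⟩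

theorem MemB.sum {ι : Type*} {I : Finset ι} {G : ι → BOp s} (hts : t ≤ s)
    (h : ∀ i ∈ I, MemB t (G i)) : MemB t (∑ i ∈ I, G i) := by
  have h' : ∀ G : BOp s, MemB t G ↔ ∃ T : BOp t, (LInf.incl hts).comp (T.comp (LOne.incl hts)) = G :=
    fun G => ⟨fun ⟨_, T, hT⟩ => ⟨T, hT.symm⟩, fun ⟨T, hT⟩ => ⟨hts, T, hT.symm⟩⟩
  simp only [h'] at h ⊢
  choose! T hT using h
  refine ⟨∑ i ∈ I, T i, ?_⟩
  rw [← Finset.sum_congr rfl hT]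
  ext x
  simp

end Kernels

/-! The adjoint of `v` -/

section Adjoint

variable {K : Type*} [NormedAddCommGroup K] [InnerProductSpace ℂ K] [CompleteSpace K]

/-- The bound is tested on `k = v* y` itself, where the pairing equals `‖v* y‖²`. -/
theorem norm_adj_le_of {s C : ℝ} (hC : 0 ≤ C) (v : K →L[ℂ] LOne s) (y : LInf s)
    (h : ∀ k, ‖∑' n, starRingEnd ℂ (y.seq n) * (v k).seq n‖ ≤ C * ‖k‖) : ‖adj v y‖ ≤ C := by
  by_contra! hlt
  have h1 := h (adj v y)
  rw [← inner_adj, inner_self_eq_norm_sq_to_K] at h1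
  simp only [norm_pow, RCLike.norm_ofReal, abs_norm] at h1
  nlinarith

theorem norm_adj_le {s : ℝ} (v : K →L[ℂ] LOne s) (y : LInf s) : ‖adj v y‖ ≤ ‖v‖ * ‖y‖ := by
  refine norm_adj_le_of (by positivity) v y fun k => ?_
  refine (norm_tsum_le_tsum_norm (y.pair_bound (v k)).1).trans ((y.pair_bound (v k)).2.trans ?_)
  have := mul_le_mul_of_nonneg_left (v.le_opNorm k) (norm_nonneg y)
  linarith

/-- The adjoint `v^* : (𝓛^s)^* → K` as a bounded operator. -/
def adjL {s : ℝ} (v : K →L[ℂ] LOne s) : LInf s →L[ℂ] K :=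
  LinearMap.mkContinuous
    { toFun := adj v
      map_add' := fun y y' => by simp [adj, ContinuousLinearMap.add_comp]
      map_smul' := fun c y => by
        simp only [adj, map_smulₛₗ, ContinuousLinearMap.smul_comp, RingHomCompTriple.comp_apply,
          RingHom.id_apply] } ‖v‖ (norm_adj_le v)

theorem adjL_apply {s : ℝ} (v : K →L[ℂ] LOne s) (y : LInf s) : adjL v y = adj v y := rfl

theorem potExt_apply {s : ℝ} (v : K →L[ℂ] LOne s) (U : K →L[ℂ] K) (y : LInf s) :
    potExt v U y = v (U (adj v y)) := rfl

/-- The adjoint sees only underlying sequences, so `v*` can be computed in whichever weighted space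
is convenient. -/
theorem adj_congr {s t : ℝ} {v : K →L[ℂ] LOne s} {w : K →L[ℂ] LOne t} {y : LInf s} {z : LInf t}
    (hv : ∀ k, (v k).seq = (w k).seq) (hy : y.seq = z.seq) : adj v y = adj w z := by
  refine ext_inner_right ℂ fun k => ?_
  rw [inner_adj, inner_adj, hv, hy]

end Adjoint

/-! The free resolvent -/

/-- The right shift on `𝓗`. -/
def shiftHil : Hil →L[ℂ] Hil :=
  have key : ∀ x : Hil, HasSum (fun n => ‖shiftR x n‖ ^ 2) (‖x‖ ^ 2) := fun x => by
    rw [hil_norm_sq]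
    exact hasSum_shift (by simp [shiftR_one]) (fun n => by rw [shiftR_succ])
      ((memHil_iff _).1 (lp.memℓp x)).hasSum
  LinearMap.mkContinuous
    { toFun := fun x => (⟨shiftR x, (memHil_iff _).2 (key x).summable⟩ : Hil)
      map_add' := fun x y => by
        ext n
        change shiftR (x + y : Hil) n = shiftR x n + shiftR y n
        simp only [shiftR, lp.coeFn_add, Pi.add_apply]
        split_ifs <;> simp
      map_smul' := fun c x => by
        ext n
        change shiftR (c • x : Hil) n = c * shiftR x n
        simp only [shiftR, lp.coeFn_smul, Pi.smul_apply, smul_eq_mul]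
        split_ifs <;> simp } 1
    fun x => by
      refine (pow_le_pow_iff_left₀ (norm_nonneg _) (by positivity) two_ne_zero).1 ?_
      rw [hil_norm_sq, one_mul]
      exact (key x).tsum_eq.le

theorem shiftHil_apply (x : Hil) (n : ℕ+) : shiftHil x n = shiftR x n := rfl

theorem norm_shiftHil (x : Hil) : ‖shiftHil x‖ = ‖x‖ := by
  refine (pow_left_inj₀ (norm_nonneg _) (norm_nonneg _) two_ne_zero).1 ?_
  rw [hil_norm_sq, hil_norm_sq]
  exact (hasSum_shift (by simp [shiftHil_apply, shiftR_one])
    (fun n => by rw [shiftHil_apply, shiftR_succ])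
    ((memHil_iff _).1 (lp.memℓp x)).hasSum).tsum_eq

theorem shiftR_single (m : ℕ+) : shiftR (Pi.single m 1) = Pi.single (m + 1) 1 := by
  funext n
  by_cases hn : n = 1
  · subst hn
    rw [shiftR_one, Pi.single_eq_of_ne]
    intro h
    have := congrArg PNat.val h
    simp at this
  · obtain ⟨n, rfl⟩ := PNat.exists_eq_succ_of_ne_one hn
    rw [shiftR_succ]
    simp [Pi.single_apply]

theorem adjoint_shiftHil_apply (x : Hil) (n : ℕ+) :
    ContinuousLinearMap.adjoint shiftHil x n = x (n + 1) := by
  have h1 : shiftHil (lp.single 2 n (1 : ℂ)) = lp.single 2 (n + 1) 1 := by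
    ext k
    rw [shiftHil_apply, lp.coeFn_single, lp.coeFn_single, shiftR_single]
  have h2 := ContinuousLinearMap.adjoint_inner_right shiftHil (lp.single 2 n (1 : ℂ)) x
  rw [h1, lp.inner_single_left, lp.inner_single_left] at h2
  simpa using h2

theorem freeHil_apply (x : Hil) (n : ℕ+) : freeHil x n = freeLap x n := rfl

/-- With the right shift `S`, `S* S = 1` gives `(1 - S)*(1 - S) = 2 - S - S*`. The Dirichlet
condition is built into `S`, and positivity of `H₀` becomes evident. -/
theorem freeHil_eq : freeHil = (ContinuousLinearMap.adjoint (1 - shiftHil)).comp (1 - shiftHil) := by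
  have h : (ContinuousLinearMap.adjoint shiftHil).comp shiftHil = 1 :=
    (ContinuousLinearMap.norm_map_iff_adjoint_comp_self shiftHil).1 norm_shiftHil
  ext x n
  have h1 : ContinuousLinearMap.adjoint shiftHil (shiftHil x) = x := by
    have := DFunLike.congr_fun h x
    simpa using this
  have h2 : ContinuousLinearMap.adjoint (1 : Hil →L[ℂ] Hil) = 1 := by
    rw [← ContinuousLinearMap.star_eq_adjoint, star_one]
  rw [map_sub, h2]
  simp only [ContinuousLinearMap.comp_apply, sub_apply, map_sub, h1,
    one_apply_eq_self, lp.coeFn_sub, Pi.sub_apply, freeHil_apply, freeLap_apply,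
    shiftHil_apply, adjoint_shiftHil_apply]
  ring

theorem isPositive_freeHil : freeHil.IsPositive := by
  rw [freeHil_eq]
  exact ContinuousLinearMap.isPositive_adjoint_comp_self _

-- Since `H₀ ≥ 0`, failure of invertibility would put `-κ²` in `[0, ∞)`; then `Re κ · Im κ = 0`, so
-- `κ` is real and nonzero and `-κ² < 0`.
open scoped ComplexOrder in
theorem isUnit_free {κ : ℂ} (hκ : 0 < κ.re) : IsUnit (freeHil + κ ^ 2 • (1 : Hil →L[ℂ] Hil)) := by
  have h0 : (0 : Hil →L[ℂ] Hil) ≤ freeHil :=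
    (ContinuousLinearMap.nonneg_iff_isPositive _).2 isPositive_freeHil
  by_contra hu
  have h1 : -κ ^ 2 ∈ spectrum ℂ freeHil := by
    rw [spectrum.mem_iff]
    intro h
    refine hu ?_
    rw [← IsUnit.neg_iff]
    convert h using 1
    rw [Algebra.algebraMap_eq_smul_one, neg_smul]
    abel
  have h2 : (0 : ℂ) ≤ -κ ^ 2 := spectrum_nonneg_of_nonneg h0 h1
  rw [Complex.le_def] at h2
  simp only [pow_two, Complex.zero_re, Complex.neg_re, Complex.mul_re, Complex.zero_im,
    Complex.neg_im, Complex.mul_im] at h2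
  have h3 : κ.im = 0 := by
    have : κ.re * κ.im = 0 := by linarith [h2.2]
    exact (mul_eq_zero.1 this).resolve_left hκ.ne'
  have h4 := h2.1
  rw [h3] at h4
  nlinarith

/-- `R₀(κ) = (H₀ + κ²)⁻¹`. -/
def freeRes (κ : ℂ) : Hil →L[ℂ] Hil := Ring.inverse (freeHil + κ ^ 2 • 1)

/-- The kernel `(ζ^|n-m| - ζ^(n+m)) ζ / (1 - ζ²)`, extended to `n = 0`. -/
def freeCol (ζ : ℂ) (m n : ℕ) : ℂ :=
  ζ / (1 - ζ ^ 2) * (ζ ^ (max n m - min n m) - ζ ^ (n + m))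

/-- Extending a sequence by the value `0` at index `0` removes the case distinction at the boundary.
-/
theorem freeLap_extend (u : ℕ → ℂ) (h0 : u 0 = 0) (n : ℕ+) :
    freeLap (fun k : ℕ+ => u k) n = 2 * u n - u (n + 1) - u (n - 1) := by
  rw [freeLap_apply]
  by_cases hn : n = 1
  · subst hn
    rw [shiftR_one]
    simp [h0]
  · obtain ⟨n, rfl⟩ := PNat.exists_eq_succ_of_ne_one hn
    rw [shiftR_succ]
    simp

/-- The relation between `ζ` and `κ` says `κ² = ζ + ζ⁻¹ - 2`, so `ζ^n` and `ζ^{-n}` solve the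
homogeneous equation. The kernel is such a solution on each side of the diagonal, with the jump `1`
across it. -/
theorem freeCol_eq {ζ κ : ℂ} (hζ : ζ ≠ 0) (hζ1 : 1 - ζ ^ 2 ≠ 0) (h : (1 - ζ) ^ 2 = κ ^ 2 * ζ)
    (m : ℕ) (hm : 1 ≤ m) (n : ℕ) (hn : 1 ≤ n) :
    2 * freeCol ζ m n - freeCol ζ m (n + 1) - freeCol ζ m (n - 1) + κ ^ 2 * freeCol ζ m n =
      if n = m then 1 else 0 := by
  have hκ : κ ^ 2 = (1 - ζ) ^ 2 / ζ := by rw [h, mul_div_cancel_right₀ _ hζ]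
  obtain ⟨n, rfl⟩ := Nat.exists_eq_add_of_le hn
  rw [hκ]
  simp only [freeCol]
  rcases lt_trichotomy (1 + n) m with hlt | heq | hgt
  · obtain ⟨d, rfl⟩ := Nat.exists_eq_add_of_lt hlt
    rw [if_neg (by omega)]
    have e1 : max (1 + n) (1 + n + d + 1) - min (1 + n) (1 + n + d + 1) = d + 1 := by omega
    have e2 : max (1 + n + 1) (1 + n + d + 1) - min (1 + n + 1) (1 + n + d + 1) = d := by omega
    have e3 : max (1 + n - 1) (1 + n + d + 1) - min (1 + n - 1) (1 + n + d + 1) = d + 2 := by omega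
    have e4 : 1 + n - 1 + (1 + n + d + 1) = 2 * n + d + 2 := by omega
    rw [e1, e2, e3, e4]
    field_simp
    ring
  · subst heq
    rw [if_pos rfl]
    have e1 : max (1 + n) (1 + n) - min (1 + n) (1 + n) = 0 := by omega
    have e2 : max (1 + n + 1) (1 + n) - min (1 + n + 1) (1 + n) = 1 := by omega
    have e3 : max (1 + n - 1) (1 + n) - min (1 + n - 1) (1 + n) = 1 := by omega
    have e4 : 1 + n - 1 + (1 + n) = 2 * n + 1 := by omega
    rw [e1, e2, e3, e4]
    field_simp
    ring
  · obtain ⟨d, hd⟩ := Nat.exists_eq_add_of_lt hgt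
    obtain ⟨m, rfl⟩ := Nat.exists_eq_add_of_le hm
    obtain rfl : n = m + d + 1 := by omega
    rw [if_neg (by omega)]
    have e1 : max (1 + (m + d + 1)) (1 + m) - min (1 + (m + d + 1)) (1 + m) = d + 1 := by omega
    have e2 : max (1 + (m + d + 1) + 1) (1 + m) - min (1 + (m + d + 1) + 1) (1 + m) = d + 2 := by
      omega
    have e3 : max (1 + (m + d + 1) - 1) (1 + m) - min (1 + (m + d + 1) - 1) (1 + m) = d := by omega
    have e4 : 1 + (m + d + 1) - 1 + (1 + m) = 2 * m + d + 2 := by omega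
    rw [e1, e2, e3, e4]
    field_simp
    ring

theorem summable_freeCol {ζ : ℂ} (hζ : ζ ≠ 0) (hζ1 : ‖ζ‖ < 1) (m : ℕ) :
    Summable fun n : ℕ+ => ‖freeCol ζ m n‖ ^ 2 := by
  have hpos : 0 < ‖ζ‖ := norm_pos_iff.2 hζ
  have hb : ∀ n : ℕ, ‖freeCol ζ m n‖ ≤ ‖ζ / (1 - ζ ^ 2)‖ * (2 / ‖ζ‖ ^ m) * ‖ζ‖ ^ n := by
    intro n
    have h1 : ∀ e : ℕ, n ≤ e + m → ‖ζ‖ ^ e ≤ ‖ζ‖ ^ n / ‖ζ‖ ^ m := by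
      intro e he
      rw [le_div_iff₀ (by positivity), ← pow_add]
      exact pow_le_pow_of_le_one hpos.le hζ1.le he
    have h2 : ‖ζ ^ (max n m - min n m) - ζ ^ (n + m)‖ ≤ 2 / ‖ζ‖ ^ m * ‖ζ‖ ^ n := by
      refine (norm_sub_le _ _).trans ?_
      rw [norm_pow, norm_pow]
      have h3 := h1 (max n m - min n m) (by omega)
      have h4 := h1 (n + m) (by omega)
      calc _ ≤ ‖ζ‖ ^ n / ‖ζ‖ ^ m + ‖ζ‖ ^ n / ‖ζ‖ ^ m := add_le_add h3 h4
        _ = _ := by ring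
    rw [freeCol, norm_mul, mul_assoc]
    exact mul_le_mul_of_nonneg_left h2 (norm_nonneg _)
  have hg : Summable fun n : ℕ+ =>
      (‖ζ / (1 - ζ ^ 2)‖ * (2 / ‖ζ‖ ^ m)) ^ 2 * (‖ζ‖ ^ 2) ^ (n : ℕ) := by
    refine Summable.mul_left _ ?_
    exact (summable_geometric_of_lt_one (by positivity)
      (pow_lt_one₀ hpos.le hζ1 two_ne_zero)).comp_injective PNat.coe_injective
  refine Summable.of_nonneg_of_le (fun n => by positivity) (fun n => ?_) hg
  calc ‖freeCol ζ m n‖ ^ 2 ≤ (‖ζ / (1 - ζ ^ 2)‖ * (2 / ‖ζ‖ ^ m) * ‖ζ‖ ^ (n : ℕ)) ^ 2 :=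
        pow_le_pow_left₀ (norm_nonneg _) (hb n) 2
    _ = _ := by rw [mul_pow, ← pow_mul, ← pow_mul, mul_comm 2]

/-- The kernel of the free resolvent. -/
theorem freeRes_single {ζ κ : ℂ} (hκ : 0 < κ.re) (hζ : ζ ≠ 0) (hζ1 : ‖ζ‖ < 1)
    (h : (1 - ζ) ^ 2 = κ ^ 2 * ζ) (n m : ℕ+) :
    freeRes κ (lp.single 2 m 1) n = freeCol ζ m n := by
  have hζ2 : 1 - ζ ^ 2 ≠ 0 := by
    intro h0
    have h1 : ‖ζ ^ 2‖ = 1 := by rw [← sub_eq_zero.1 h0, norm_one]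
    rw [norm_pow] at h1
    have := pow_lt_one₀ (norm_nonneg ζ) hζ1 two_ne_zero
    linarith
  let u : Hil := ⟨fun n => freeCol ζ m n, (memHil_iff _).2 (summable_freeCol hζ hζ1 m)⟩
  have hu : (freeHil + κ ^ 2 • (1 : Hil →L[ℂ] Hil)) u = lp.single 2 m 1 := by
    ext k
    have h1 : (freeHil + κ ^ 2 • (1 : Hil →L[ℂ] Hil)) u k =
        freeLap (fun k : ℕ+ => freeCol ζ m k) k + κ ^ 2 * freeCol ζ m k := rfl
    rw [h1, freeLap_extend (freeCol ζ m) (by simp [freeCol]),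
      freeCol_eq hζ hζ2 h m m.pos k k.pos, lp.coeFn_single, Pi.single_apply]
    simp only [PNat.coe_inj]
  have h2 : freeRes κ (lp.single 2 m 1) = u := by
    rw [← hu, ← mul_apply_eq_comp, freeRes, Ring.inverse_mul_cancel _ (isUnit_free hκ),
      one_apply_eq_self]
  rw [h2]

/-- A geometric sum with ratio `ζ²` cancels the denominator, which is singular at the threshold
value `ζ = 1`. -/
theorem freeCol_eq_sum {ζ : ℂ} (hζ : 1 - ζ ^ 2 ≠ 0) (n m : ℕ) :
    freeCol ζ m n = ∑ i ∈ Finset.range (min n m), ζ ^ (max n m - min n m + 1 + 2 * i) := by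
  have h1 : n + m = max n m - min n m + 2 * min n m := by omega
  rw [freeCol, h1]
  generalize min n m = a
  generalize max n m - a = d
  have h2 : ∀ i, ζ ^ (d + 1 + 2 * i) = ζ ^ (d + 1) * (ζ ^ 2) ^ i := fun i => by
    rw [pow_add, pow_mul]
  simp only [h2]
  rw [← Finset.mul_sum, geom_sum_eq (by intro h; exact hζ (by rw [h, sub_self]))]
  have h3 : ζ ^ 2 - 1 ≠ 0 := by
    intro h
    exact hζ (by rw [← neg_sub, h, neg_zero])
  rw [div_mul_eq_mul_div, mul_div_assoc', div_eq_div_iff hζ h3]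
  ring

/-- A Taylor remainder with explicit dependence on the exponent `p`, as needed for growth bounds on
kernels. Writing `E_N(p)` for the remainder, Pascal's rule gives `E_{N+1}(p+1) = E_{N+1}(p) - ω
E_N(p)`; the same rule adds up the bounds. -/
theorem norm_pow_sub_binomial_le {ω : ℂ} (h : ‖1 - ω‖ ≤ 1) (N p : ℕ) :
    ‖(1 - ω) ^ p - ∑ j ∈ Finset.range N, ω ^ j * ((-1) ^ j * (p.choose j : ℂ))‖ ≤
      p.choose N * ‖ω‖ ^ N := by
  induction N generalizing p with
  | zero => simpa using pow_le_one₀ (norm_nonneg _) h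
  | succ N ih =>
    induction p with
    | zero => simp [Finset.sum_range_succ', Nat.choose]
    | succ p ihp =>
      have hs : ∑ j ∈ Finset.range (N + 1), ω ^ j * ((-1) ^ j * ((p + 1).choose j : ℂ)) =
          ∑ j ∈ Finset.range (N + 1), ω ^ j * ((-1) ^ j * (p.choose j : ℂ)) -
            ω * ∑ j ∈ Finset.range N, ω ^ j * ((-1) ^ j * (p.choose j : ℂ)) := by
        rw [Finset.sum_range_succ', Finset.sum_range_succ' _ N, Finset.mul_sum]
        simp only [Nat.choose_succ_succ, Nat.cast_add, mul_add, Finset.sum_add_distrib, pow_succ]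
        simp only [Nat.choose_zero_right, Nat.cast_one, pow_zero]
        have : ∀ j, ω ^ j * ω * ((-1) ^ j * -1 * (p.choose j : ℂ)) =
            -(ω * (ω ^ j * ((-1) ^ j * (p.choose j : ℂ)))) := fun j => by ring
        simp only [this, Finset.sum_neg_distrib]
        ring
      have he : (1 - ω) ^ (p + 1) -
          ∑ j ∈ Finset.range (N + 1), ω ^ j * ((-1) ^ j * ((p + 1).choose j : ℂ)) =
          ((1 - ω) ^ p - ∑ j ∈ Finset.range (N + 1), ω ^ j * ((-1) ^ j * (p.choose j : ℂ))) -
          ω * ((1 - ω) ^ p - ∑ j ∈ Finset.range N, ω ^ j * ((-1) ^ j * (p.choose j : ℂ))) := by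
        rw [hs]
        ring
      rw [he]
      refine (norm_sub_le _ _).trans ?_
      rw [norm_mul]
      have h1 := mul_le_mul_of_nonneg_left (ih p) (norm_nonneg ω)
      have h2 : ((p + 1).choose (N + 1) : ℝ) = p.choose N + p.choose (N + 1) := by
        rw [Nat.choose_succ_succ]
        push_cast
        ring
      rw [h2]
      calc _ ≤ (p.choose (N + 1) : ℝ) * ‖ω‖ ^ (N + 1) + ‖ω‖ * (p.choose N * ‖ω‖ ^ N) :=
            add_le_add ihp h1
        _ = _ := by ring

/-- The parameter `μ = √(1 + κ²/4) - κ/2`, in terms of which the free kernel is explicit. -/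
theorem exists_uniformizer : ∃ μ : ℂ → ℂ, AnalyticAt ℂ μ 0 ∧ μ 0 = 1 ∧
    (∀ κ, μ κ ^ 2 + κ * μ κ = 1) ∧ ∀ᶠ κ in rightZero, ‖μ κ‖ < 1 := by
  let w : ℂ → ℂ := fun κ => (1 + κ ^ 2 / 4) ^ (1 / 2 : ℂ)
  have hw : ∀ κ, w κ ^ 2 = 1 + κ ^ 2 / 4 := fun κ => by
    simp only [w]
    rw [← Complex.cpow_nat_mul]
    simp
  have hwa : AnalyticAt ℂ w 0 := by
    refine AnalyticAt.cpow (by fun_prop) analyticAt_const ?_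
    simp
  have hμa : AnalyticAt ℂ (fun κ => w κ - κ / 2) 0 := by fun_prop
  have heq : ∀ κ, (w κ - κ / 2) ^ 2 + κ * (w κ - κ / 2) = 1 := fun κ => by
    linear_combination hw κ
  have h0 : w 0 - 0 / 2 = 1 := by simp [w]
  refine ⟨fun κ => w κ - κ / 2, hμa, h0, heq, ?_⟩
  have ht : Tendsto (fun κ => w κ - κ / 2) rightZero (𝓝 1) := by
    rw [← h0]
    exact hμa.continuousAt.tendsto.mono_left nhdsWithin_le_nhds
  -- From `κ = μ⁻¹ - μ` one has `Re κ = Re μ · (|μ|⁻² - 1)`. As `Re μ > 0` near `μ = 1`, the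
  -- condition `Re κ > 0` is `|μ| < 1`.
  have hre : ∀ᶠ κ in rightZero, 0 < (w κ - κ / 2).re :=
    ((Complex.continuous_re.tendsto 1).comp ht).eventually (lt_mem_nhds (by simp))
  filter_upwards [hre, eventually_re_pos] with κ h1 h2
  have h3 := heq κ
  generalize w κ - κ / 2 = μ at h1 h3
  have hμ : μ ≠ 0 := ne_zero_of_re_pos h1
  have h4 : κ = μ⁻¹ - μ := by
    field_simp
    linear_combination h3
  have hn : 0 < Complex.normSq μ := Complex.normSq_pos.2 hμ
  rw [h4, Complex.sub_re, Complex.inv_re, sub_pos, lt_div_iff₀ hn] at h2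
  have h5 : Complex.normSq μ < 1 := by
    by_contra! h
    nlinarith
  rw [Complex.normSq_eq_norm_sq] at h5
  exact (sq_lt_one_iff₀ (norm_nonneg μ)).1 h5

/-! Expansion of the free resolvent -/

/-- The size `min(n,m) max(n,m)^j` of the `j`-th coefficient of the free resolvent kernel. -/
def minMax (j : ℕ) (n m : ℕ+) : ℝ := min (n : ℕ) m * (max (n : ℕ) m : ℕ) ^ j

/-- Uneven splitting of the weight: the output grows only like `n^j`, at the price of one extra
power on the input. This is what keeps the correction `R₀ v M⁻¹ v* R₀` in small spaces, since `v`
supplies the extra decay. -/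
theorem minMax_le_right (j : ℕ) (n m : ℕ+) :
    minMax j n m ≤ weight j n * weight (j + 1 : ℕ) m := by
  have h1 : minMax j n m ≤ (n : ℝ) ^ j * (m : ℝ) ^ (j + 1) := by
    have h2 : min (n : ℕ) m * (max (n : ℕ) m) ^ j ≤ m * (n * m) ^ j := by
      refine Nat.mul_le_mul (min_le_right _ _) (Nat.pow_le_pow_left ?_ j)
      exact max_le (Nat.le_mul_of_pos_right _ m.pos) (Nat.le_mul_of_pos_left _ n.pos)
    unfold minMax
    calc ((min (n : ℕ) m : ℕ) : ℝ) * (max (n : ℕ) m : ℕ) ^ j ≤ m * (n * m) ^ j := by exact_mod_cast h2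
      _ = _ := by ring
  exact h1.trans (mul_le_mul (cast_pow_le_weight j n) (cast_pow_le_weight (j + 1) m)
    (by positivity) (weight_pos _ _).le)

theorem minMax_comm (j : ℕ) (n m : ℕ+) : minMax j n m = minMax j m n := by
  rw [minMax, minMax, min_comm, max_comm]

theorem minMax_le_left (j : ℕ) (n m : ℕ+) :
    minMax j n m ≤ weight (j + 1 : ℕ) n * weight j m := by
  rw [minMax_comm, mul_comm]
  exact minMax_le_right j m n

/-- For `j ≥ 1` one factor of the maximum is absorbed through `min · max = nm`, so weight `j`
suffices on each side; for `j = 0` the minimum alone still needs weight `1`. -/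
theorem minMax_le {j t : ℕ} (ht : 1 ≤ t) (hj : j ≤ t) (n m : ℕ+) :
    minMax j n m ≤ weight t n * weight t m := by
  have hn := n.pos
  have hm := m.pos
  have h2 : min (n : ℕ) m * (max (n : ℕ) m) ^ j ≤ (n * m) ^ t := by
    obtain ⟨t, rfl⟩ := Nat.exists_eq_add_of_le ht
    rcases Nat.eq_zero_or_pos j with rfl | hj0
    · rw [pow_zero, mul_one]
      refine ((min_le_left _ _).trans (Nat.le_mul_of_pos_right _ hm)).trans ?_
      exact Nat.le_self_pow (by omega) _
    · obtain ⟨j, rfl⟩ := Nat.exists_eq_add_of_le hj0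
      have h3 : max (n : ℕ) m ≤ n * m :=
        max_le (Nat.le_mul_of_pos_right _ hm) (Nat.le_mul_of_pos_left _ hn)
      calc min (n : ℕ) m * (max (n : ℕ) m) ^ (0 + 1 + j)
          = (min (n : ℕ) m * max (n : ℕ) m) * max (n : ℕ) m ^ j := by ring
        _ ≤ (n * m) * (n * m) ^ j := by
            rw [min_mul_max]
            exact Nat.mul_le_mul_left _ (Nat.pow_le_pow_left h3 j)
        _ = (n * m) ^ (1 + j) := by ring
        _ ≤ (n * m) ^ (1 + t) := Nat.pow_le_pow_right (Nat.mul_pos hn hm) (by omega)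
  have h3 : minMax j n m ≤ (n : ℝ) ^ t * (m : ℝ) ^ t := by
    unfold minMax
    rw [← mul_pow]
    exact_mod_cast h2
  exact h3.trans (mul_le_mul (cast_pow_le_weight t n) (cast_pow_le_weight t m) (by positivity)
    (weight_pos _ _).le)

theorem kerBound_of_minMax {j : ℕ} {t : ℝ} {C : ℝ} {k : ℕ+ → ℕ+ → ℂ} (ht : 1 ≤ t) (hj : j ≤ t)
    (h : ∀ n m, ‖k n m‖ ≤ C * minMax j n m) : KerBound t C k := by
  have hC : 0 ≤ C := by
    have := (norm_nonneg _).trans (h 1 1)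
    simpa [minMax] using this
  have h1 : KerBound (max 1 j : ℕ) C k := fun n m =>
    (h n m).trans (mul_le_mul_of_nonneg_left (minMax_le (le_max_left _ _) (le_max_right _ _) n m) hC)
  refine h1.mono ?_
  push_cast
  exact max_le ht hj

/-- The coefficients of the free resolvent kernel in powers of `ω = 1 - ζ`. -/
def binKer (j : ℕ) (n m : ℕ+) : ℂ :=
  ∑ i ∈ Finset.range (min (n : ℕ) m),
    (-1) ^ j * (((max (n : ℕ) m - min (n : ℕ) m + 1 + 2 * i).choose j : ℕ) : ℂ)

theorem choose_le_max {a b i : ℕ} (hi : i < a) (hab : a ≤ b) (j : ℕ) :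
    (b - a + 1 + 2 * i).choose j ≤ (2 * b) ^ j :=
  (Nat.choose_le_pow _ _).trans (Nat.pow_le_pow_left (by omega) j)

theorem norm_binKer_le (j : ℕ) (n m : ℕ+) : ‖binKer j n m‖ ≤ 2 ^ j * minMax j n m := by
  have h : ∀ i ∈ Finset.range (min (n : ℕ) m),
      ‖(-1) ^ j * (((max (n : ℕ) m - min (n : ℕ) m + 1 + 2 * i).choose j : ℕ) : ℂ)‖ ≤
        (2 * (max (n : ℕ) m : ℕ) : ℝ) ^ j := by
    intro i hi
    rw [norm_mul, norm_pow, norm_neg, norm_one, one_pow, one_mul, Complex.norm_natCast]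
    exact_mod_cast choose_le_max (Finset.mem_range.1 hi) min_le_max j
  refine (norm_sum_le_of_le _ h).trans (le_of_eq ?_)
  rw [Finset.sum_const, Finset.card_range, nsmul_eq_mul, minMax]
  ring

theorem binKer_zero (n m : ℕ+) : binKer 0 n m = (min (n : ℕ) m : ℕ) := by
  simp [binKer]

/-- The exponents `d + 1 + 2i`, `i < a`, sum to `a(a + d) = min · max`. The separable form is what
makes `M₁` of rank at most one. -/
theorem binKer_one (n m : ℕ+) : binKer 1 n m = -((n : ℂ) * m) := by
  have h : ∀ a d : ℕ, ∑ i ∈ Finset.range a, (d + 1 + 2 * i) = a * (a + d) := by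
    intro a d
    induction a with
    | zero => simp
    | succ a ih =>
      rw [Finset.sum_range_succ, ih]
      ring
  have h1 := h (min (n : ℕ) m) (max (n : ℕ) m - min (n : ℕ) m)
  rw [Nat.add_sub_cancel' min_le_max, min_mul_max] at h1
  simp only [binKer, pow_one, Nat.choose_one_right, neg_mul, one_mul, Finset.sum_neg_distrib]
  rw [← Nat.cast_sum, h1]
  push_cast
  rfl

/-- The binomial remainder is applied to each of the `min(n,m)` powers of `ζ`; every exponent is at
most `2 max(n,m)`. -/
theorem norm_freeCol_sub_le {ζ : ℂ} (hζ : ‖ζ‖ < 1) (N : ℕ) (n m : ℕ+) :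
    ‖freeCol ζ m n - ∑ j ∈ Finset.range N, (1 - ζ) ^ j * binKer j n m‖ ≤
      (2 * ‖1 - ζ‖) ^ N * minMax N n m := by
  have hζ2 : 1 - ζ ^ 2 ≠ 0 := by
    intro h0
    have h1 : ‖ζ ^ 2‖ = 1 := by rw [← sub_eq_zero.1 h0, norm_one]
    rw [norm_pow] at h1
    have := pow_lt_one₀ (norm_nonneg ζ) hζ two_ne_zero
    linarith
  have hs : ∑ j ∈ Finset.range N, (1 - ζ) ^ j * binKer j n m =
      ∑ i ∈ Finset.range (min (n : ℕ) m), ∑ j ∈ Finset.range N, (1 - ζ) ^ j * ((-1) ^ j *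
        (((max (n : ℕ) m - min (n : ℕ) m + 1 + 2 * i).choose j : ℕ) : ℂ)) := by
    rw [Finset.sum_comm]
    simp only [binKer, Finset.mul_sum]
  rw [freeCol_eq_sum hζ2, hs, ← Finset.sum_sub_distrib]
  have h : ∀ i ∈ Finset.range (min (n : ℕ) m),
      ‖ζ ^ (max (n : ℕ) m - min (n : ℕ) m + 1 + 2 * i) - ∑ j ∈ Finset.range N, (1 - ζ) ^ j *
        ((-1) ^ j * (((max (n : ℕ) m - min (n : ℕ) m + 1 + 2 * i).choose j : ℕ) : ℂ))‖ ≤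
        (2 * (max (n : ℕ) m : ℕ) : ℝ) ^ N * ‖1 - ζ‖ ^ N := by
    intro i hi
    have h1 : ‖1 - (1 - ζ)‖ ≤ 1 := by simpa using hζ.le
    have h2 := norm_pow_sub_binomial_le h1 N (max (n : ℕ) m - min (n : ℕ) m + 1 + 2 * i)
    rw [sub_sub_cancel] at h2
    refine h2.trans (mul_le_mul_of_nonneg_right ?_ (by positivity))
    exact_mod_cast choose_le_max (Finset.mem_range.1 hi) min_le_max N
  refine (norm_sum_le_of_le _ h).trans (le_of_eq ?_)
  rw [Finset.sum_const, Finset.card_range, nsmul_eq_mul, minMax]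
  ring

theorem toBOp_single {s : ℝ} (hs : 0 ≤ s) (T : Hil →L[ℂ] Hil) (n m : ℕ+) :
    (toBOp hs T (LOne.single s m)).seq n = T (lp.single 2 m 1) n := by
  have h : LOne.toHil hs (LOne.single s m) = lp.single 2 m 1 := by
    ext k
    rw [LOne.toHil_apply, LOne.seq_single, lp.coeFn_single]
  rw [toBOp, ContinuousLinearMap.comp_apply, ContinuousLinearMap.comp_apply, h, hilToInf_seq]

/-- Here `ζ = μ²`, so `1 - ζ = κμ` and the expansion in powers of `1 - ζ` is one in powers of `κμ`;
the factors `μ^j` are expanded in `κ` afterwards. -/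
theorem hasExp_toBOp_freeRes_aux {s : ℝ} (hs : 0 ≤ s) {N : ℕ} (hN : 1 ≤ N) (hNs : N ≤ s)
    {μ : ℂ → ℂ} (hμ : ∀ κ, μ κ ^ 2 + κ * μ κ = 1) (hμ1 : ∀ᶠ κ in rightZero, ‖μ κ‖ < 1) :
    (fun κ => toBOp hs (freeRes κ) -
      ∑ j ∈ Finset.range N, (κ * μ κ) ^ j • kerOp s (binKer j)) =O[rightZero]
        fun κ : ℂ => κ ^ N := by
  refine IsBigO.of_bound (2 ^ N) ?_
  filter_upwards [hμ1, eventually_re_pos] with κ h1 h2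
  have hω : κ * μ κ = 1 - μ κ ^ 2 := by linear_combination hμ κ
  have hμ0 : μ κ ≠ 0 := by
    intro h
    have := hμ κ
    rw [h] at this
    norm_num at this
  have hζ1 : ‖μ κ ^ 2‖ < 1 := by
    rw [norm_pow]
    exact pow_lt_one₀ (norm_nonneg _) h1 two_ne_zero
  have hs1 : (1 : ℝ) ≤ s := le_trans (by exact_mod_cast hN) hNs
  have hk : KerBound s ((2 * ‖1 - μ κ ^ 2‖) ^ N) fun n m => ((toBOp hs (freeRes κ) -
      ∑ j ∈ Finset.range N, (κ * μ κ) ^ j • kerOp s (binKer j)) (LOne.single s m)).seq n := by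
    refine kerBound_of_minMax (j := N) hs1 hNs fun n m => ?_
    have h3 : ((toBOp hs (freeRes κ) - ∑ j ∈ Finset.range N, (κ * μ κ) ^ j • kerOp s (binKer j))
        (LOne.single s m)).seq n =
        freeCol (μ κ ^ 2) m n - ∑ j ∈ Finset.range N, (1 - μ κ ^ 2) ^ j * binKer j n m := by
      rw [sub_apply, map_sub, Pi.sub_apply, toBOp_single,
        freeRes_single h2 (pow_ne_zero 2 hμ0) hζ1 (by rw [← hω]; ring), sum_apply, map_sum,
        Finset.sum_apply]
      congr 1
      refine Finset.sum_congr rfl fun j hj => ?_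
      have hj' : (j : ℝ) ≤ s := le_trans (by exact_mod_cast (Finset.mem_range.1 hj).le) hNs
      rw [smul_apply, map_smul, Pi.smul_apply,
        kerOp_single (kerBound_of_minMax hs1 hj' (norm_binKer_le j)), hω, smul_eq_mul]
    rw [h3]
    exact norm_freeCol_sub_le hζ1 N n m
  refine (BOp.norm_le_kernel hk).trans ?_
  rw [← hω, mul_pow, norm_mul, mul_pow, norm_pow]
  refine mul_le_mul_of_nonneg_left ?_ (by positivity)
  exact mul_le_of_le_one_right (by positivity) (pow_le_one₀ (norm_nonneg _) h1.le)

/-- The threshold expansion of the free resolvent. -/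
theorem exists_free_expansion : ∃ g : ℕ → ℕ+ → ℕ+ → ℂ,
    (∀ n m, g 0 n m = (min (n : ℕ) m : ℕ)) ∧ (∀ n m : ℕ+, g 1 n m = -((n : ℂ) * m)) ∧
    (∀ j, ∃ C, 0 ≤ C ∧ ∀ n m, ‖g j n m‖ ≤ C * minMax j n m) ∧
    ∀ (s : ℝ) (hs : 0 ≤ s) (N : ℕ), 1 ≤ N → N ≤ s →
      HasExp (fun κ => toBOp hs (freeRes κ)) N fun j => kerOp s (g j) := by
  obtain ⟨μ, hμa, hμ0, hμ, hμ1⟩ := exists_uniformizer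
  choose d hd using fun j : ℕ => HasExp.of_analyticAt (hμa.pow j)
  have hd0 : ∀ j, d j 0 = 1 := fun j => by
    have h1 := (hd j 1).zero_order le_rfl
    have h2 : Tendsto (fun κ => μ κ ^ j) rightZero (𝓝 1) := by
      have := (hμa.pow j).continuousAt.tendsto.mono_left
        (nhdsWithin_le_nhds (s := {κ : ℂ | 0 < κ.re}))
      rwa [Pi.pow_apply, hμ0, one_pow] at this
    exact tendsto_nhds_unique h1 h2
  have hd01 : d 0 1 = 0 := by
    have h1 : HasExp (fun _ : ℂ => (1 : ℂ)) 2 (d 0) :=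
      (hd 0 2).congr (Eventually.of_forall fun κ => by simp)
    have := h1.unique (HasExp.const (1 : ℂ) 2) 1 (by norm_num)
    simpa using this
  -- The coefficient of `κ^i` in `∑ (κμ)^j binKer j`: the factor `μ^j` contributes its Taylor
  -- coefficient of order `i - j`.
  refine ⟨fun i n m => ∑ j ∈ Finset.range (i + 1), d j (i - j) * binKer j n m, ?_, ?_, ?_, ?_⟩
  · intro n m
    simp [hd0, binKer_zero]
  · intro n m
    simp [Finset.sum_range_succ, hd0, hd01, binKer_one]
  · intro i
    refine ⟨∑ j ∈ Finset.range (i + 1), ‖d j (i - j)‖ * 2 ^ j, by positivity, fun n m => ?_⟩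
    rw [Finset.sum_mul]
    refine norm_sum_le_of_le _ fun j hj => ?_
    rw [norm_mul, mul_assoc]
    refine mul_le_mul_of_nonneg_left ((norm_binKer_le j n m).trans ?_) (norm_nonneg _)
    refine mul_le_mul_of_nonneg_left ?_ (by positivity)
    unfold minMax
    refine mul_le_mul_of_nonneg_left ?_ (by positivity)
    have : 1 ≤ max (n : ℕ) m := n.pos.trans_le (le_max_left _ _)
    exact pow_le_pow_right₀ (by exact_mod_cast this) (by have := Finset.mem_range.1 hj; omega)
  · intro s hs N hN hNs
    have hs1 : (1 : ℝ) ≤ s := le_trans (by exact_mod_cast hN) hNs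
    have h1 : HasExp (fun κ : ℂ => ∑ j ∈ Finset.range N, (κ * μ κ) ^ j • kerOp s (binKer j)) N
        fun i => ∑ j ∈ Finset.range N, if j ≤ i then d j (i - j) • kerOp s (binKer j) else 0 := by
      refine HasExp.sum fun j _ => ?_
      have h2 := (((hd j N).map (ContinuousLinearMap.toSpanSingleton ℂ
        (kerOp s (binKer j)))).shift j).trunc (Nat.le_add_right N j)
      refine (h2.congr (Eventually.of_forall fun κ => ?_)).congr_coeff fun i _ => ?_
      · simp [mul_pow, smul_smul]
      · simp
    have h3 := (HasExp.of_isBigO (hasExp_toBOp_freeRes_aux hs hN hNs hμ hμ1)).add h1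
    refine (h3.congr (Eventually.of_forall fun κ => by simp)).congr_coeff fun i hi => ?_
    rw [Pi.zero_apply, zero_add]
    refine BOp.ext_kernel fun n m => ?_
    have hb : ∀ j ≤ i, KerBound s (2 ^ j) (binKer j) := fun j hj => by
      refine kerBound_of_minMax hs1 ?_ (norm_binKer_le j)
      exact le_trans (by exact_mod_cast (by omega : j ≤ N)) hNs
    have hsum : KerBound s (∑ j ∈ Finset.range (i + 1), ‖d j (i - j)‖ * 2 ^ j) fun n m =>
        ∑ j ∈ Finset.range (i + 1), d j (i - j) * binKer j n m := by
      intro n m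
      rw [Finset.sum_mul]
      refine norm_sum_le_of_le _ fun j hj => ?_
      rw [norm_mul, mul_assoc]
      exact mul_le_mul_of_nonneg_left (hb j (by have := Finset.mem_range.1 hj; omega) n m)
        (norm_nonneg _)
    have hr : Finset.range (i + 1) = (Finset.range N).filter (· ≤ i) := by
      ext j
      simp only [Finset.mem_range, Finset.mem_filter]
      omega
    rw [kerOp_single hsum, sum_apply, map_sum, Finset.sum_apply, hr, Finset.sum_filter]
    refine Finset.sum_congr rfl fun j _ => ?_
    split_ifs with hj
    · rw [smul_apply, map_smul, Pi.smul_apply, kerOp_single (hb j hj), smul_eq_mul]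
    · simp

/-! The Hamiltonian on the weighted spaces -/

theorem LInf.norm_freeInf_le {s : ℝ} (hs : 0 ≤ s) (x : LInf s) :
    ‖freeInf hs x‖ ≤ (3 + 5 ^ (s / 2)) * ‖x‖ := by
  refine LInf.norm_le _ fun n => ?_
  have hN : 0 ≤ ‖x‖ := norm_nonneg x
  have h1 : ‖x.seq n‖ ≤ ‖x‖ * weight s n := x.apply_le n
  have h2 : ‖x.seq (n + 1)‖ ≤ ‖x‖ * (5 ^ (s / 2) * weight s n) :=
    (x.apply_le _).trans (mul_le_mul_of_nonneg_left (weight_le_succ hs n) hN)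
  have h3 : ‖shiftR x.seq n‖ ≤ ‖x‖ * weight s n := by
    by_cases h' : n = 1
    · subst h'
      rw [shiftR_one, norm_zero]
      exact mul_nonneg hN (weight_pos s 1).le
    · obtain ⟨m, rfl⟩ := PNat.exists_eq_succ_of_ne_one h'
      rw [shiftR_succ]
      exact (x.apply_le m).trans (mul_le_mul_of_nonneg_left (weight_succ_le hs m) hN)
  have h4 : ‖freeLap x.seq n‖ ≤ (3 + 5 ^ (s / 2)) * ‖x‖ * weight s n := by
    have := norm_freeLap_le x.seq n
    linarith
  calc weight (-s) n * ‖freeLap x.seq n‖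
      ≤ weight (-s) n * ((3 + 5 ^ (s / 2)) * ‖x‖ * weight s n) :=
        mul_le_mul_of_nonneg_left h4 (weight_pos _ n).le
    _ = (weight (-s) n * weight s n) * ((3 + 5 ^ (s / 2)) * ‖x‖) := by ring
    _ = _ := by rw [weight_neg_mul, one_mul]

/-- `H₀` as a bounded operator on `(𝓛^s)^*`. -/
def freeInfL {s : ℝ} (hs : 0 ≤ s) : LInf s →L[ℂ] LInf s :=
  (freeInf hs).mkContinuous (3 + 5 ^ (s / 2)) (LInf.norm_freeInf_le hs)

theorem freeInfL_seq {s : ℝ} (hs : 0 ≤ s) (x : LInf s) :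
    (freeInfL hs x).seq = freeLap x.seq := rfl

theorem freeOne_seq {s : ℝ} (hs : 0 ≤ s) (x : LOne s) :
    (freeOne hs x).seq = freeLap x.seq := rfl

theorem freeInfL_hilToInf {s : ℝ} (hs : 0 ≤ s) (x : Hil) :
    freeInfL hs (hilToInf hs x) = hilToInf hs (freeHil x) := rfl

theorem LOne.toInf_seq {s t : ℝ} (hs : 0 ≤ s) (ht : 0 ≤ t) (x : LOne s) :
    (hilToInf ht (LOne.toHil hs x)).seq = x.seq := rfl

/-! ### The factorized potential and the reduction to `M(κ)` -/

section Potential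

variable {K : Type*} [NormedAddCommGroup K] [InnerProductSpace ℂ K] [CompleteSpace K]
  {β : ℕ} {V : Hil →L[ℂ] Hil} {v : K →L[ℂ] LOne β} {U : K →L[ℂ] K}

/-- `H` as a bounded operator on `(𝓛^s)^*`, `0 ≤ s ≤ β`. -/
def hamInfL (v : K →L[ℂ] LOne β) (U : K →L[ℂ] K) {s : ℝ} (h0 : 0 ≤ s) (h : s ≤ β) :
    LInf s →L[ℂ] LInf s :=
  freeInfL h0 + ((hilToInf h0).comp (LOne.toHil (Nat.cast_nonneg β))).comp
    ((v.comp (U.comp (adjL v))).comp (LInf.incl h))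

theorem hamInfL_apply (v : K →L[ℂ] LOne β) (U : K →L[ℂ] K) {s : ℝ} (h0 : 0 ≤ s) (h : s ≤ β)
    (x : LInf s) : hamInfL v U h0 h x = hamInf v U h0 h x := rfl

theorem hamInf_seq (v : K →L[ℂ] LOne β) (U : K →L[ℂ] K) {s : ℝ} (h0 : 0 ≤ s) (h : s ≤ β)
    (x : LInf s) : (hamInf v U h0 h x).seq =
      freeLap x.seq + (potExt v U (LInf.incl h x)).seq := rfl

theorem hamOne_seq (v : K →L[ℂ] LOne β) (U : K →L[ℂ] K) {s : ℝ} (h0 : 0 ≤ s) (h : s ≤ β)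
    (x : LOne s) : (hamOne v U h0 h x).seq = freeLap x.seq +
      (potExt v U (hilToInf (Nat.cast_nonneg β) (LOne.toHil h0 x))).seq := by
  have h1 : hamOne v U h0 h x = freeOne h0 x +
    LOne.incl h (potExt v U (hilToInf (Nat.cast_nonneg β) (LOne.toHil h0 x))) := rfl
  rw [h1, map_add, LOne.incl_seq, freeOne_seq]

theorem hamInf_hilToInf (hV : IsFactored V v U) {s : ℝ} (h0 : 0 ≤ s) (h : s ≤ β) (x : Hil) :
    hamInf v U h0 h (hilToInf h0 x) = hilToInf h0 ((freeHil + V) x) := by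
  refine LInf.ext ?_
  have h1 : LInf.incl h (hilToInf h0 x) = hilToInf (Nat.cast_nonneg β) x := LInf.ext rfl
  rw [hamInf_seq, h1, ← hV.factor]
  rfl

theorem toHil_hamOne (hV : IsFactored V v U) {s : ℝ} (h0 : 0 ≤ s) (h : s ≤ β) (x : LOne s) :
    LOne.toHil h0 (hamOne v U h0 h x) = (freeHil + V) (LOne.toHil h0 x) := by
  ext n
  rw [LOne.toHil_apply, hamOne_seq, ← hV.factor]
  rfl

/-- A self-adjoint unitary is an involution. -/
theorem IsFactored.U_U (hV : IsFactored V v U) (k : K) : U (U k) = k := by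
  have h := Unitary.star_mul_self_of_mem hV.unitary_U
  rw [hV.selfAdjoint_U.star_eq] at h
  exact DFunLike.congr_fun h k

/-- `v` as an operator from `K` to `𝓗`. -/
def toHilOp (v : K →L[ℂ] LOne β) : K →L[ℂ] Hil := (LOne.toHil (Nat.cast_nonneg β)).comp v

theorem adjoint_toHilOp (v : K →L[ℂ] LOne β) :
    ContinuousLinearMap.adjoint (toHilOp v) = (adjL v).comp (hilToInf (Nat.cast_nonneg β)) := by
  ext x
  refine ext_inner_right ℂ fun k => ?_
  rw [ContinuousLinearMap.adjoint_inner_left, ContinuousLinearMap.comp_apply, adjL_apply, inner_adj,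
    lp.inner_eq_tsum]
  refine tsum_congr fun n => ?_
  rw [RCLike.inner_apply, mul_comm]
  rfl

theorem IsFactored.apply_eq (hV : IsFactored V v U) (x : Hil) :
    V x = toHilOp v (U (ContinuousLinearMap.adjoint (toHilOp v) x)) := by
  rw [adjoint_toHilOp]
  ext n
  exact congrFun (hV.factor x) n

/-- `M(κ) = U + v^* R₀(κ) v`. -/
def bsOp (v : K →L[ℂ] LOne β) (U : K →L[ℂ] K) (κ : ℂ) : K →L[ℂ] K :=
  U + (adjL v).comp ((toBOp (Nat.cast_nonneg β) (freeRes κ)).comp v)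

theorem bsOp_eq (v : K →L[ℂ] LOne β) (U : K →L[ℂ] K) (κ : ℂ) : bsOp v U κ =
    U + (ContinuousLinearMap.adjoint (toHilOp v)).comp ((freeRes κ).comp (toHilOp v)) := by
  rw [adjoint_toHilOp]
  rfl

/-- The resolvent in terms of `M(κ)`. -/
theorem resolv_eq (hV : IsFactored V v U) {κ : ℂ} (hκ : 0 < κ.re) (hM : IsUnit (bsOp v U κ)) :
    IsUnit (freeHil + V + κ ^ 2 • (1 : Hil →L[ℂ] Hil)) ∧
      resolv V κ = freeRes κ - (freeRes κ).comp ((toHilOp v).comp ((Ring.inverse (bsOp v U κ)).comp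
        ((ContinuousLinearMap.adjoint (toHilOp v)).comp (freeRes κ)))) := by
  set w := toHilOp v with hw
  set w' := ContinuousLinearMap.adjoint w with hw'
  set R := freeRes κ with hR
  set N := Ring.inverse (bsOp v U κ) with hN
  set T := freeHil + κ ^ 2 • (1 : Hil →L[ℂ] Hil) with hT
  have hTR : ∀ x, T (R x) = x := fun x =>
    DFunLike.congr_fun (Ring.mul_inverse_cancel _ (isUnit_free hκ)) x
  have hRT : ∀ x, R (T x) = x := fun x =>
    DFunLike.congr_fun (Ring.inverse_mul_cancel _ (isUnit_free hκ)) x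
  have hMN : ∀ k, bsOp v U κ (N k) = k := fun k =>
    DFunLike.congr_fun (Ring.mul_inverse_cancel _ hM) k
  have hNM : ∀ k, N (bsOp v U κ k) = k := fun k =>
    DFunLike.congr_fun (Ring.inverse_mul_cancel _ hM) k
  -- The substitution `v* R₀ v = M - U` together with `U² = 1` drives both products below; no
  -- inverse of `H + κ²` is presupposed.
  have hMk : ∀ k, w' (R (w k)) = bsOp v U κ k - U k := fun k => by
    rw [bsOp_eq]
    simp [hw, hw', hR]
  have hH : ∀ x, (freeHil + V + κ ^ 2 • (1 : Hil →L[ℂ] Hil)) x = T x + w (U (w' x)) := fun x => by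
    rw [← hV.apply_eq, hT]
    simp only [add_apply]
    abel
  set X := R - R.comp (w.comp (N.comp (w'.comp R))) with hX
  have hXx : ∀ x, X x = R x - R (w (N (w' (R x)))) := fun x => rfl
  have h1 : (freeHil + V + κ ^ 2 • (1 : Hil →L[ℂ] Hil)) * X = 1 := by
    ext1 x
    rw [mul_apply_eq_comp, one_apply_eq_self, hH, hXx, map_sub, hTR, hTR, map_sub, hMk, hMN,
      sub_sub_cancel, hV.U_U, sub_add_cancel]
  have h2 : X * (freeHil + V + κ ^ 2 • (1 : Hil →L[ℂ] Hil)) = 1 := by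
    ext1 x
    rw [mul_apply_eq_comp, one_apply_eq_self, hXx, hH, map_add R, hRT, map_add w', hMk, hV.U_U,
      add_sub_cancel, hNM, add_sub_cancel_right]
  let u : (Hil →L[ℂ] Hil)ˣ := ⟨_, X, h1, h2⟩
  exact ⟨u.isUnit, Ring.inverse_unit u⟩

end Potential

/-! Coefficient relations -/

/-- Applied with `F = κ^p R x` and `F'` the expansion of its image under `H`: comparing coefficients
turns the resolvent identity into a two-step recursion. -/
theorem HasExp.relation {E : Type*} [NormedAddCommGroup E] [NormedSpace ℂ E] {F F' : ℂ → E}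
    {n p : ℕ} {c c' : ℕ → E} {y : E} (hF : HasExp F n c) (hF' : HasExp F' n c')
    (h : ∀ᶠ κ in rightZero, F' κ + κ ^ 2 • F κ = κ ^ p • y) {k : ℕ} (hk : k < n) :
    c' k + (if 2 ≤ k then c (k - 2) else 0) = if k = p then y else 0 := by
  have h1 := (hF'.add ((hF.shift 2).trunc (Nat.le_add_right n 2))).congr h
  have h2 := h1.unique (HasExp.monomial p y n) k hk
  rwa [Pi.single_apply] at h2

/-! Zero-energy solutions of the free equation -/

/-- The kernel `min(n,m)` of `H₀⁻¹`. -/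
def minKer (n m : ℕ+) : ℂ := (min (n : ℕ) m : ℕ)

theorem norm_minKer (n m : ℕ+) : ‖minKer n m‖ = minMax 0 n m := by
  simp [minKer, minMax]

theorem kerBound_minKer {s : ℝ} (hs : 1 ≤ s) : KerBound s 1 minKer :=
  kerBound_of_minMax (j := 0) hs (by simpa using zero_le_one.trans hs)
    fun n m => by rw [norm_minKer, one_mul]

theorem freeLap_minKer (m : ℕ+) : freeLap (fun n => minKer n m) = Pi.single m 1 := by
  funext n
  have h := freeLap_extend (fun k => ((min k m : ℕ) : ℂ)) (by simp) n
  have h1 : freeLap (fun n => minKer n m) n = _ := h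
  rw [h1]
  have hn := n.pos
  rcases lt_trichotomy (n : ℕ) m with hlt | heq | hgt
  · rw [Pi.single_eq_of_ne (by rintro rfl; omega)]
    obtain ⟨k, hk⟩ := Nat.exists_eq_add_of_le' hn
    have e1 : min (n : ℕ) m = k + 1 := by omega
    have e2 : min ((n : ℕ) + 1) m = k + 2 := by omega
    have e3 : min ((n : ℕ) - 1) m = k := by omega
    rw [e1, e2, e3]
    push_cast
    ring
  · obtain rfl : n = m := PNat.eq heq
    rw [Pi.single_eq_same]
    obtain ⟨k, hk⟩ := Nat.exists_eq_add_of_le' hn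
    have e1 : min (n : ℕ) n = k + 1 := by omega
    have e2 : min ((n : ℕ) + 1) n = k + 1 := by omega
    have e3 : min ((n : ℕ) - 1) n = k := by omega
    rw [e1, e2, e3]
    push_cast
    ring
  · rw [Pi.single_eq_of_ne (by rintro rfl; omega)]
    have e1 : min (n : ℕ) m = m := by omega
    have e2 : min ((n : ℕ) + 1) m = m := by omega
    have e3 : min ((n : ℕ) - 1) m = m := by omega
    rw [e1, e2, e3]
    ring

/-- It suffices to check basis vectors, where the second difference of `min(·, m)` is a unit mass at
`m`; continuity does the rest. -/
theorem freeLap_green {s : ℝ} (hs : 1 ≤ s) (f : LOne s) : freeLap (kerSeq minKer f.seq) = f.seq := by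
  have hs0 : 0 ≤ s := zero_le_one.trans hs
  have h : (freeInfL hs0).comp (kerOp s minKer) = (hilToInf hs0).comp (LOne.toHil hs0) := by
    refine BOp.ext_kernel fun n m => ?_
    rw [ContinuousLinearMap.comp_apply, ContinuousLinearMap.comp_apply, LOne.toInf_seq,
      freeInfL_seq, kerOp_seq (kerBound_minKer hs),
      (funext fun k => kerSeq_single s minKer k m : kerSeq minKer (LOne.single s m).seq = _),
      freeLap_minKer, LOne.seq_single]
  have h1 := congrArg LInf.seq (DFunLike.congr_fun h f)
  rwa [ContinuousLinearMap.comp_apply, ContinuousLinearMap.comp_apply, LOne.toInf_seq,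
    freeInfL_seq, kerOp_seq (kerBound_minKer hs)] at h1

theorem eq_mul_of_freeLap_eq_zero {x : ℕ+ → ℂ} (h : freeLap x = 0) (n : ℕ+) : x n = n * x 1 := by
  induction n using PNat.strongInductionOn with
  | _ n ih =>
    by_cases hn : n = 1
    · subst hn
      simp
    · obtain ⟨n, rfl⟩ := PNat.exists_eq_succ_of_ne_one hn
      have h1 := congrFun h n
      rw [freeLap_apply, ih n (PNat.lt_add_right n 1), Pi.zero_apply] at h1
      by_cases hn' : n = 1
      · subst hn'
        rw [shiftR_one] at h1
        push_cast at h1 ⊢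
        linear_combination -h1
      · obtain ⟨k, rfl⟩ := PNat.exists_eq_succ_of_ne_one hn'
        rw [shiftR_succ, ih k ((PNat.lt_add_right k 1).trans (PNat.lt_add_right _ 1))] at h1
        push_cast at h1 ⊢
        linear_combination -h1

/-- `∑ m x[m]`. -/
def moment (x : ℕ+ → ℂ) : ℂ := ∑' m : ℕ+, (m : ℂ) * x m

/-- `∑_{m > n} (m - n) x[m]`. -/
def tail (x : ℕ+ → ℂ) (n : ℕ+) : ℂ := ∑' m : ℕ+, ((m - n : ℕ) : ℂ) * x m

theorem summable_moment {s : ℝ} (hs : 1 ≤ s) (f : LOne s) :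
    Summable fun m : ℕ+ => (m : ℂ) * f.seq m := by
  refine Summable.of_norm_bounded f.summable fun m => ?_
  rw [norm_mul, Complex.norm_natCast]
  refine mul_le_mul_of_nonneg_right ?_ (norm_nonneg _)
  have h1 := cast_pow_le_weight 1 m
  rw [pow_one, Nat.cast_one] at h1
  exact h1.trans (weight_mono hs m)

/-- Since `min(n,m) = m - (m - n)₊`, with truncated subtraction supplying the positive part. This
separates the constant at infinity from a decaying remainder. -/
theorem green_eq {s : ℝ} (hs : 1 ≤ s) (f : LOne s) (n : ℕ+) :
    kerSeq minKer f.seq n = moment f.seq - tail f.seq n := by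
  have h1 := summable_moment hs f
  have h2 := ((kerBound_minKer hs).seq_bound n f).1
  have h3 : ∀ m : ℕ+, ((m - n : ℕ) : ℂ) * f.seq m = (m : ℂ) * f.seq m - minKer n m * f.seq m := by
    intro m
    have : (m : ℕ) = (m - n) + min (n : ℕ) m := by omega
    have h4 : (m : ℂ) = ((m - n : ℕ) : ℂ) + minKer n m := by
      rw [minKer, ← Nat.cast_add, ← this]
    rw [h4]
    ring
  rw [tail, tsum_congr h3, h1.tsum_sub h2, moment, kerSeq, sub_sub_cancel]

/-- Summing over `n` first, `∑_{n ≤ m} (m - n)(1+n²)^{(β-2)/2} ≤ m² (1+m²)^{(β-2)/2}`, which the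
weight `β` at `m` dominates. The two powers lost here are the shift in `𝓛^{β-2}`. -/
theorem tail_mem {β : ℕ} (hβ : 2 ≤ β) (f : LOne β) : tail f.seq ∈ l1Sub ((β : ℝ) - 2) := by
  have hβ' : (0 : ℝ) ≤ (β : ℝ) - 2 := by
    have : (2 : ℝ) ≤ β := by exact_mod_cast hβ
    linarith
  have hcol : ∀ m : ℕ+, HasSum
      (fun n : ℕ+ => weight ((β : ℝ) - 2) n * ‖((m - n : ℕ) : ℂ) * f.seq m‖)
      (∑ n ∈ Finset.Icc 1 m, weight ((β : ℝ) - 2) n * ‖((m - n : ℕ) : ℂ) * f.seq m‖) := by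
    intro m
    refine hasSum_sum_of_ne_finset_zero fun n hn => ?_
    rw [Finset.mem_Icc, not_and] at hn
    have : (m : ℕ) - n = 0 := by
      have := hn _root_.one_le
      rw [not_le, ← PNat.coe_lt_coe] at this
      omega
    rw [this]
    simp
  have hbound : ∀ m : ℕ+,
      ∑ n ∈ Finset.Icc 1 m, weight ((β : ℝ) - 2) n * ‖((m - n : ℕ) : ℂ) * f.seq m‖ ≤
        weight β m * ‖f.seq m‖ := by
    intro m
    have h1 : ∀ n ∈ Finset.Icc 1 m, weight ((β : ℝ) - 2) n * ‖((m - n : ℕ) : ℂ) * f.seq m‖ ≤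
        weight ((β : ℝ) - 2) m * (m * ‖f.seq m‖) := by
      intro n hn
      have hnm : (n : ℕ) ≤ m := (PNat.coe_le_coe n m).2 (Finset.mem_Icc.1 hn).2
      rw [norm_mul, Complex.norm_natCast]
      refine mul_le_mul ?_ (mul_le_mul_of_nonneg_right (by exact_mod_cast Nat.sub_le _ _)
        (norm_nonneg _)) (by positivity) (weight_pos _ _).le
      unfold weight
      refine Real.rpow_le_rpow (by positivity) ?_ (by linarith)
      have : (n : ℝ) ≤ m := by exact_mod_cast hnm
      have : (n : ℝ) ^ 2 ≤ (m : ℝ) ^ 2 := pow_le_pow_left₀ (by positivity) this 2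
      linarith
    refine (Finset.sum_le_card_nsmul _ _ _ h1).trans ?_
    have hc : (Finset.Icc 1 m).card = m := by simp
    rw [hc, nsmul_eq_mul]
    have h2 : weight β m = weight ((β : ℝ) - 2) m * (1 + (m : ℝ) ^ 2) := by
      rw [← weight_two, ← weight_add, sub_add_cancel]
    rw [h2]
    have h3 : 0 ≤ weight ((β : ℝ) - 2) m * ‖f.seq m‖ :=
      mul_nonneg (weight_pos _ _).le (norm_nonneg _)
    nlinarith
  have h0 : ∀ p : ℕ+ × ℕ+, 0 ≤ weight ((β : ℝ) - 2) p.2 * ‖((p.1 - p.2 : ℕ) : ℂ) * f.seq p.1‖ :=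
    fun p => mul_nonneg (weight_pos _ _).le (norm_nonneg _)
  have hsum : Summable fun p : ℕ+ × ℕ+ =>
      weight ((β : ℝ) - 2) p.2 * ‖((p.1 - p.2 : ℕ) : ℂ) * f.seq p.1‖ := by
    refine (summable_prod_of_nonneg h0).2 ⟨fun m => (hcol m).summable, ?_⟩
    simp only [fun m => (hcol m).tsum_eq]
    refine Summable.of_nonneg_of_le (fun m => Finset.sum_nonneg fun n _ => h0 (m, n)) hbound
      f.summable
  have hsum' := (summable_prod_of_nonneg fun p => h0 p.swap).1 hsum.prod_symm
  refine Summable.of_nonneg_of_le (fun n => mul_nonneg (weight_pos _ n).le (norm_nonneg _))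
    (fun n => ?_) hsum'.2
  have hn : Summable fun m : ℕ+ => ‖((m - n : ℕ) : ℂ) * f.seq m‖ := by
    have h1 := (hsum'.1 n).mul_left (weight ((β : ℝ) - 2) n)⁻¹
    refine h1.congr fun m => ?_
    simp only [Prod.swap_prod_mk]
    rw [inv_mul_cancel_left₀ (weight_pos _ n).ne']
  calc weight ((β : ℝ) - 2) n * ‖tail f.seq n‖
      ≤ weight ((β : ℝ) - 2) n * ∑' m : ℕ+, ‖((m - n : ℕ) : ℂ) * f.seq m‖ :=
        mul_le_mul_of_nonneg_left (norm_tsum_le_tsum_norm hn) (weight_pos _ n).le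
    _ = _ := by rw [← tsum_mul_left]; rfl

/-- Summation by parts. -/
theorem tsum_freeLap_comm {s : ℝ} (hs : 0 ≤ s) (y : LInf s) (x : LOne s) :
    ∑' n, starRingEnd ℂ (y.seq n) * freeLap x.seq n =
      ∑' n, starRingEnd ℂ (freeLap y.seq n) * x.seq n := by
  have hshift : ∀ {f g : ℕ+ → ℂ} {a : ℂ}, g 1 = 0 → (∀ n, g (n + 1) = f n) → HasSum f a →
      HasSum g a := by
    intro f g a h1 h2 hf
    have h : f = g ∘ fun n => n + 1 := funext fun n => (h2 n).symm
    rw [h] at hf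
    refine (succ_injective.hasSum_iff fun n hn => ?_).1 hf
    by_cases h' : n = 1
    · rw [h', h1]
    · obtain ⟨m, rfl⟩ := PNat.exists_eq_succ_of_ne_one h'
      exact absurd ⟨m, rfl⟩ hn
  set a : ℕ+ → ℂ := fun n => starRingEnd ℂ (y.seq n) with ha
  have hs0 : Summable fun n => a n * x.seq n := (y.pair_bound x).1.of_norm
  have hs1 : Summable fun n => a n * x.seq (n + 1) := by
    have h1 : Summable fun n => ‖y‖ * (weight s (n + 1) * ‖x.seq (n + 1)‖) :=
      (x.summable.comp_injective succ_injective).mul_left _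
    refine Summable.of_norm_bounded h1 fun n => ?_
    rw [norm_mul, RCLike.norm_conj, ← mul_assoc]
    refine mul_le_mul_of_nonneg_right ((y.apply_le n).trans ?_) (norm_nonneg _)
    exact mul_le_mul_of_nonneg_left (weight_succ_le hs n) (norm_nonneg _)
  have hs2 : Summable fun n => a (n + 1) * x.seq n := by
    refine Summable.of_norm_bounded (x.summable.mul_left (‖y‖ * 5 ^ (s / 2))) fun n => ?_
    rw [norm_mul, RCLike.norm_conj, ← mul_assoc, mul_assoc ‖y‖]
    refine mul_le_mul_of_nonneg_right ((y.apply_le _).trans ?_) (norm_nonneg _)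
    exact mul_le_mul_of_nonneg_left (weight_le_succ hs n) (norm_nonneg _)
  have h1 : HasSum (fun n => shiftR a n * x.seq n) (∑' n, a n * x.seq (n + 1)) :=
    hshift (by simp [shiftR_one]) (fun n => by rw [shiftR_succ]) hs1.hasSum
  have h2 : HasSum (fun n => a n * shiftR x.seq n) (∑' n, a (n + 1) * x.seq n) :=
    hshift (by simp [shiftR_one]) (fun n => by rw [shiftR_succ]) hs2.hasSum
  have e1 := ((hs0.hasSum.mul_left 2).sub hs1.hasSum).sub h2
  have e2 := ((hs0.hasSum.mul_left 2).sub hs2.hasSum).sub h1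
  have f1 : ∀ n, a n * freeLap x.seq n =
      2 * (a n * x.seq n) - a n * x.seq (n + 1) - a n * shiftR x.seq n := fun n => by
    rw [freeLap_apply]
    ring
  have f2 : ∀ n, starRingEnd ℂ (freeLap y.seq n) * x.seq n =
      2 * (a n * x.seq n) - a (n + 1) * x.seq n - shiftR a n * x.seq n := fun n => by
    have h3 : starRingEnd ℂ (shiftR y.seq n) = shiftR a n := by
      simp only [shiftR, ha]
      split_ifs <;> simp
    rw [freeLap_apply, map_sub, map_sub, map_mul, h3, Complex.conj_ofNat]
    ring
  rw [tsum_congr f1, tsum_congr f2, e1.tsum_eq, e2.tsum_eq]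
  ring

/-! Zero modes -/

section ZeroModes

variable {K : Type*} [NormedAddCommGroup K] [InnerProductSpace ℂ K] [CompleteSpace K]
  {β : ℕ} {V : Hil →L[ℂ] Hil} {v : K →L[ℂ] LOne β} {U : K →L[ℂ] K}

theorem mem_genEig {x : ℕ+ → ℂ} : x ∈ genEig v U ↔
    ∃ y : LInf β, y.seq = x ∧ freeLap x + (potExt v U y).seq = 0 := by
  have h : ∀ y : LInf β, hamInf v U (Nat.cast_nonneg β) le_rfl y = 0 ↔
      freeLap y.seq + (potExt v U y).seq = 0 := fun y => by
    have h1 : LInf.incl le_rfl y = y := LInf.ext (LInf.incl_seq _ _)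
    have h2 := hamInf_seq v U (Nat.cast_nonneg β) le_rfl y
    rw [h1] at h2
    rw [← h2]
    exact ⟨fun h0 => by rw [h0, map_zero], fun h0 => LInf.ext (by rw [h0, map_zero])⟩
  rw [genEig, Submodule.mem_map]
  constructor
  · rintro ⟨y, hy, rfl⟩
    exact ⟨y, rfl, (h y).1 (LinearMap.mem_ker.1 hy)⟩
  · rintro ⟨y, rfl, hy⟩
    exact ⟨y, LinearMap.mem_ker.2 ((h y).2 hy), rfl⟩

/-- The leading coefficient `M_0 = U + v^* H₀⁻¹ v` of `M(κ)`. -/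
def bsZero (v : K →L[ℂ] LOne β) (U : K →L[ℂ] K) : K →L[ℂ] K :=
  U + (adjL v).comp ((kerOp β minKer).comp v)

theorem bsZero_apply (v : K →L[ℂ] LOne β) (U : K →L[ℂ] K) (k : K) :
    bsZero v U k = U k + adj v (kerOp β minKer (v k)) := rfl

/-- The zero mode attached to a vector of `ker M_0`. -/
theorem mode_of_bsZero (hV : IsFactored V v U) {k : K} (hk : bsZero v U k = 0) :
    -kerSeq minKer (v k).seq ∈ genEig v U ∧ (kerSeq minKer (v k).seq = 0 → k = 0) := by
  have hseq : (kerOp β minKer (v k)).seq = kerSeq minKer (v k).seq :=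
    kerOp_seq (kerBound_minKer hV.one_le) _
  rw [bsZero_apply] at hk
  -- For `Ψ = -H₀⁻¹vk` the equation `M₀k = 0` reads `v*Ψ = Uk`. Hence `VΨ = vUUk = vk = -H₀Ψ`, and
  -- `Ψ = 0` forces `Uk = 0`.
  have hadj : adj v (-kerOp β minKer (v k)) = U k := by
    rw [← adjL_apply, map_neg, adjL_apply]
    exact (eq_neg_of_add_eq_zero_left hk).symm
  constructor
  · refine mem_genEig.2 ⟨-kerOp β minKer (v k), by rw [map_neg, hseq], ?_⟩
    rw [potExt_apply, hadj, hV.U_U, map_neg, freeLap_green hV.one_le, neg_add_cancel]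
  · intro h0
    have h1 : kerOp β minKer (v k) = 0 := LInf.ext (by rw [hseq, h0, map_zero])
    rw [h1, neg_zero, ← adjL_apply, map_zero] at hadj
    rw [← hV.U_U k, ← hadj, map_zero]

/-- The zero mode of a kernel vector is minus its moment times `𝟏` plus a tail, so it always lies in
`ℂ𝟏 + 𝓛^{β-2}`. -/
theorem bsZero_injective_of_resEig (hV : IsFactored V v U) (hβ : 2 ≤ β) (h : resEig v U = ⊥) {k : K}
    (hk : bsZero v U k = 0) : k = 0 := by
  obtain ⟨h1, h2⟩ := mode_of_bsZero hV hk
  refine h2 (neg_eq_zero.1 ?_)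
  rw [← Submodule.mem_bot ℂ, ← h]
  refine ⟨h1, ?_⟩
  have h3 : -kerSeq minKer (v k).seq =
      (-moment (v k).seq) • (fun _ : ℕ+ => (1 : ℂ)) + tail (v k).seq := by
    funext n
    rw [Pi.neg_apply, green_eq hV.one_le, Pi.add_apply, Pi.smul_apply, smul_eq_mul]
    ring
  rw [h3]
  exact Submodule.add_mem_sup (Submodule.smul_mem _ _ (Submodule.mem_span_singleton_self _))
    (tail_mem hβ _)

theorem green_mem_of_moment (hV : IsFactored V v U) (hβ : 2 ≤ β) {k : K}
    (hm : moment (v k).seq = 0) : kerSeq minKer (v k).seq ∈ l1Sub ((β : ℝ) - 2) := by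
  have h3 : kerSeq minKer (v k).seq = -tail (v k).seq := by
    funext n
    rw [green_eq hV.one_le, hm, zero_sub, Pi.neg_apply]
  rw [h3]
  exact Submodule.neg_mem _ (tail_mem hβ _)

theorem eq_zero_of_eig (hV : IsFactored V v U) (hβ : 2 ≤ β) (h : eig v U = ⊥) {k : K}
    (hk : bsZero v U k = 0) (hm : moment (v k).seq = 0) : k = 0 := by
  obtain ⟨h1, h2⟩ := mode_of_bsZero hV hk
  refine h2 (neg_eq_zero.1 ?_)
  rw [← Submodule.mem_bot ℂ, ← h]
  exact ⟨h1, Submodule.neg_mem _ (green_mem_of_moment hV hβ hm)⟩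

theorem tendsto_zero_of_mem_l1Sub {s : ℝ} (hs : 0 ≤ s) {x : ℕ+ → ℂ} (hx : x ∈ l1Sub s) :
    Tendsto x cofinite (𝓝 0) := by
  have h1 : Summable fun n => ‖x n‖ :=
    Summable.of_nonneg_of_le (fun n => norm_nonneg _)
      (fun n => le_mul_of_one_le_left (norm_nonneg _) (one_le_weight hs n)) hx
  exact tendsto_zero_iff_norm_tendsto_zero.2 h1.tendsto_cofinite_zero

theorem Hil.tendsto_zero (x : Hil) : Tendsto x cofinite (𝓝 0) := by
  have h1 := ((memHil_iff _).1 (lp.memℓp x)).tendsto_cofinite_zero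
  have h2 : Tendsto (fun n => √(‖x n‖ ^ 2)) cofinite (𝓝 0) := by
    have := (Real.continuous_sqrt.tendsto 0).comp h1
    rwa [Real.sqrt_zero] at this
  refine tendsto_zero_iff_norm_tendsto_zero.2 (h2.congr fun n => Real.sqrt_sq (norm_nonneg _))

/-- The square summable zero modes are those in `𝓛^{β-2}`. -/
theorem map_ker_eq_eig (hV : IsFactored V v U) (hβ : 2 ≤ β) :
    (LinearMap.ker (freeHil + V).toLinearMap).map hilSeq = eig v U := by
  have hβ0 : (0 : ℝ) ≤ (β : ℝ) - 2 := by
    have : (2 : ℝ) ≤ β := by exact_mod_cast hβ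
    linarith
  have hb := Nat.cast_nonneg (α := ℝ) β
  have hham : ∀ x : Hil, (freeHil + V) x = 0 ↔
      freeLap x + (potExt v U (hilToInf hb x)).seq = 0 := fun x => by
    rw [← hV.factor]
    constructor
    · intro h
      funext n
      exact congrFun (congrArg hilSeq h) n
    · intro h
      ext n
      exact congrFun h n
  ext z
  rw [Submodule.mem_map]
  constructor
  · rintro ⟨x, hx, rfl⟩
    have hx0 := (hham x).1 (LinearMap.mem_ker.1 hx)
    refine ⟨mem_genEig.2 ⟨hilToInf hb x, rfl, hx0⟩, ?_⟩
    set f := potExt v U (hilToInf hb x) with hf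
    -- Adding `H₀⁻¹Vx` to `x` gives a free zero solution, hence a multiple `nc`. Decay of `x` and of
    -- the tail makes `nc` convergent.
    have h1 : freeLap (hilSeq x + kerSeq minKer f.seq) = 0 := by
      rw [map_add, freeLap_green hV.one_le]
      exact hx0
    set c := (hilSeq x + kerSeq minKer f.seq) 1 with hc
    have h2 : ∀ n : ℕ+, (n : ℂ) * c = x n + moment f.seq - tail f.seq n := fun n => by
      have := eq_mul_of_freeLap_eq_zero h1 n
      rw [Pi.add_apply, green_eq hV.one_le] at this
      rw [← this, add_sub_assoc]
      rfl
    have h3 : Tendsto (fun n : ℕ+ => (n : ℂ) * c) cofinite (𝓝 (moment f.seq)) := by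
      have := (x.tendsto_zero.add_const (moment f.seq)).sub
        (tendsto_zero_of_mem_l1Sub hβ0 (tail_mem hβ f))
      rw [zero_add, sub_zero] at this
      exact this.congr fun n => (h2 n).symm
    -- Successive differences of the convergent sequence `nc` are constantly `c` and tend to `0`.
    -- Then `c = 0`, the moment vanishes, and `x` is the tail.
    have h4 := (h3.comp succ_injective.tendsto_cofinite).sub h3
    have hc0 : c = 0 := by
      rw [sub_self] at h4
      refine tendsto_nhds_unique (tendsto_const_nhds.congr fun n => ?_) h4
      simp only [Function.comp_apply]
      push_cast
      ring
    have hm : moment f.seq = 0 := by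
      rw [hc0] at h3
      simp only [mul_zero] at h3
      exact (tendsto_nhds_unique tendsto_const_nhds h3).symm
    have h5 : hilSeq x = tail f.seq := by
      funext n
      have := h2 n
      rw [hc0, hm, mul_zero, add_zero] at this
      exact sub_eq_zero.1 this.symm
    rw [h5]
    exact tail_mem hβ f
  · rintro ⟨hz, hz1⟩
    obtain ⟨y, rfl, hy⟩ := mem_genEig.1 hz
    let w : LOne ((β : ℝ) - 2) := ⟨y.seq, hz1⟩
    have hw : hilToInf hb (LOne.toHil hβ0 w) = y := LInf.ext rfl
    refine ⟨LOne.toHil hβ0 w, LinearMap.mem_ker.2 ((hham _).2 ?_), rfl⟩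
    rw [hw]
    exact hy

/-- `κ² R(κ) → P₀` strongly along the ray `κ = t (1 + i)`. -/
theorem tendsto_sq_resolv (hV : IsSelfAdjoint V)
    (hinv : ∀ᶠ κ in rightZero, IsUnit (freeHil + V + κ ^ 2 • (1 : Hil →L[ℂ] Hil))) :
    ∃ κ : ℝ → ℂ, Tendsto κ (𝓝[>] 0) rightZero ∧ ∀ x : Hil,
      Tendsto (fun t => κ t ^ 2 • resolv V (κ t) x) (𝓝[>] 0)
        (𝓝 ((LinearMap.ker (freeHil + V).toLinearMap).starProjection x)) := by
  set H := freeHil + V with hH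
  have hsa : IsSelfAdjoint H := isPositive_freeHil.isSelfAdjoint.add hV
  -- On this ray `κ² = 2t²i` is purely imaginary, so self-adjointness alone bounds `κ²R(κ)` by `1`,
  -- whatever the spectrum near `0`.
  let κ : ℝ → ℂ := fun t => t * (1 + Complex.I)
  have hκ2 : ∀ t, κ t ^ 2 = ((2 * t ^ 2 : ℝ) : ℂ) * Complex.I := fun t => by
    simp only [κ]
    push_cast
    ring_nf
    rw [Complex.I_sq]
    ring
  have hκ : Tendsto κ (𝓝[>] 0) rightZero := by
    refine tendsto_nhdsWithin_iff.2 ⟨?_, ?_⟩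
    · have : Continuous κ := by fun_prop
      exact (this.tendsto' 0 0 (by simp [κ])).mono_left nhdsWithin_le_nhds
    · filter_upwards [self_mem_nhdsWithin] with t ht
      simpa [κ] using ht
  refine ⟨κ, hκ, fun x => ?_⟩
  set N := LinearMap.ker H.toLinearMap with hN
  have hlow : ∀ (τ : ℝ) (y : Hil), τ * ‖y‖ ≤ ‖H y + ((τ : ℂ) * Complex.I) • y‖ := by
    intro τ y
    rcases eq_or_ne y 0 with rfl | hy
    · simp
    have h1 : (⟪y, H y + ((τ : ℂ) * Complex.I) • y⟫_ℂ).im = τ * ‖y‖ ^ 2 := by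
      have h2 : (⟪y, H y⟫_ℂ).im = 0 := by
        rw [← Complex.conj_eq_iff_im, inner_conj_symm]
        exact hsa.isSymmetric y y
      rw [inner_add_right, Complex.add_im, h2, inner_smul_right, inner_self_eq_norm_sq_to_K,
        zero_add]
      simp [← Complex.ofReal_pow]
    have h3 : τ * ‖y‖ ^ 2 ≤ ‖y‖ * ‖H y + ((τ : ℂ) * Complex.I) • y‖ := by
      rw [← h1]
      exact ((le_abs_self _).trans (Complex.abs_im_le_norm _)).trans (norm_inner_le_norm _ _)
    have hpos : 0 < ‖y‖ := norm_pos_iff.2 hy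
    nlinarith
  have hall : ∀ᶠ t in 𝓝[>] (0 : ℝ), (∀ z, ‖κ t ^ 2 • resolv V (κ t) z‖ ≤ ‖z‖) ∧
      (∀ z, H z = 0 → κ t ^ 2 • resolv V (κ t) z = z) ∧
      ∀ z, ‖κ t ^ 2 • resolv V (κ t) (H z)‖ ≤ 2 * t ^ 2 * (2 * ‖z‖) := by
    filter_upwards [hκ.eventually hinv] with t hu
    set R := resolv V (κ t) with hR
    have hRl : ∀ z, H (R z) + κ t ^ 2 • R z = z := fun z =>
      DFunLike.congr_fun (Ring.mul_inverse_cancel _ hu) z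
    have hRr : ∀ z, R (H z) + κ t ^ 2 • R z = z := fun z => by
      have h1 := DFunLike.congr_fun (Ring.inverse_mul_cancel _ hu) z
      rw [← map_smul, ← map_add]
      exact h1
    have hnk : ‖κ t ^ 2‖ = 2 * t ^ 2 := by
      rw [hκ2, norm_mul, Complex.norm_I, mul_one, Complex.norm_real, Real.norm_of_nonneg
        (by positivity)]
    have hb : ∀ z, ‖κ t ^ 2 • R z‖ ≤ ‖z‖ := fun z => by
      have h1 := hlow (2 * t ^ 2) (R z)
      rw [← hκ2, hRl] at h1
      rwa [norm_smul, hnk]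
    refine ⟨hb, fun z hz => ?_, fun z => ?_⟩
    · have := hRr z
      rwa [hz, map_zero, zero_add] at this
    · rw [eq_sub_of_add_eq (hRr z), norm_smul, hnk]
      refine mul_le_mul_of_nonneg_left ?_ (by positivity)
      have := norm_sub_le z (κ t ^ 2 • R z)
      have := hb z
      linarith
  -- On `ker H` the operator `κ²R` is the identity, and on `Hu` it equals `κ²(u - κ²Ru)`, which
  -- tends to `0`. The uniform bound carries this to the closure of the range, the complement of the
  -- kernel.
  have hq : x - N.starProjection x ∈ closure (Set.range H) := by
    have h1 : x - N.starProjection x ∈ Nᗮ := N.sub_starProjection_mem_orthogonal x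
    have h2 := H.orthogonal_ker
    rw [← ContinuousLinearMap.star_eq_adjoint, hsa.star_eq] at h2
    have h3 : x - N.starProjection x ∈ (LinearMap.range H.toLinearMap).topologicalClosure := by
      rw [← h2]
      exact h1
    exact h3
  rw [Metric.tendsto_nhds]
  intro ε hε
  obtain ⟨_, ⟨u, rfl⟩, hu⟩ := Metric.mem_closure_iff.1 hq (ε / 2) (by linarith)
  have hsmall : ∀ᶠ t in 𝓝[>] (0 : ℝ), 2 * t ^ 2 * (2 * ‖u‖) < ε / 2 := by
    have : Continuous fun t : ℝ => 2 * t ^ 2 * (2 * ‖u‖) := by fun_prop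
    exact ((this.tendsto' 0 0 (by simp)).mono_left nhdsWithin_le_nhds).eventually
      (gt_mem_nhds (by linarith))
  filter_upwards [hall, hsmall] with t ⟨hb, hz, hr⟩ hs
  have hPx : H (N.starProjection x) = 0 := LinearMap.mem_ker.1 (N.starProjection_apply_mem x)
  have hdec : κ t ^ 2 • resolv V (κ t) x - N.starProjection x =
      κ t ^ 2 • resolv V (κ t) (x - N.starProjection x - H u) +
        κ t ^ 2 • resolv V (κ t) (H u) := by
    simp only [map_sub, smul_sub, hz _ hPx]
    abel
  rw [dist_eq_norm, hdec]
  have h1 := hb (x - N.starProjection x - H u)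
  rw [dist_eq_norm] at hu
  have h2 := hr u
  exact (norm_add_le _ _).trans_lt (by linarith)

end ZeroModes

/-! Inversion of `M(κ)` -/

/-- Inversion of an expansion with a degenerate leading coefficient: `P₁`, `P₂` are complementary
idempotents on whose ranges the orders `κ`, `κ²` of the expansion take over. -/
theorem HasExp.scaled_inverse {A : Type*} [NormedRing A] [NormedAlgebra ℂ A] [CompleteSpace A]
    {M : ℂ → A} {c : ℕ → A} {n p : ℕ} (hn : 1 ≤ n) (hM : HasExp M (n + p) c) {P₁ P₂ : A}
    (h1 : p = 0 → P₁ = 0) (h2 : p ≤ 1 → P₂ = 0) (h11 : P₁ * P₁ = P₁) (h22 : P₂ * P₂ = P₂)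
    (h12 : P₁ * P₂ = 0) (h21 : P₂ * P₁ = 0) (c01 : c 0 * P₁ = 0) (c02 : c 0 * P₂ = 0)
    (c12 : c 1 * P₂ = 0) (hL : IsUnit (c 0 + c 1 * P₁ + c 2 * P₂)) :
    (∀ᶠ κ in rightZero, IsUnit (M κ)) ∧
      ∃ d, HasExp (fun κ => κ ^ p • Ring.inverse (M κ)) n d := by
  have hr : ∀ {m : ℕ} (Q : A), m ≤ n + p → HasExp (fun κ => M κ * Q) m fun i => c i * Q :=
    fun Q hm => (hM.trunc hm).map ((ContinuousLinearMap.mul ℂ A).flip Q)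
  have hzero : ∀ m, HasExp (fun _ : ℂ => (0 : A)) m fun _ => 0 := fun m =>
    HasExp.of_isBigO (isBigO_zero _ _)
  -- If the block vanishes there is nothing to divide; otherwise `p` provides the extra known terms
  -- that the division by `κ` consumes. The second block is treated alike.
  have hY1 : HasExp (fun κ => κ⁻¹ • (M κ * P₁)) n fun i => c (i + 1) * P₁ := by
    rcases Nat.eq_zero_or_pos p with hp | hp
    · simpa only [h1 hp, mul_zero, smul_zero] using hzero n
    · have h3 : HasExp (fun κ : ℂ => κ ^ 1 • κ⁻¹ • (M κ * P₁)) (n + 1) fun i => c i * P₁ := by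
        refine (hr P₁ (by omega)).congr (eventually_ne_zero.mono fun κ hκ => ?_)
        beta_reduce
        rw [pow_one, smul_inv_smul₀ hκ]
      refine HasExp.unshift 1 h3 fun i hi => ?_
      obtain rfl : i = 0 := by omega
      exact c01
  have hY2 : HasExp (fun κ => (κ ^ 2)⁻¹ • (M κ * P₂)) n fun i => c (i + 2) * P₂ := by
    rcases Nat.lt_or_ge p 2 with hp | hp
    · simpa only [h2 (by omega), mul_zero, smul_zero] using hzero n
    · have h3 : HasExp (fun κ : ℂ => κ ^ 2 • (κ ^ 2)⁻¹ • (M κ * P₂)) (n + 2) fun i => c i * P₂ := by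
        refine (hr P₂ (by omega)).congr (eventually_ne_zero.mono fun κ hκ => ?_)
        beta_reduce
        rw [smul_inv_smul₀ (pow_ne_zero 2 hκ)]
      refine HasExp.unshift 2 h3 fun i hi => ?_
      interval_cases i
      · exact c02
      · exact c12
  -- Rescaling the blocks makes the leading coefficient of `MD` invertible. Then `M⁻¹ = D (MD)⁻¹`,
  -- and the only poles are those of `D`.
  set D : ℂ → A := fun κ => (1 - P₁ - P₂) + κ⁻¹ • P₁ + (κ ^ 2)⁻¹ • P₂ with hD
  set D' : ℂ → A := fun κ => (1 - P₁ - P₂) + κ • P₁ + κ ^ 2 • P₂ with hD'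
  have hY : HasExp (fun κ => M κ * D κ) n
      fun i => c i * (1 - P₁ - P₂) + c (i + 1) * P₁ + c (i + 2) * P₂ := by
    refine (((hr (1 - P₁ - P₂) (Nat.le_add_right n p)).add hY1).add hY2).congr
      (Eventually.of_forall fun κ => ?_)
    simp only [hD, mul_add, mul_smul_comm]
  have hY0 : IsUnit (c 0 * (1 - P₁ - P₂) + c (0 + 1) * P₁ + c (0 + 2) * P₂) := by
    rw [mul_sub, mul_sub, c01, c02, mul_one, sub_zero, sub_zero]
    exact hL
  obtain ⟨hYu, e, he⟩ := hY.inverse hn hY0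
  have hDD : ∀ κ : ℂ, κ ≠ 0 → D κ * D' κ = 1 ∧ D' κ * D κ = 1 := by
    intro κ hκ
    constructor <;>
    · simp only [hD, hD', mul_add, add_mul, mul_sub, sub_mul, mul_smul_comm, smul_mul_assoc, h11, h22,
        h12, h21, mul_one, one_mul, smul_zero, sub_zero, add_zero, zero_add,
        sub_self, smul_smul, inv_mul_cancel₀ hκ, mul_inv_cancel₀ hκ,
        inv_mul_cancel₀ (pow_ne_zero 2 hκ), mul_inv_cancel₀ (pow_ne_zero 2 hκ), one_smul]
      abel
  have hinv : ∀ᶠ κ in rightZero, IsUnit (M κ) ∧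
      Ring.inverse (M κ) = D κ * Ring.inverse (M κ * D κ) := by
    filter_upwards [hYu, eventually_ne_zero] with κ hu hκ
    have e1 : M κ * (D κ * Ring.inverse (M κ * D κ)) = 1 := by
      rw [← mul_assoc, Ring.mul_inverse_cancel _ hu]
    have e2 : (D κ * Ring.inverse (M κ * D κ)) * M κ = 1 := by
      have hM' : M κ = M κ * D κ * D' κ := by rw [mul_assoc, (hDD κ hκ).1, mul_one]
      nth_rewrite 2 [hM']
      rw [← mul_assoc, mul_assoc (D κ), Ring.inverse_mul_cancel _ hu, mul_one, (hDD κ hκ).1]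
    let u : Aˣ := ⟨M κ, _, e1, e2⟩
    exact ⟨u.isUnit, Ring.inverse_unit u⟩
  refine ⟨hinv.mono fun κ h => h.1, ?_⟩
  have hDexp : ∃ e', HasExp (fun κ => κ ^ p • D κ) n e' := by
    have hq1 : ∃ e', HasExp (fun κ : ℂ => κ ^ p • κ⁻¹ • P₁) n e' := by
      rcases Nat.eq_zero_or_pos p with hp | hp
      · exact ⟨_, by simpa only [h1 hp, smul_zero] using hzero n⟩
      · obtain ⟨q, rfl⟩ : ∃ q, p = q + 1 := ⟨p - 1, by omega⟩
        refine ⟨_, (HasExp.monomial q P₁ n).congr (eventually_ne_zero.mono fun κ hκ => ?_)⟩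
        beta_reduce
        rw [pow_succ, mul_smul, smul_inv_smul₀ hκ]
    have hq2 : ∃ e', HasExp (fun κ : ℂ => κ ^ p • (κ ^ 2)⁻¹ • P₂) n e' := by
      rcases Nat.lt_or_ge p 2 with hp | hp
      · exact ⟨_, by simpa only [h2 (by omega), smul_zero] using hzero n⟩
      · obtain ⟨q, rfl⟩ := Nat.exists_eq_add_of_le' hp
        refine ⟨_, (HasExp.monomial q P₂ n).congr (eventually_ne_zero.mono fun κ hκ => ?_)⟩
        beta_reduce
        rw [pow_add, mul_smul, smul_inv_smul₀ (pow_ne_zero 2 hκ)]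
    obtain ⟨e1, he1⟩ := hq1
    obtain ⟨e2, he2⟩ := hq2
    refine ⟨_, (((HasExp.monomial p (1 - P₁ - P₂) n).add he1).add he2).congr
      (Eventually.of_forall fun κ => ?_)⟩
    simp only [hD, smul_add]
  obtain ⟨e', he'⟩ := hDexp
  refine ⟨_, (HasExp.bilin (ContinuousLinearMap.mul ℂ A) he' he).congr ?_⟩
  filter_upwards [hinv] with κ h
  rw [h.2, ContinuousLinearMap.mul_apply', smul_mul_assoc]

/-! ### Compact perturbations of `U` and nondegeneracy of the rescaled operator -/

section Fredholm

variable {K : Type*} [NormedAddCommGroup K] [InnerProductSpace ℂ K] {U C : K →L[ℂ] K}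

/-- As `U² = 1`, `U + C = U(1 + UC)`; the Fredholm alternative for the compact `UC` at `-1` leaves
only an eigenvector, which injectivity excludes. -/
theorem isUnit_of_injective_add_compact [CompleteSpace K] (hU : ∀ k, U (U k) = k) (hC : IsCompactOperator C)
    (hinj : ∀ k, (U + C) k = 0 → k = 0) : IsUnit (U + C) := by
  have hT : IsCompactOperator (U * C) := hC.clm_comp U
  have hUU : U * U = 1 := ContinuousLinearMap.ext hU
  have hu : IsUnit U := ⟨⟨U, U, hUU, hUU⟩, rfl⟩
  rcases hT.hasEigenvalue_or_mem_resolventSet (μ := (-1 : ℂ)) (by norm_num) with h | h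
  · obtain ⟨x, hx⟩ := h.exists_hasEigenvector
    have h1 : U (C x) = (-1 : ℂ) • x := hx.apply_eq_smul
    refine absurd (hinj x ?_) hx.2
    have h2 : U x + C x = U (x + U (C x)) := by rw [map_add, hU]
    rw [add_apply, h2, h1, neg_one_smul, add_neg_cancel, map_zero]
  · rw [spectrum.mem_resolventSet_iff] at h
    have h1 : U + C = U * -(algebraMap ℂ (K →L[ℂ] K) (-1) - U * C) := by
      rw [map_neg, map_one, neg_sub, sub_neg_eq_add, mul_add, ← mul_assoc, hUU, one_mul, mul_one,
        add_comm]
    rw [h1]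
    exact hu.mul h.neg

/-- On the kernel the compact operator `-UC` acts as the identity. -/
theorem finiteDimensional_ker_add_compact (hU : ∀ k, U (U k) = k) (hC : IsCompactOperator C) :
    FiniteDimensional ℂ (LinearMap.ker (U + C).toLinearMap) := by
  set N := LinearMap.ker (U + C).toLinearMap with hN
  have hcl : IsClosed (N : Set K) := (U + C).isClosed_ker
  have h1 : IsCompactOperator ((-(U * C)).comp N.subtypeL) :=
    ((hC.clm_comp (-U)).comp_clm N.subtypeL)
  have h2 : ∀ x : N, (-(U * C)).comp N.subtypeL x = x := fun x => by
    have h3 : U x + C x = 0 := LinearMap.mem_ker.1 x.2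
    have h4 : U (C x) = -x := by rw [eq_neg_of_add_eq_zero_right h3, map_neg, hU]
    change -(U (C x)) = x
    rw [h4, neg_neg]
  have h5 := h1.codRestrict (V := N) (fun x => by rw [h2]; exact x.2) hcl
  have h6 : ∀ f : N → N, (∀ x, f x = x) → IsCompactOperator f → IsCompactOperator (id : N → N) :=
    fun f hf h => by rwa [show f = id from funext hf] at h
  exact FiniteDimensional.of_isCompactOperator_id (𝕜 := ℂ) (h6 _ (fun x => Subtype.ext (h2 x)) h5)

theorem isCompactOperator_starProjection (N : Submodule ℂ K) [FiniteDimensional ℂ N] :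
    IsCompactOperator N.starProjection := by
  have := FiniteDimensional.proper ℂ N
  have h : IsCompactOperator N.orthogonalProjectionOnto :=
    isCompactOperator_of_locallyCompactSpace_dom N.orthogonalProjectionOnto
  exact h.clm_comp N.subtypeL

/-- Nondegeneracy of the block-triangular leading coefficient. -/
theorem scaled_injective [CompleteSpace K] {c₀ c₁ c₂ : K →L[ℂ] K} {η : K} (hc : IsSelfAdjoint c₀)
    {N N₂ : Submodule ℂ K} [N.HasOrthogonalProjection] [N₂.HasOrthogonalProjection]
    (hN : ∀ x, x ∈ N ↔ c₀ x = 0) (hN₂ : ∀ x, x ∈ N₂ ↔ x ∈ N ∧ ⟪η, x⟫_ℂ = 0)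
    (h1 : ∀ x ∈ N, c₁ x = -(⟪η, x⟫_ℂ • η)) (h2 : ∀ x ∈ N₂, ⟪x, c₂ x⟫_ℂ = 0 → x = 0) {x : K}
    (hx : c₀ x + c₁ (N.starProjection x - N₂.starProjection x) + c₂ (N₂.starProjection x) = 0) :
    x = 0 := by
  have hle : N₂ ≤ N := fun y hy => ((hN₂ y).1 hy).1
  set u := N₂.starProjection x with hu
  set y := N.starProjection x - u with hy
  have hu2 : u ∈ N₂ := N₂.starProjection_apply_mem x
  have hyN : y ∈ N := N.sub_mem (N.starProjection_apply_mem x) (hle hu2)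
  have hz : ∀ z ∈ N, ⟪z, c₀ x⟫_ℂ = 0 := fun z hz => by
    have := hc.isSymmetric z x
    rw [ContinuousLinearMap.coe_coe, (hN z).1 hz, inner_zero_left] at this
    exact this.symm
  have hη : ∀ z, ⟪z, c₁ y⟫_ℂ = -(⟪η, y⟫_ℂ * ⟪z, η⟫_ℂ) := fun z => by
    rw [h1 y hyN, inner_neg_right, inner_smul_right]
  -- Pairing with `u ∈ N₂` kills the `c₀` term by self-adjointness and the `c₁` term because `u ⊥
  -- η`, leaving only the definite form of `c₂`.
  have hu0 : u = 0 := by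
    refine h2 u hu2 ?_
    have h3 := congrArg (fun w => ⟪u, w⟫_ℂ) hx
    simp only [inner_add_right, inner_zero_right, hz u (hle hu2), hη] at h3
    rw [← inner_conj_symm u η, ((hN₂ u).1 hu2).2, map_zero, mul_zero, neg_zero, zero_add,
      zero_add] at h3
    exact h3
  rw [hu0, map_zero, add_zero] at hx
  -- With `u = 0`, pairing with `y ∈ N` leaves `-|⟨η, y⟩|² = 0`. So `y` lies in `N₂`, while its
  -- projection to `N₂` is `u = 0`.
  have hy2 : y ∈ N₂ := by
    refine (hN₂ y).2 ⟨hyN, ?_⟩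
    have h3 := congrArg (fun w => ⟪y, w⟫_ℂ) hx
    simp only [inner_add_right, inner_zero_right, hz y hyN, hη, zero_add, neg_eq_zero] at h3
    rcases mul_eq_zero.1 h3 with h4 | h4
    · exact h4
    · rw [← inner_conj_symm, h4, map_zero]
  have hyx : N.starProjection x = y := by rw [hy, hu0, sub_zero]
  have hy0 : y = 0 := by
    have h4 : N₂.starProjection (N.starProjection x) = N₂.starProjection x :=
      DFunLike.congr_fun (Submodule.starProjection_comp_starProjection_of_le hle) x
    rw [← Submodule.starProjection_eq_self_iff.2 hy2, ← hyx, h4]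
    exact hu0
  rw [hy0, map_zero, add_zero] at hx
  rw [← Submodule.starProjection_eq_self_iff.2 ((hN x).2 hx), hyx, hy0]

end Fredholm

/-! ### The first three coefficients of `M(κ)` and its inverse -/

section Threshold

variable {K : Type*} [NormedAddCommGroup K] [InnerProductSpace ℂ K] [CompleteSpace K]
  {β : ℕ} {V : Hil →L[ℂ] Hil} {v : K →L[ℂ] LOne β} {U : K →L[ℂ] K}

/-- The compression `T ↦ v^* T v`. -/
def compress (v : K →L[ℂ] LOne β) : BOp β →L[ℂ] (K →L[ℂ] K) :=
  (ContinuousLinearMap.compL ℂ K (LInf β) K (adjL v)).comp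
    ((ContinuousLinearMap.compL ℂ K (LOne β) (LInf β)).flip v)

theorem compress_apply (v : K →L[ℂ] LOne β) (T : BOp β) :
    compress v T = (adjL v).comp (T.comp v) := rfl

theorem hasExp_bsOp {g : ℕ → ℕ+ → ℕ+ → ℂ} {N : ℕ} (U : K →L[ℂ] K)
    (hg : HasExp (fun κ => toBOp (Nat.cast_nonneg β) (freeRes κ)) N fun j => kerOp β (g j)) :
    HasExp (bsOp v U) N fun i => (Pi.single 0 U : ℕ → K →L[ℂ] K) i + compress v (kerOp β (g i)) :=
  (HasExp.const U N).add (hg.map (compress v))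

/-- The kernel `min(n,m)` is already bounded from `𝓛^1` to its dual, so the compression factors
through `v` as a map into `𝓛^1`, where it is compact. -/
theorem isCompactOperator_bsZero (hV : IsFactored V v U) :
    IsCompactOperator (compress v (kerOp β minKer)) := by
  have h1 : compress v (kerOp β minKer) = ((adjL ((LOne.incl hV.one_le).comp v)).comp
      (kerOp 1 minKer)).comp ((LOne.incl hV.one_le).comp v) := by
    ext k
    refine adj_congr (fun l => (LOne.incl_seq hV.one_le (v l)).symm) ?_
    change (kerOp (β : ℝ) minKer (v k)).seq = (kerOp 1 minKer (LOne.incl hV.one_le (v k))).seq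
    rw [kerOp_seq (kerBound_minKer hV.one_le), kerOp_seq (kerBound_minKer le_rfl),
      LOne.incl_seq]
  rw [h1]
  exact hV.compact.clm_comp ((adjL ((LOne.incl hV.one_le).comp v)).comp (kerOp 1 minKer))

/-- For real `t > 0` each `M(t)` is self-adjoint, and self-adjointness passes to the norm limit. -/
theorem isSelfAdjoint_bsZero (hV : IsFactored V v U)
    (h : Tendsto (bsOp v U) rightZero (𝓝 (bsZero v U))) : IsSelfAdjoint (bsZero v U) := by
  have hκ : Tendsto (fun t : ℝ => (t : ℂ)) (𝓝[>] 0) rightZero := by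
    refine tendsto_nhdsWithin_iff.2 ⟨?_, ?_⟩
    · exact (Complex.continuous_ofReal.tendsto' 0 0 Complex.ofReal_zero).mono_left
        nhdsWithin_le_nhds
    · filter_upwards [self_mem_nhdsWithin] with t ht
      simpa using ht
  have h1 : ∀ t : ℝ, star (bsOp v U t) = bsOp v U t := by
    intro t
    have hR : star (freeRes t) = freeRes t := by
      have h2 : star (freeHil + (t : ℂ) ^ 2 • (1 : Hil →L[ℂ] Hil)) =
          freeHil + (t : ℂ) ^ 2 • (1 : Hil →L[ℂ] Hil) := by
        rw [star_add, star_smul, star_one, isPositive_freeHil.isSelfAdjoint.star_eq]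
        simp
      rw [freeRes, ← Ring.inverse_star, h2]
    rw [bsOp_eq, star_add, hV.selfAdjoint_U.star_eq]
    congr 1
    rw [ContinuousLinearMap.star_eq_adjoint, ContinuousLinearMap.adjoint_comp,
      ContinuousLinearMap.adjoint_comp, ContinuousLinearMap.adjoint_adjoint,
      ← ContinuousLinearMap.star_eq_adjoint (freeRes t), hR, ContinuousLinearMap.comp_assoc]
  have h2 := h.comp hκ
  refine tendsto_nhds_unique (((continuous_star.tendsto _).comp h2).congr fun t => ?_) h2
  exact h1 t

/-- The sequence `n ↦ n`. -/
def linSeq {s : ℝ} (hs : 1 ≤ s) : LInf s :=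
  ⟨fun n => n, 1, by
    rintro _ ⟨n, rfl⟩
    have h1 : ‖(n : ℂ)‖ ≤ weight s n := by
      have h2 := cast_pow_le_weight 1 n
      rw [pow_one, Nat.cast_one] at h2
      rw [Complex.norm_natCast]
      exact h2.trans (weight_mono hs n)
    calc weight (-s) n * ‖(n : ℂ)‖ ≤ weight (-s) n * weight s n :=
          mul_le_mul_of_nonneg_left h1 (weight_pos _ n).le
      _ = 1 := weight_neg_mul s n⟩

theorem inner_adj_linSeq (hβ : (1 : ℝ) ≤ β) (k : K) :
    ⟪adj v (linSeq hβ), k⟫_ℂ = moment (v k).seq := by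
  rw [inner_adj]
  refine tsum_congr fun n => ?_
  change starRingEnd ℂ ((n : ℕ) : ℂ) * _ = _
  rw [Complex.conj_natCast]

/-- The kernel `-nm` factors through the sequence `n ↦ n`, whose image under `v*` represents the
moment functional `k ↦ ∑ m (vk)[m]`. -/
theorem compress_separable (hβ : (1 : ℝ) ≤ β) {g : ℕ+ → ℕ+ → ℂ}
    (hg : ∀ n m : ℕ+, g n m = -((n : ℂ) * m)) (hb : ∃ C, KerBound β C g) (k : K) :
    compress v (kerOp β g) k = -(⟪adj v (linSeq hβ), k⟫_ℂ • adj v (linSeq hβ)) := by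
  obtain ⟨C, hC⟩ := hb
  have h1 : kerOp β g (v k) = -(moment (v k).seq • linSeq hβ) := by
    refine LInf.ext (funext fun n => ?_)
    rw [kerOp_seq hC, map_neg, map_smul, Pi.neg_apply, Pi.smul_apply, smul_eq_mul, mul_comm]
    change kerSeq g (v k).seq n = -((n : ℂ) * moment (v k).seq)
    rw [kerSeq, moment, ← tsum_mul_left, ← tsum_neg]
    exact tsum_congr fun m => by rw [hg]; ring
  rw [compress_apply, ContinuousLinearMap.comp_apply, ContinuousLinearMap.comp_apply, h1, map_neg,
    map_smul, adjL_apply, inner_adj_linSeq]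

/-- The `κ²`-coefficient of `M(κ)` is definite on the vectors of `ker M_0` with vanishing moment. -/
theorem eq_zero_of_inner_compress (hV : IsFactored V v U) (hβ : 4 ≤ β) {g : ℕ → ℕ+ → ℕ+ → ℂ}
    (hg0 : g 0 = minKer) {C : ℝ} (hg2 : ∀ n m, ‖g 2 n m‖ ≤ C * minMax 2 n m)
    (hg : HasExp (fun κ => toBOp (Nat.cast_nonneg β) (freeRes κ)) 3 fun j => kerOp β (g j)) {k : K}
    (hk : bsZero v U k = 0) (hm : moment (v k).seq = 0)
    (h : ⟪k, compress v (kerOp β (g 2)) k⟫_ℂ = 0) : k = 0 := by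
  have hβ4 : (4 : ℝ) ≤ β := by exact_mod_cast hβ
  have hb := Nat.cast_nonneg (α := ℝ) β
  have hC : 0 ≤ C := by
    have := (norm_nonneg _).trans (hg2 1 1)
    simpa [minMax] using this
  -- The `κ²` coefficient of `(H₀ + κ²)R₀ = I` says that `H₀` maps the second coefficient to minus
  -- the zeroth.
  have hrel : freeLap (kerSeq (g 2) (v k).seq) = -kerSeq minKer (v k).seq := by
    have h1 : HasExp (fun κ => toBOp hb (freeRes κ) (v k)) 3 fun j => kerOp β (g j) (v k) :=
      hg.map (ContinuousLinearMap.apply ℂ (LInf β) (v k))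
    have h2 := h1.map (freeInfL hb)
    have h3 := h1.relation (p := 0) (y := hilToInf hb (LOne.toHil hb (v k))) h2
      (by
        filter_upwards [eventually_re_pos] with κ hκ
        rw [pow_zero, one_smul, toBOp, ContinuousLinearMap.comp_apply,
          ContinuousLinearMap.comp_apply, freeInfL_hilToInf, ← map_smul, ← map_add]
        congr 1
        exact DFunLike.congr_fun (Ring.mul_inverse_cancel _ (isUnit_free hκ)) _)
      (k := 2) (by norm_num)
    rw [if_pos le_rfl, if_neg (by norm_num), Nat.sub_self, hg0] at h3
    have h4 := congrArg LInf.seq h3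
    rw [map_add, freeInfL_seq, kerOp_seq (kerBound_minKer hV.one_le), map_zero,
      kerOp_seq (kerBound_of_minMax (j := 2) hV.one_le (by push_cast; linarith) hg2)] at h4
    exact eq_neg_of_add_eq_zero_left h4
  -- Summation by parts needs dual spaces. The vanishing moment and `β ≥ 4` put `γ = H₀⁻¹vk` in
  -- `𝓛^2`, while `u = g₂vk` lies in `(𝓛^2)^*` by the uneven weight bound. Then `⟨u, vk⟩ = ⟨u, H₀γ⟩
  -- = ⟨H₀u, γ⟩ = -‖γ‖²`.
  have hmem : kerSeq minKer (v k).seq ∈ l1Sub 2 := by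
    refine Summable.of_nonneg_of_le (fun n => mul_nonneg (weight_pos _ n).le (norm_nonneg _))
      (fun n => ?_) (green_mem_of_moment hV (by omega) hm)
    exact mul_le_mul_of_nonneg_right (weight_mono (by linarith) n) (norm_nonneg _)
  have h3β : ((2 + 1 : ℕ) : ℝ) ≤ β := by push_cast; linarith
  have hu : kerSeq (g 2) (v k).seq ∈ lInfSub 2 := by
    refine ⟨C * ‖LOne.incl h3β (v k)‖, ?_⟩
    rintro _ ⟨n, rfl⟩
    have h1 := (kerSeq_bound (k := g 2) (n := n) (C := C * weight 2 n) (fun m => by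
      rw [mul_assoc]
      exact (hg2 n m).trans (mul_le_mul_of_nonneg_left (minMax_le_right 2 n m) hC))
      (LOne.incl h3β (v k))).2
    rw [LOne.incl_seq] at h1
    calc weight (-2) n * ‖kerSeq (g 2) (v k).seq n‖
        ≤ weight (-2) n * (C * weight 2 n * ‖LOne.incl h3β (v k)‖) :=
          mul_le_mul_of_nonneg_left h1 (weight_pos _ n).le
      _ = (weight (-2) n * weight 2 n) * (C * ‖LOne.incl h3β (v k)‖) := by ring
      _ = _ := by rw [weight_neg_mul, one_mul]
  let γ : LOne 2 := ⟨_, hmem⟩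
  let u : LInf 2 := ⟨_, hu⟩
  have hγ : γ.seq = kerSeq minKer (v k).seq := rfl
  have hu' : u.seq = kerSeq (g 2) (v k).seq := rfl
  have hparts := tsum_freeLap_comm (by norm_num) u γ
  rw [hγ, freeLap_green hV.one_le, hu', hrel] at hparts
  have hinner : ⟪compress v (kerOp β (g 2)) k, k⟫_ℂ =
      ∑' n, starRingEnd ℂ (kerSeq (g 2) (v k).seq n) * (v k).seq n := by
    rw [compress_apply, ContinuousLinearMap.comp_apply, adjL_apply, inner_adj,
      ContinuousLinearMap.comp_apply,
      kerOp_seq (kerBound_of_minMax (j := 2) hV.one_le (by push_cast; linarith) hg2)]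
  rw [← inner_conj_symm, h, map_zero, hparts] at hinner
  have h5 : ∀ n, starRingEnd ℂ ((-kerSeq minKer (v k).seq) n) * kerSeq minKer (v k).seq n =
      ((-‖kerSeq minKer (v k).seq n‖ ^ 2 : ℝ) : ℂ) := fun n => by
    rw [Pi.neg_apply, map_neg, neg_mul, Complex.conj_mul']
    push_cast
    rfl
  rw [tsum_congr h5, ← Complex.ofReal_tsum, tsum_neg] at hinner
  have h6 : ∑' n, ‖kerSeq minKer (v k).seq n‖ ^ 2 = 0 :=
    neg_eq_zero.1 (Complex.ofReal_eq_zero.1 hinner.symm)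
  have h7 := (γ.sq_summable (by norm_num)).1
  rw [hγ] at h7
  have h8 := (hasSum_zero_iff_of_nonneg fun n => by positivity).1 (h6 ▸ h7.hasSum)
  refine (mode_of_bsZero hV hk).2 (funext fun n => ?_)
  have := congrFun h8 n
  simpa using this

/-- The inverse of `M(κ)` has a pole of order at most `p = 0, 1, 2`. -/
theorem exists_bsOp_inverse (hV : IsFactored V v U) {n p : ℕ} (hn : 1 ≤ n) (hβ : β = n + 1 + p)
    (hp : p ≤ 2) (h0 : p = 0 → resEig v U = ⊥) (h1 : p = 1 → eig v U = ⊥) :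
    (∀ᶠ κ in rightZero, IsUnit (bsOp v U κ)) ∧
      ∃ d, HasExp (fun κ => κ ^ p • Ring.inverse (bsOp v U κ)) n d := by
  obtain ⟨g, hg0, hg1, hgb, hg⟩ := exists_free_expansion
  have hg0' : g 0 = minKer := funext fun n => funext fun m => hg0 n m
  have hβn : ((n + p : ℕ) : ℝ) ≤ β := by
    rw [hβ]
    push_cast
    linarith
  -- These are `β - 1` terms; the pole of order `p` will consume `p` of them.
  have hexp := hg β (Nat.cast_nonneg β) (n + p) (by omega) hβn
  have hM := hasExp_bsOp (v := v) U hexp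
  set c : ℕ → K →L[ℂ] K := fun i =>
    (Pi.single 0 U : ℕ → K →L[ℂ] K) i + compress v (kerOp β (g i)) with hc
  have hc0 : c 0 = U + compress v (kerOp β minKer) := by
    simp only [hc, Pi.single_eq_same, hg0']
  have hc0' : c 0 = bsZero v U := hc0
  have hsa : IsSelfAdjoint (c 0) := by
    have := hM.zero_order (by omega)
    rw [hc0'] at this ⊢
    exact isSelfAdjoint_bsZero hV this
  set η := adj v (linSeq hV.one_le) with hη
  have hc1 : ∀ x, c 1 x = -(⟪η, x⟫_ℂ • η) := fun x => by
    obtain ⟨C, -, hC⟩ := hgb 1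
    have : c 1 = compress v (kerOp β (g 1)) := by simp [hc]
    rw [this]
    exact compress_separable hV.one_le hg1
      ⟨C, kerBound_of_minMax hV.one_le (by simpa using hV.one_le) hC⟩ x
  have hc2 : c 2 = compress v (kerOp β (g 2)) := by simp [hc]
  have hcompact := isCompactOperator_bsZero hV
  set N := LinearMap.ker (c 0).toLinearMap with hNdef
  have hN : ∀ x, x ∈ N ↔ c 0 x = 0 := fun x => LinearMap.mem_ker
  have hfin : FiniteDimensional ℂ N := by
    rw [hNdef, hc0]
    exact finiteDimensional_ker_add_compact hV.U_U hcompact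
  set N₂ := N ⊓ LinearMap.ker (innerSL ℂ η).toLinearMap with hN₂def
  have hN₂ : ∀ x, x ∈ N₂ ↔ x ∈ N ∧ ⟪η, x⟫_ℂ = 0 := fun x => Iff.rfl
  have hle : N₂ ≤ N := inf_le_left
  have hfin₂ : FiniteDimensional ℂ N₂ := Submodule.finiteDimensional_of_le hle
  have hmode : ∀ x, x ∈ N₂ → bsZero v U x = 0 ∧ moment (v x).seq = 0 := fun x hx => by
    obtain ⟨hx1, hx2⟩ := (hN₂ x).1 hx
    rw [hη, inner_adj_linSeq] at hx2
    exact ⟨hc0' ▸ (hN x).1 hx1, hx2⟩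
  have hNbot : p = 0 → N = ⊥ := fun hp0 => by
    refine (Submodule.eq_bot_iff _).2 fun x hx => ?_
    exact bsZero_injective_of_resEig hV (by omega) (h0 hp0) (hc0' ▸ (hN x).1 hx)
  have hN₂bot : p ≤ 1 → N₂ = ⊥ := fun hp1 => by
    rcases Nat.eq_zero_or_pos p with hp0 | hp0
    · rw [eq_bot_iff, ← hNbot hp0]
      exact hle
    · refine (Submodule.eq_bot_iff _).2 fun x hx => ?_
      obtain ⟨hx1, hx2⟩ := hmode x hx
      exact eq_zero_of_eig hV (by omega) (h1 (by omega)) hx1 hx2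
  have hdef : ∀ x ∈ N₂, ⟪x, c 2 x⟫_ℂ = 0 → x = 0 := fun x hx hx2 => by
    rcases Nat.lt_or_ge p 2 with hp1 | hp1
    · rw [hN₂bot (by omega)] at hx
      exact (Submodule.mem_bot ℂ).1 hx
    · obtain ⟨hx1, hx3⟩ := hmode x hx
      obtain ⟨C, -, hC⟩ := hgb 2
      rw [hc2] at hx2
      exact eq_zero_of_inner_compress hV (by omega) hg0' hC (hexp.trunc (by omega)) hx1 hx3 hx2
  set P := N.starProjection with hP
  set P₂ := N₂.starProjection with hP₂
  have hPP : P * P = P := N.isIdempotentElem_starProjection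
  have hP22 : P₂ * P₂ = P₂ := N₂.isIdempotentElem_starProjection
  have h2P : P₂ * P = P₂ := Submodule.starProjection_comp_starProjection_of_le hle
  have hP2 : P * P₂ = P₂ := by
    ext x
    exact Submodule.starProjection_eq_self_iff.2 (hle (N₂.starProjection_apply_mem x))
  have hcP : c 0 * P = 0 := by
    ext x
    exact (hN _).1 (N.starProjection_apply_mem x)
  have hcP2 : c 0 * P₂ = 0 := by rw [← hP2, ← mul_assoc, hcP, zero_mul]
  have hcomp : IsCompactOperator
      (compress v (kerOp β minKer) + (c 1 * (P - P₂) + c 2 * P₂)) :=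
    hcompact.add ((((isCompactOperator_starProjection N).sub
      (isCompactOperator_starProjection N₂)).clm_comp (c 1)).add
      ((isCompactOperator_starProjection N₂).clm_comp (c 2)))
  -- The idempotents project onto `N ⊖ N₂` and `N₂`. They vanish as `p` requires, so `c 1` or `c 2`
  -- is used only where that many terms are available.
  refine hM.scaled_inverse hn (P₁ := P - P₂) (P₂ := P₂) (fun hp0 => ?_) (fun hp1 => ?_) ?_ hP22 ?_ ?_
    ?_ hcP2 ?_ ?_
  · ext x
    have hx1 : P x ∈ N := N.starProjection_apply_mem x
    have hx2 : P₂ x ∈ N₂ := N₂.starProjection_apply_mem x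
    rw [hNbot hp0, Submodule.mem_bot] at hx1
    rw [hN₂bot (by omega), Submodule.mem_bot] at hx2
    rw [sub_apply, hx1, hx2, sub_zero, zero_apply]
  · ext x
    have hx2 : P₂ x ∈ N₂ := N₂.starProjection_apply_mem x
    rw [hN₂bot hp1, Submodule.mem_bot] at hx2
    rw [hx2, zero_apply]
  · rw [mul_sub, sub_mul, sub_mul, hPP, hP22, h2P, hP2, sub_self, sub_zero]
  · rw [sub_mul, hP2, hP22, sub_self]
  · rw [mul_sub, h2P, hP22, sub_self]
  · rw [mul_sub, hcP, hcP2, sub_zero]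
  · ext x
    rw [mul_apply_eq_comp, hc1, ((hN₂ _).1 (N₂.starProjection_apply_mem x)).2, zero_smul, neg_zero,
      zero_apply]
  · have hsum : c 0 + c 1 * (P - P₂) + c 2 * P₂ =
        U + (compress v (kerOp β minKer) + (c 1 * (P - P₂) + c 2 * P₂)) := by
      rw [hc0]
      abel
    rw [hsum]
    refine isUnit_of_injective_add_compact hV.U_U hcomp fun x hx => ?_
    rw [← hsum] at hx
    exact scaled_injective hsa hN hN₂ (fun y _ => hc1 y) hdef hx

end Threshold

/-! The resolvent expansion -/

section Resolvent

variable {K : Type*} [NormedAddCommGroup K] [InnerProductSpace ℂ K]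
  {β : ℕ} {V : Hil →L[ℂ] Hil} {v : K →L[ℂ] LOne β} {U : K →L[ℂ] K}

/-- An operator factoring through `K` has kernel entries bounded by a product, so output growth `i`
and input growth `b` combine as a maximum and not as a sum. -/
theorem memB_comp {s : ℝ} {i b k : ℕ} (hib : i ≤ k) (hbk : b ≤ k) (hks : (k : ℝ) ≤ s)
    {T : K →L[ℂ] LInf s} {S : LOne s →L[ℂ] K} (D : K →L[ℂ] K)
    (hT : ∃ C, ∀ n y, ‖(T y).seq n‖ ≤ C * weight i n * ‖y‖)
    (hS : ∃ C, ∀ m, ‖S (LOne.single s m)‖ ≤ C * weight b m) : MemB k ((T.comp D).comp S) := by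
  obtain ⟨C, hT⟩ := hT
  obtain ⟨C', hS⟩ := hS
  have hT0 : ∀ n y, ‖(T y).seq n‖ ≤ |C| * weight k n * ‖y‖ := fun n y => by
    refine (hT n y).trans (mul_le_mul_of_nonneg_right ?_ (norm_nonneg y))
    exact mul_le_mul (le_abs_self C) (weight_mono (by exact_mod_cast hib) n) (weight_pos _ n).le
      (abs_nonneg C)
  have hS0 : ∀ m, ‖S (LOne.single s m)‖ ≤ |C'| * weight k m := fun m =>
    (hS m).trans (mul_le_mul (le_abs_self C') (weight_mono (by exact_mod_cast hbk) m)
      (weight_pos _ m).le (abs_nonneg C'))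
  refine memB_of_kernel (C := |C| * ‖D‖ * |C'|) hks fun n m => ?_
  calc ‖(T (D (S (LOne.single s m)))).seq n‖ ≤ |C| * weight k n * ‖D (S (LOne.single s m))‖ :=
        hT0 n _
    _ ≤ |C| * weight k n * (‖D‖ * (|C'| * weight k m)) := by
        refine mul_le_mul_of_nonneg_left ?_ (mul_nonneg (abs_nonneg C) (weight_pos _ n).le)
        exact (D.le_opNorm _).trans (mul_le_mul_of_nonneg_left (hS0 m) (norm_nonneg D))
    _ = _ := by ring

/-- The factor `v` takes values in `𝓛^{i+1}` and pays for the larger weight, so the output grows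
only like the weight `i`. -/
theorem norm_kerOp_apply_le {s : ℝ} (hs : 1 ≤ s) (hsβ : s ≤ β) {g : ℕ+ → ℕ+ → ℂ} {i : ℕ}
    (hi : ((i + 1 : ℕ) : ℝ) ≤ s) {C : ℝ} (hC : 0 ≤ C) (hg : ∀ n m, ‖g n m‖ ≤ C * minMax i n m) :
    ∃ C, ∀ n y, ‖((kerOp s g).comp ((LOne.incl hsβ).comp v) y).seq n‖ ≤ C * weight i n * ‖y‖ := by
  have hi' : (i : ℝ) ≤ s := le_trans (by push_cast; linarith) hi
  refine ⟨C * ‖(LOne.incl (hi.trans hsβ)).comp v‖, fun n y => ?_⟩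
  rw [ContinuousLinearMap.comp_apply, kerOp_seq (kerBound_of_minMax hs hi' hg),
    ContinuousLinearMap.comp_apply, LOne.incl_seq, ← LOne.incl_seq (hi.trans hsβ)]
  refine (kerSeq_bound (C := C * weight i n) (fun m => ?_) _).2.trans ?_
  · rw [mul_assoc]
    exact (hg n m).trans (mul_le_mul_of_nonneg_left (minMax_le_right i n m) hC)
  · have h1 := ((LOne.incl (hi.trans hsβ)).comp v).le_opNorm y
    calc _ ≤ C * weight i n * (‖(LOne.incl (hi.trans hsβ)).comp v‖ * ‖y‖) :=
          mul_le_mul_of_nonneg_left h1 (mul_nonneg hC (weight_pos _ n).le)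
      _ = _ := by ring

variable [CompleteSpace K]

theorem toBOp_resolv (hV : IsFactored V v U) {s : ℝ} (hs : 0 ≤ s) (hsβ : s ≤ β) {κ : ℂ}
    (hκ : 0 < κ.re) (hM : IsUnit (bsOp v U κ)) :
    toBOp hs (resolv V κ) = toBOp hs (freeRes κ) -
      ((toBOp hs (freeRes κ)).comp ((LOne.incl hsβ).comp v)).comp ((Ring.inverse (bsOp v U κ)).comp
        ((adjL ((LOne.incl hsβ).comp v)).comp (toBOp hs (freeRes κ)))) := by
  have h1 : toHilOp v = (LOne.toHil hs).comp ((LOne.incl hsβ).comp v) := by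
    ext k n
    rw [ContinuousLinearMap.comp_apply, LOne.toHil_apply, ContinuousLinearMap.comp_apply,
      LOne.incl_seq]
    rfl
  have h2 : ContinuousLinearMap.adjoint (toHilOp v) =
      (adjL ((LOne.incl hsβ).comp v)).comp (hilToInf hs) := by
    rw [adjoint_toHilOp]
    ext x
    exact adj_congr (fun k => (LOne.incl_seq hsβ (v k)).symm) rfl
  rw [(resolv_eq hV hκ hM).2, h2]
  ext x
  simp only [toBOp, ContinuousLinearMap.comp_apply, sub_apply, map_sub]
  rw [h1]
  rfl

/-- The mirror estimate: here the decay of `v` is spent on the summed variable, leaving growth `b`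
in the column index. -/
theorem norm_adj_kerOp_single_le {s : ℝ} (hs : 1 ≤ s) (hsβ : s ≤ β) {g : ℕ+ → ℕ+ → ℂ} {b : ℕ}
    (hb : ((b + 1 : ℕ) : ℝ) ≤ s) {C : ℝ} (hC : 0 ≤ C) (hg : ∀ n m, ‖g n m‖ ≤ C * minMax b n m) :
    ∃ C, ∀ m, ‖(adjL ((LOne.incl hsβ).comp v)).comp (kerOp s g) (LOne.single s m)‖ ≤
      C * weight b m := by
  have hb' : (b : ℝ) ≤ s := le_trans (by push_cast; linarith) hb
  set w := (LOne.incl (hb.trans hsβ)).comp v with hw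
  refine ⟨C * ‖w‖, fun m => ?_⟩
  rw [ContinuousLinearMap.comp_apply, adjL_apply]
  refine norm_adj_le_of (mul_nonneg (mul_nonneg hC (norm_nonneg _)) (weight_pos _ m).le) _ _
    fun k => ?_
  have hwk : (w k).seq = (v k).seq := by
    rw [hw, ContinuousLinearMap.comp_apply, LOne.incl_seq]
  have h1 : ∀ n, ‖starRingEnd ℂ ((kerOp s g (LOne.single s m)).seq n) *
      (((LOne.incl hsβ).comp v) k).seq n‖ ≤
        C * weight b m * (weight (b + 1 : ℕ) n * ‖(w k).seq n‖) := by
    intro n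
    rw [norm_mul, RCLike.norm_conj, kerOp_single (kerBound_of_minMax hs hb' hg),
      ContinuousLinearMap.comp_apply, LOne.incl_seq, hwk, ← mul_assoc]
    refine mul_le_mul_of_nonneg_right ((hg n m).trans ?_) (norm_nonneg _)
    calc C * minMax b n m ≤ C * (weight (b + 1 : ℕ) n * weight b m) :=
          mul_le_mul_of_nonneg_left (minMax_le_left b n m) hC
      _ = _ := by ring
  have h2 := tsum_of_norm_bounded ((w k).summable.hasSum.mul_left (C * weight b m)) h1
  rw [← LOne.norm_def] at h2
  refine h2.trans ?_
  calc _ ≤ C * weight b m * (‖w‖ * ‖k‖) :=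
        mul_le_mul_of_nonneg_left (w.le_opNorm k) (mul_nonneg hC (weight_pos _ m).le)
    _ = _ := by ring

theorem exists_resolv_expansion (hV : IsFactored V v U) {n p s : ℕ} (hs : s = n + 1) (hn : 1 ≤ n)
    (hβ : β = n + 1 + p) (hinv : ∀ᶠ κ in rightZero, IsUnit (bsOp v U κ)) {d : ℕ → K →L[ℂ] K}
    (hd : HasExp (fun κ => κ ^ p • Ring.inverse (bsOp v U κ)) n d) :
    ∃ G : ℤ → BOp s,
      HasExp (fun κ => κ ^ p • toBOp (Nat.cast_nonneg s) (resolv V κ)) n (fun k => G (k - p)) ∧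
      (∀ k < n, ∀ t : ℝ, k ≤ t → (p ≤ k → 1 ≤ t) → t ≤ s → MemB t (G (k - p))) ∧
      ∀ j < -(p : ℤ), G j = 0 := by
  obtain ⟨g, -, -, hgb, hg⟩ := exists_free_expansion
  choose C hC hgb using hgb
  have hsβ : (s : ℝ) ≤ β := by
    rw [hs, hβ]
    push_cast
    linarith
  have hs1 : (1 : ℝ) ≤ s := by
    rw [hs]
    push_cast
    linarith [Nat.cast_nonneg (α := ℝ) n]
  have hns : (n : ℝ) ≤ s := by
    rw [hs]
    push_cast
    linarith
  have hA := hg s (Nat.cast_nonneg s) n hn hns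
  set w : K →L[ℂ] LOne s := (LOne.incl hsβ).comp v with hw
  have hT : HasExp (fun κ => (toBOp (Nat.cast_nonneg s) (freeRes κ)).comp w) n
      fun i => (kerOp s (g i)).comp w :=
    hA.map ((ContinuousLinearMap.compL ℂ K (LOne s) (LInf s)).flip w)
  have hS : HasExp (fun κ => (adjL w).comp (toBOp (Nat.cast_nonneg s) (freeRes κ))) n
      fun i => (adjL w).comp (kerOp s (g i)) :=
    hA.map (ContinuousLinearMap.compL ℂ (LOne s) (LInf s) K (adjL w))
  have hX := HasExp.bilin (ContinuousLinearMap.compL ℂ (LOne s) K (LInf s))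
    (HasExp.bilin (ContinuousLinearMap.compL ℂ K K (LInf s)) hT hd) hS
  -- Coefficients of the triple Cauchy product `R₀v · κ^pM⁻¹ · v*R₀`. Both outer indices are at most
  -- `k`, so the `k`-th one lies in `𝓑^k`.
  set X : ℕ → BOp s := fun k => ∑ q ∈ Finset.HasAntidiagonal.antidiagonal k,
    ContinuousLinearMap.compL ℂ (LOne s) K (LInf s)
      (∑ r ∈ Finset.HasAntidiagonal.antidiagonal q.1, ContinuousLinearMap.compL ℂ K K (LInf s)
        ((kerOp s (g r.1)).comp w) (d r.2)) ((adjL w).comp (kerOp s (g q.2))) with hXdef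
  have hXmem : ∀ k < n, MemB k (X k) := by
    intro k hk
    have hks : ((k + 1 : ℕ) : ℝ) ≤ s := by
      rw [hs]
      exact_mod_cast (by omega : k + 1 ≤ n + 1)
    have hks' : (k : ℝ) ≤ s := le_trans (by push_cast; linarith) hks
    refine MemB.sum hks' fun q hq => ?_
    rw [map_sum, sum_apply]
    refine MemB.sum hks' fun r hr => ?_
    rw [Finset.HasAntidiagonal.mem_antidiagonal] at hq hr
    have hle : ∀ i ≤ k, ((i + 1 : ℕ) : ℝ) ≤ s := fun i hi =>
      le_trans (by exact_mod_cast (by omega : i + 1 ≤ k + 1)) hks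
    exact memB_comp (i := r.1) (b := q.2) (by omega) (by omega) hks' (d r.2)
      (norm_kerOp_apply_le hs1 hsβ (hle _ (by omega)) (hC r.1) (hgb r.1))
      (norm_adj_kerOp_single_le hs1 hsβ (hle _ (by omega)) (hC q.2) (hgb q.2))
  have hexp := ((hA.shift p).trunc (Nat.le_add_right n p)).sub hX
  -- The free part enters only from `j = 0` on, i.e. `k = j + p ≥ p`, since it was multiplied by
  -- `κ^p`; it alone forces weight at least `1`.
  refine ⟨fun j => if -(p : ℤ) ≤ j then
    (if p ≤ (j + p).toNat then kerOp s (g ((j + p).toNat - p)) else 0) - X (j + p).toNat else 0,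
    ?_, ?_, ?_⟩
  · refine (hexp.congr ?_).congr_coeff fun k _ => ?_
    · filter_upwards [hinv, eventually_re_pos] with κ hu hκ
      rw [toBOp_resolv hV (Nat.cast_nonneg s) hsβ hκ hu, smul_sub]
      congr 1
      ext1 x
      simp only [ContinuousLinearMap.compL_apply, ContinuousLinearMap.comp_apply, smul_apply,
        map_smul, hw]
    · have e1 : ((k : ℤ) - p + p).toNat = k := by omega
      beta_reduce
      rw [if_pos (show -(p : ℤ) ≤ (k : ℤ) - p by omega), e1]
  · intro k hk t hkt h1t hts
    have e1 : ((k : ℤ) - p + p).toNat = k := by omega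
    beta_reduce
    rw [if_pos (by omega), e1]
    refine MemB.sub ?_ ((hXmem k hk).mono hkt hts)
    split_ifs with hpk
    · have hkp : ((k - p : ℕ) : ℝ) ≤ t := le_trans (by exact_mod_cast Nat.sub_le k p) hkt
      refine memB_of_kernel hts (C := C (k - p)) fun a b => ?_
      beta_reduce
      rw [kerOp_single (kerBound_of_minMax hs1 (hkp.trans hts) (hgb (k - p)))]
      exact kerBound_of_minMax (h1t hpk) hkp (hgb (k - p)) a b
    · exact MemB.zero hts
  · intro j hj
    beta_reduce
    rw [if_neg (by omega)]

/-- The relations between the coefficients. -/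
theorem coeff_relations (hV : IsFactored V v U) {s : ℝ} (hs : 0 ≤ s) (hsβ : s ≤ β) {n p : ℕ}
    {G : ℤ → BOp s}
    (hinv : ∀ᶠ κ in rightZero, IsUnit (freeHil + V + κ ^ 2 • (1 : Hil →L[ℂ] Hil)))
    (hG : HasExp (fun κ => κ ^ p • toBOp hs (resolv V κ)) n fun k => G (k - p))
    (h0 : ∀ j < -(p : ℤ), G j = 0) {j : ℤ} (hj : j ≤ n - 1 - p) (x : LOne s) :
    hamInf v U hs hsβ (G j x) + G (j - 2) x =
        (if j = 0 then hilToInf hs (LOne.toHil hs x) else 0) ∧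
      G j (hamOne v U hs hsβ x) + G (j - 2) x =
        if j = 0 then hilToInf hs (LOne.toHil hs x) else 0 := by
  rcases lt_or_ge j (-(p : ℤ)) with hjp | hjp
  · rw [h0 j hjp, h0 (j - 2) (by omega), if_neg (by omega)]
    simp
  obtain ⟨k, rfl⟩ : ∃ k : ℕ, j = (k : ℤ) - p := ⟨(j + p).toNat, by omega⟩
  have hk : k < n := by omega
  have hGx : ∀ y : LOne s, HasExp (fun κ => κ ^ p • toBOp hs (resolv V κ) y) n
      fun k => G (k - p) y := fun y => hG.map (ContinuousLinearMap.apply ℂ (LInf s) y)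
  -- The first two relations have no predecessor in the expansion; there the convention `G_j = 0`
  -- below `-p` supplies the missing term.
  have hshift : (if 2 ≤ k then G (((k - 2 : ℕ) : ℤ) - p) x else 0) = G ((k : ℤ) - p - 2) x := by
    split_ifs with h2
    · congr 2
      omega
    · rw [h0 _ (by omega), zero_apply]
  have hif : ∀ y : LInf s, (if k = p then y else 0) = if (k : ℤ) - p = 0 then y else 0 := fun y => by
    congr 1
    exact propext ⟨fun h => by omega, fun h => by omega⟩
  rw [← hshift, ← hif]
  constructor
  · refine HasExp.relation (hGx x) ((hGx x).map (hamInfL v U hs hsβ)) ?_ hk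
    filter_upwards [hinv] with κ hu
    have h1 : hamInfL v U hs hsβ (toBOp hs (resolv V κ) x) + κ ^ 2 • toBOp hs (resolv V κ) x =
        hilToInf hs (LOne.toHil hs x) := by
      rw [toBOp, ContinuousLinearMap.comp_apply, ContinuousLinearMap.comp_apply, hamInfL_apply,
        hamInf_hilToInf hV, ← map_smul, ← map_add]
      congr 1
      exact DFunLike.congr_fun (Ring.mul_inverse_cancel _ hu) _
    rw [map_smul, smul_comm (κ ^ 2), ← smul_add, h1]
  · refine HasExp.relation (hGx x) (hGx (hamOne v U hs hsβ x)) ?_ hk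
    filter_upwards [hinv] with κ hu
    have h1 : toBOp hs (resolv V κ) (hamOne v U hs hsβ x) + κ ^ 2 • toBOp hs (resolv V κ) x =
        hilToInf hs (LOne.toHil hs x) := by
      simp only [toBOp, ContinuousLinearMap.comp_apply]
      rw [toHil_hamOne hV, ← map_smul, ← map_smul, ← map_add, ← map_add]
      congr 1
      exact DFunLike.congr_fun (Ring.inverse_mul_cancel _ hu) _
    rw [smul_comm (κ ^ 2), ← smul_add, h1]

/-- The coefficient of `κ⁻²` is the projection onto the zero eigenspace. -/
theorem coeff_neg_two (hV : IsFactored V v U) {s : ℝ} (hs : 0 ≤ s) {n p : ℕ} (hp : p ≤ 2)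
    (hpn : p + 1 ≤ n) {G : ℤ → BOp s}
    (hinv : ∀ᶠ κ in rightZero, IsUnit (freeHil + V + κ ^ 2 • (1 : Hil →L[ℂ] Hil)))
    (hG : HasExp (fun κ => κ ^ p • toBOp hs (resolv V κ)) n fun k => G (k - p))
    (h0 : ∀ j < -(p : ℤ), G j = 0) (x : LOne s) :
    G (-2) x = hilToInf hs
      ((LinearMap.ker (freeHil + V).toLinearMap).starProjection (LOne.toHil hs x)) := by
  have hGx : HasExp (fun κ => κ ^ p • toBOp hs (resolv V κ) x) n
      fun k => G (k - p) x := hG.map (ContinuousLinearMap.apply ℂ (LInf s) x)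
  have h1 := (hGx.shift (2 - p)).zero_order (by omega)
  -- The extra factor `κ^{2-p}` turns `κ^pR` into `κ²R`, whose limit is `G₋₂`. For `p ≤ 1` this
  -- limit is the conventional `0`, so the projection vanishes too.
  have h2 : (if 2 - p ≤ 0 then G (((0 - (2 - p) : ℕ) : ℤ) - p) x else 0) = G (-2) x := by
    split_ifs with h
    · obtain rfl : p = 2 := by omega
      rfl
    · rw [h0 _ (by omega), zero_apply]
  rw [h2] at h1
  obtain ⟨κ, hκ, hlim⟩ := tendsto_sq_resolv hV.isSelfAdjoint hinv
  refine tendsto_nhds_unique (h1.comp hκ)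
    ((((hilToInf hs).continuous.tendsto _).comp (hlim (LOne.toHil hs x))).congr fun t => ?_)
  rw [Function.comp_apply, Function.comp_apply, smul_smul, ← pow_add,
    show 2 - p + p = 2 by omega, map_smul]
  rfl

end Resolvent

/-- The numbers attached to a threshold type: `p` is the order of the pole, `n` the number of
terms. -/
theorem ThresholdType.exists_params {K : Type*} [NormedAddCommGroup K] [InnerProductSpace ℂ K]
    [CompleteSpace K] {β : ℕ} {v : K →L[ℂ] LOne β} {U : K →L[ℂ] K} {τ : ThresholdType}
    (hτ : τ.Holds v U) (hβ : τ.minBeta ≤ β) : ∃ p n : ℕ, 1 ≤ n ∧ β = n + 1 + p ∧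
      τ.space β = n + 1 ∧ τ.jMin = -(p : ℤ) ∧ τ.jMax β = (n : ℤ) - 1 - p ∧ p ≤ 2 ∧
      (p = 0 → resEig v U = ⊥) ∧ (p = 1 → eig v U = ⊥) ∧
      ∀ k : ℕ, k < n → (k : ℤ) ≤ τ.coeffSpace (k - p) ∧
        (p ≤ k → 1 ≤ τ.coeffSpace (k - p)) ∧ τ.coeffSpace (k - p) ≤ (n + 1 : ℕ) := by
  cases τ
  · have h2 : 2 ≤ β := hβ
    refine ⟨0, β - 1, by omega, by omega, ?_, rfl, ?_, by omega, fun _ => hτ.1, by omega,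
      fun k hk => ?_⟩
    · simp only [space]
      omega
    · simp only [jMax]
      omega
    · simp only [coeffSpace, Int.even_iff]
      split_ifs <;> refine ⟨?_, ?_, ?_⟩ <;> omega
  · have h2 : 3 ≤ β := hβ
    refine ⟨1, β - 2, by omega, by omega, ?_, rfl, ?_, by omega, by omega, fun _ => hτ.2,
      fun k hk => ?_⟩
    · simp only [space]
      omega
    · simp only [jMax]
      omega
    · simp only [coeffSpace, Int.even_iff]
      split_ifs <;> refine ⟨?_, ?_, ?_⟩ <;> omega
  all_goals
    have h2 : 4 ≤ β := hβ
    refine ⟨2, β - 3, by omega, by omega, ?_, rfl, ?_, by omega, by omega, by omega,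
      fun k hk => ?_⟩
    · simp only [space]
      omega
    · simp only [jMax]
      omega
    · simp only [coeffSpace, Int.even_iff]
      split_ifs <;> refine ⟨?_, ?_, ?_⟩ <;> omega

end HalfLine

end

/-! ### Assembly of the resolvent expansion and its relations -/

theorem mainTheorem8 {K : Type*} [NormedAddCommGroup K] [InnerProductSpace ℂ K] [CompleteSpace K]
    (β : ℕ) (V : Hil →L[ℂ] Hil) (v : K →L[ℂ] LOne β) (U : K →L[ℂ] K)
    (hV : IsFactored V v U) (τ : ThresholdType) (hτ : τ.Holds v U) (hβ : τ.minBeta ≤ β) :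
    ∃ P₀ : Hil →L[ℂ] Hil,
      IsStarProjection P₀ ∧ (LinearMap.range P₀.toLinearMap).map hilSeq = eig v U ∧
      (∃ G : ℤ → BOp (τ.space β), IsExpansion V β τ G) ∧
      ∀ G : ℤ → BOp (τ.space β), IsExpansion V β τ G →
        (∀ j : ℤ, (j = -2 ∨ j = -1) → j ≤ τ.jMax β → ∀ x : LOne (τ.space β),
          hamInf v U (τ.space_nonneg β) (τ.space_le β) (G j x) = 0 ∧
          G j (hamOne v U (τ.space_nonneg β) (τ.space_le β) x) = 0) ∧
        (0 ≤ τ.jMax β → ∀ x : LOne (τ.space β),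
          hamInf v U (τ.space_nonneg β) (τ.space_le β) (G 0 x) =
            toBOp (τ.space_nonneg β) (1 - P₀) x ∧
          G 0 (hamOne v U (τ.space_nonneg β) (τ.space_le β) x) =
            toBOp (τ.space_nonneg β) (1 - P₀) x) ∧
        (∀ j : ℤ, 1 ≤ j → j ≤ τ.jMax β → ∀ x : LOne (τ.space β),
          hamInf v U (τ.space_nonneg β) (τ.space_le β) (G j x) = -G (j - 2) x ∧
          G j (hamOne v U (τ.space_nonneg β) (τ.space_le β) x) = -G (j - 2) x) := by
  obtain ⟨p, n, hn, hβn, hs, hmin, hmax, hp, h0, h1, hcoeff⟩ := τ.exists_params hτ hβ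
  have hexp : ∀ G : ℤ → BOp (τ.space β),
      HasExp (fun κ => κ ^ p • toBOp (τ.space_nonneg β) (resolv V κ)) n (fun k => G (k - p)) ↔
      (fun κ : ℂ => toBOp (τ.space_nonneg β) (resolv V κ) -
        ∑ j ∈ Finset.Icc τ.jMin (τ.jMax β), κ ^ j • G j) =O[rightZero]
          fun κ : ℂ => κ ^ (τ.jMax β + 1) := fun G => by
    have h := hasExp_iff_zpow (fun κ => toBOp (τ.space_nonneg β) (resolv V κ)) p n G
    rw [hmin, hmax, show (n : ℤ) - 1 - p + 1 = n - p by ring]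
    exact h
  refine ⟨(LinearMap.ker (freeHil + V).toLinearMap).starProjection, isStarProjection_starProjection,
    ?_, ?_, fun G hG => ?_⟩
  -- `P₀` projects onto the closed kernel of `H` in `ℓ²`, so closedness of `𝖤` is part of this
  -- identification.
  · rw [← map_ker_eq_eig hV (by omega)]
    congr 1
    exact Submodule.range_starProjection _
  · obtain ⟨hu, d, hd⟩ := exists_bsOp_inverse hV hn hβn hp h0 h1
    obtain ⟨G, hG1, hG2, hG3⟩ := exists_resolv_expansion hV hs hn hβn hu hd
    refine ⟨G, ?_, (hexp G).1 hG1, fun j hj => ?_, fun j hj => hG3 j (hmin ▸ hj)⟩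
    · filter_upwards [hu, eventually_re_pos] with κ hκ hre
      exact (resolv_eq hV hre hκ).1
    · rw [hmin, hmax, Finset.mem_Icc] at hj
      obtain ⟨k, rfl⟩ : ∃ k : ℕ, j = (k : ℤ) - p := ⟨(j + p).toNat, by omega⟩
      obtain ⟨h2, h3, h4⟩ := hcoeff k (by omega)
      refine hG2 k (by omega) _ (by exact_mod_cast h2) (fun hpk => by exact_mod_cast h3 hpk) ?_
      rw [hs]
      exact_mod_cast h4
  · have hG0 : ∀ j < -(p : ℤ), G j = 0 := fun j hj => hG.eq_zero j (by rw [hmin]; exact hj)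
    have hrel : ∀ j ≤ τ.jMax β, ∀ x, _ := fun j hj x => coeff_relations hV (τ.space_nonneg β)
      (τ.space_le β) hG.invertible ((hexp G).2 hG.expansion) hG0 (hmax ▸ hj) x
    refine ⟨fun j hj hjmax x => ?_, fun hmax0 x => ?_, fun j hj hjmax x => ?_⟩
    · have h2 := hrel j hjmax x
      -- For these `j` the index `j - 2` is at most `-3`, below every possible pole.
      rw [hG0 (j - 2) (by omega), if_neg (by omega), zero_apply, add_zero, add_zero] at h2
      exact h2
    · have h2 := hrel 0 hmax0 x
      have h3 := coeff_neg_two hV (τ.space_nonneg β) hp (by omega) hG.invertible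
        ((hexp G).2 hG.expansion) hG0 x
      rw [if_pos rfl, zero_sub, h3] at h2
      have h4 : toBOp (τ.space_nonneg β)
          (1 - (LinearMap.ker (freeHil + V).toLinearMap).starProjection) x =
          hilToInf (τ.space_nonneg β) (LOne.toHil (τ.space_nonneg β) x) -
          hilToInf (τ.space_nonneg β) ((LinearMap.ker (freeHil + V).toLinearMap).starProjection
            (LOne.toHil (τ.space_nonneg β) x)) := by
        rw [← map_sub]
        rfl
      rw [h4]
      exact ⟨eq_sub_of_add_eq h2.1, eq_sub_of_add_eq h2.2⟩
    · have h2 := hrel j hjmax x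
      rw [if_neg (by omega)] at h2
      exact ⟨eq_neg_of_add_eq_zero_left h2.1, eq_neg_of_add_eq_zero_left h2.2⟩
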